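/- **Proposition (Hadamard identity for ordered $q$-exponential integrals).** Let $q\in\mathbb C^*$ be not a root of unity. Let $V$ be a complex vector space with a space $D\subset V^*$ of linear functionals that separates the points of $V$. Let $x(z)=\sum_{m\in\mathbb Z}x_m z^{-m}$ with $x_m\in\operatorname{End}(V)$ be a field of highest weight type: for every $v\in V$, $x_mv=0$ for all sufficiently large $m$. Put $X_n=(\mathbb C^*)^n\setminus\bigcup_{i\ne j}\{z_i=qz_j\}$. Assume that $x(z)$ is *almost commutative with two poles*: for all $n\ge 0$, $\varphi\in D$, $v\in V$ the series of $\langle\varphi,x(z_1)\cdots x(z_n)v\rangle$ converges absolutely in a region $|z_1|\gg|z_2|\gg\cdots\gg|z_n|>0$, and its sum continues to a meromorphic function on $(\mathbb C^*)^n$ which has at most simple poles along the shifted diagonals $z_i=qz_j$ $(i\neq j)$, has no other singularities, and is symmetric in $z_1,\dots,z_n$ on $X_n$. *Contours.* All contours enclose the origin. A contour of kind $C$ for a variable $z$ has the points $z=qw$ outside and $z=q^{-1}w$ inside; one of kind $C'$ has the points $z=qw$ inside and $z=q^{-1}w$ outside, where $w$ runs over the other variables. In iterated integrals the inner contours move with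 the outer variables; poles $z=q^{k}w$ and $z=q^{-k}w$, $k\ge2$, that are created by inner integrations lie on the same side as $z=qw$ and $z=q^{-1}w$ respectively. Products of $x$'s under the integral are understood, in matrix coefficients, as analytically continued, and such integrals represent operators on $V$. *Ordered exponential.* $$E_q:=\mathcal P\overrightarrow{\exp}_q\Bigl(\tfrac1{2\pi i}\oint x(z)\tfrac{dz}{z}\Bigr)=1+\sum_{n>0}\frac{1}{n!(2\pi i)^n}\oint_{C_1}\frac{dz_1}{z_1}\cdots\oint_{C_n}\frac{dz_n}{z_n}\,x(z_1)\cdots x(z_n),$$ with all contours of kind $C$, as a formal series graded by the number of factors $x$. *$q$-commutator.* On (linear combinations of) iterated integrals, $$ad_q\tfrac{1}{2\pi i}\oint x(z)\tfrac{dz}{z}\Bigl(\tfrac1{(2\pi i)^n}\oint\tfrac{dw_1}{w_1}\cdots\oint\tfrac{dw_n}{w_n}A(w_1,\dots,w_n)\Bigr)$$ $$=\tfrac1{(2\pi i)^{n+1}}\Bigl(\oint\tfrac{dw_1}{w_1}\cdots\oint\tfrac{dw_n}{w_n}\oint_{C}\tfrac{dz}{z}\,x(z)A(w_1,\dots,w_n)-\oint\tfrac{dw_1}{w_1}\cdots\oint\tfrac{dw_n}{w_n}\oint_{C'}\tfrac{dz}{z}\,A(w_1,\dots,w_n)x(z)\Bigr),$$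 where $C$ is of kind $C$ and $C'$ of kind $C'$. The iterates $ad_q^n\frac{1}{2\pi i}\oint x(z)\frac{dz}{z}(A)$ start from an operator $A$ (the case $n=0$), and their integrands are signed sums of products $x(z_1)\cdots x(z_k)\,A\,x(w_l)\cdots x(w_1)$. Since $A$ is arbitrary there is no continuation across $A$: the products on the left and on the right of $A$ are continued and integrated separately, each with the prescribed contours, and composed with $A$. Then, for every operator $A\in\operatorname{End}(V)$, all these integrals exist as operators on $V$, the formal series $E_q$ is invertible, and the following identity of formal series holds (graded by the number of factors $x$): $$E_q\,A\,E_q^{-1}=A+\sum_{n>0}\frac1{n!}\,ad_q^n\Bigl(\tfrac{1}{2\pi i}\oint x(z)\tfrac{dz}{z}\Bigr)(A).$$ -/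

import Mathlib

open Filter Topology

noncomputable section

namespace QExp

/-! ### Fields and analytic continuation of their products

A field is given by its modes `x : ℤ → Module.End ℂ V`, so that `x(z) = ∑ m, x m * z ^ (-m)`, acting
on a complex vector space `V`. Products of fields are understood through their matrix coefficients
`⟨φ, x(z₁) ⋯ x(zₙ) v⟩`, where `v` runs over `V` and `φ` over a space `D` of linear functionals. -/

/-- The torus `(ℂ*)ⁿ`. -/
def torus (n : ℕ) : Set (Fin n → ℂ) := {z | ∀ i, z i ≠ 0}

/-- `Xₙ`: the torus without the shifted diagonals `zᵢ = q zⱼ`, `i ≠ j`. -/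
def regularSet (q : ℂ) (n : ℕ) : Set (Fin n → ℂ) :=
  {z | z ∈ torus n ∧ ∀ i j, i ≠ j → z i ≠ q * z j}

/-- The region `|z₁| ≫ |z₂| ≫ ⋯ ≫ |zₙ| > 0`, with `≫` meaning "larger by a factor more than `R`". -/
def orderedRegion (R : ℝ) (n : ℕ) : Set (Fin n → ℂ) :=
  {z | z ∈ torus n ∧ ∀ i j, i < j → R * ‖z j‖ < ‖z i‖}

section Fields

variable {V : Type*} [AddCommGroup V] [Module ℂ V]

/-- The product of modes `x_{m₁} x_{m₂} ⋯ x_{mₙ}`. -/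
def modeProduct (x : ℤ → Module.End ℂ V) {n : ℕ} (m : Fin n → ℤ) : Module.End ℂ V :=
  (List.ofFn fun i => x (m i)).prod

/-- `G` is the analytic continuation of the matrix coefficient `⟨φ, x(z₁) ⋯ x(zₙ) v⟩`: the Laurent
series of the matrix coefficient converges to `G` in a region `|z₁| ≫ ⋯ ≫ |zₙ| > 0`, and `G` is
meromorphic in `(ℂ*)ⁿ` with at most simple poles along `zᵢ = q zⱼ`, `i ≠ j`, and no other
singularities. -/
structure IsContinuation (q : ℂ) (x : ℤ → Module.End ℂ V) (φ : Module.Dual ℂ V) (v : V) (n : ℕ)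
    (G : (Fin n → ℂ) → ℂ) : Prop where
  analytic : AnalyticOnNhd ℂ G (regularSet q n)
  simple_poles : ∃ F : (Fin n → ℂ) → ℂ, AnalyticOnNhd ℂ F (torus n) ∧
    ∀ z ∈ regularSet q n,
      F z = (∏ i, ∏ j, if i ≠ j then z i - q * z j else 1) * G z
  expansion : ∃ R : ℝ, 0 < R ∧ ∀ z ∈ orderedRegion R n,
    HasSum (fun m : Fin n → ℤ => φ (modeProduct x m v) * ∏ i, z i ^ (-m i)) (G z)

/-- `x(z)` is an almost commutative function with two poles: each product `x(z₁) ⋯ x(zₙ)` has an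
analytic continuation as in `IsContinuation`, and this continuation is symmetric on `Xₙ`. -/
def IsAlmostCommutative (D : Submodule ℂ (Module.Dual ℂ V)) (q : ℂ) (x : ℤ → Module.End ℂ V) :
    Prop :=
  ∀ n : ℕ, ∀ φ ∈ D, ∀ v : V, ∃ G : (Fin n → ℂ) → ℂ, IsContinuation q x φ v n G ∧
    ∀ σ : Equiv.Perm (Fin n), ∀ z ∈ regularSet q n, G (z ∘ σ) = G z

end Fields

/-! ### Contour integrals -/

/-- The two kinds of contours. All of them enclose the origin. For a variable `z` on a contour of
kind `C` the points `z = q⁻¹ w` are inside and the points `z = q w` outside, and for a contour of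
kind `C'` the points `z = q w` are inside and the points `z = q⁻¹ w` outside, where `w` runs over
the other variables of the integrand. -/
inductive Contour
  | C
  | C'

/-- The points inside a contour are the `r ^ k * w`, `k ≥ 1`, with this ratio `r`. -/
def Contour.insideRatio (q : ℂ) : Contour → ℂ
  | .C => q⁻¹
  | .C' => q

open Classical in
/-- The points `r ^ k * wⱼ`, `1 ≤ k ≤ N`. The points with `k = 1` are the prescribed poles of the
integrand; those with `k ≥ 2` are the poles which the integrations over previous variables may
create, and they are on the same side of the contour as the points with `k = 1`. -/
def insidePoints (r : ℂ) (N : ℕ) {m : ℕ} (w : Fin m → ℂ) : Finset ℂ :=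
  Finset.univ.image fun p : Fin N × Fin m => r ^ ((p.1 : ℕ) + 1) * w p.2

open Classical in
/-- `(2πi)⁻¹ ∮ g(z) dz/z` over a contour which encloses the origin and the points of `S` and no
further singularity of `g` in `ℂ*`. The contour is taken to be the cycle of all circles of radius
`ε` about the origin and the points of `S`; the value does not depend on `ε` once `ε` is small. -/
def contourIntegral (S : Finset ℂ) (g : ℂ → ℂ) : ℂ :=
  limUnder (𝓝[>] (0 : ℝ)) fun ε =>
    (2 * Real.pi * Complex.I)⁻¹ * ∑ p ∈ insert 0 S, circleIntegral (fun z => g z / z) p ε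

/-- The iterated integral `(2πi)⁻ⁿ ∮_{Cₙ} dzₙ/zₙ ⋯ ∮_{C₁} dz₁/z₁ g(z₁, …, zₙ)`, whose contours are of
the kinds given by the list; the integral over `z₁` is the innermost one, and the contour of each
variable is positioned with respect to the variables after it in the list. `N` bounds the powers of
`q` that are taken into account. -/
def iteratedIntegral (q : ℂ) (N : ℕ) : (cs : List Contour) → ((Fin cs.length → ℂ) → ℂ) → ℂ
  | [], g => g Fin.elim0
  | c :: cs, g => iteratedIntegral q N cs fun w =>
      contourIntegral (insidePoints (c.insideRatio q) N w) fun z =>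
        g (Fin.cons (α := fun _ : Fin (cs.length + 1) => ℂ) z w)

section Operators

variable {V : Type*} [AddCommGroup V] [Module ℂ V]

/-- `T` is the operator `(2πi)⁻ⁿ ∮ dzₙ/zₙ ⋯ ∮ dz₁/z₁ x(z_{σ 1}) ⋯ x(z_{σ n})`, with the contours `cs`,
the integrand being taken in the sense of analytic continuation. -/
def IsIntegralOperator (D : Submodule ℂ (Module.Dual ℂ V)) (q : ℂ) (x : ℤ → Module.End ℂ V)
    (cs : List Contour) (σ : Equiv.Perm (Fin cs.length)) (T : Module.End ℂ V) : Prop :=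
  ∀ φ ∈ D, ∀ v : V, ∀ G : (Fin cs.length → ℂ) → ℂ, IsContinuation q x φ v cs.length G →
    φ (T v) = iteratedIntegral q cs.length cs fun z => G (z ∘ σ)

/-- The operator described by `IsIntegralOperator` (an arbitrary one if there is none). -/
def integralOperator (D : Submodule ℂ (Module.Dual ℂ V)) (q : ℂ) (x : ℤ → Module.End ℂ V)
    (cs : List Contour) (σ : Equiv.Perm (Fin cs.length)) : Module.End ℂ V :=
  Classical.epsilon (IsIntegralOperator D q x cs σ)

/-- The ordered `q`-exponential
`1 + ∑ n > 0, (n! (2πi)ⁿ)⁻¹ ∮_{C₁} dz₁/z₁ ⋯ ∮_{Cₙ} dzₙ/zₙ x(z₁) ⋯ x(zₙ)`, all contours of kind `C`, as a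
formal series; the formal variable counts the factors `x`. -/
def orderedExp (D : Submodule ℂ (Module.Dual ℂ V)) (q : ℂ) (x : ℤ → Module.End ℂ V) :
    PowerSeries (Module.End ℂ V) :=
  PowerSeries.mk fun n =>
    ((n.factorial : ℂ)⁻¹) • integralOperator D q x (List.replicate n Contour.C) 1

end Operators

/-! ### The `q`-commutator -/

/-- The iterated integral of the operator valued function
`x(z₁) ⋯ x(z_k) A x(w_l) ⋯ x(w₁)`.
`left` lists the contours of `z₁, …, z_k` and `right` those of `w₁, …, w_l`; thus in both lists the
first variable is the one farthest from `A`. -/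
structure IntegralTerm where
  left : List Contour
  right : List Contour

/-- `ad_q (∮ x(z) dz/z)`, on linear combinations of iterated integrals: multiply the integrand by
`x(z)` from the left and integrate over `z` along a contour of kind `C`, multiply it by `x(z)` from
the right and integrate over `z` along a contour of kind `C'`, and subtract. The integral over `z`
is inside the earlier ones. -/
def adq : (IntegralTerm →₀ ℂ) →ₗ[ℂ] (IntegralTerm →₀ ℂ) :=
  Finsupp.lsum ℂ fun t => LinearMap.toSpanSingleton ℂ (IntegralTerm →₀ ℂ)
    (Finsupp.single ⟨Contour.C :: t.left, t.right⟩ 1 -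
      Finsupp.single ⟨t.left, Contour.C' :: t.right⟩ 1)

section Value

variable {V : Type*} [AddCommGroup V] [Module ℂ V]

/-- The operator which an iterated integral represents. The operator `A` is arbitrary, so there is no
continuation across it: the product of the fields on either side of `A` is continued and integrated,
and the results are composed with `A`. -/
def IntegralTerm.value (D : Submodule ℂ (Module.Dual ℂ V)) (q : ℂ) (x : ℤ → Module.End ℂ V)
    (A : Module.End ℂ V) (t : IntegralTerm) : Module.End ℂ V :=
  integralOperator D q x t.left 1 * A * integralOperator D q x t.right Fin.revPerm

/-- The operator `ad_q ^ n (∮ x(z) dz/z) (A)`. -/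
def adqPow (D : Submodule ℂ (Module.Dual ℂ V)) (q : ℂ) (x : ℤ → Module.End ℂ V) (n : ℕ)
    (A : Module.End ℂ V) : Module.End ℂ V :=
  ((adq ^ n) (Finsupp.single ⟨[], []⟩ 1)).sum fun t c => c • t.value D q x A

end Value

end QExp

end

/-!
Write `F` for the continued matrix coefficient of `x(z₁) ⋯ x(zₙ)`. Since `q` is not a root of
unity, every point of the torus has an ordering of its coordinates at which the `q`-Vandermonde
product `∏_{a < b} (z_b - q z_a)` does not vanish, so by the Nullstellensatz some multiple of this
product by a Laurent polynomial symmetrizes to `1`. Up to symmetrization `F` may thus be replaced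
by its product with such a multiple, in which one of each pair of poles `zᵢ = q zⱼ`, `zⱼ = q zᵢ` is
cleared. The contours of an iterated integral can then be moved apart without meeting a pole, to a
torus in the region of convergence, and there the integral is a finite sum of products of modes.
This shows that the integrals represent operators.

On such tori the poles which are left over after multiplication with two symmetrizing weights allow
the radii to be prescribed: the product of the integral over `k` contours of kind `C` with the one
over `l` contours of kind `C'`, divided by `k! l!`, is the sum over the sets `S` of `k` variables of
averages of one function, where the radii of the variables in `S` descend, followed by those of the
others in ascending order. The first variable can be added to `S` or removed from it without
changing the order of the radii, so the averages cancel in pairs in the alternating sum over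
`k + l = n`, `n > 0`. Hence the inverse of `E_q` is the alternating sum of the integrals of kind
`C'`, divided by `n!`. The two terms of `ad_q` commute, one adding a contour `C` on the left of `A`
and the other a contour `C'` on its right, so the binomial expansion of `ad_q ^ n` gives the
coefficients of `E_q A E_q⁻¹`.
-/

noncomputable section

namespace QExp

section Symmetrization

open MvPolynomial

theorem exists_perm_not_lt {α : Type*} [PartialOrder α] {n : ℕ} (f : Fin n → α) :
    ∃ σ : Equiv.Perm (Fin n), ∀ a b, a < b → ¬f (σ b) < f (σ a) := by
  let g : Fin n → LinearExtension α := fun i => toLinearExtension (f i)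
  refine ⟨Tuple.sort g, fun a b hab hlt => hlt.ne ?_⟩
  have hle : g (Tuple.sort g b) ≤ g (Tuple.sort g a) := toLinearExtension.monotone hlt.le
  exact hle.antisymm (Tuple.monotone_sort g hab.le)

theorem exists_perm_ne_mul {K : Type*} [Field K] {q : K} (hq : ∀ n : ℕ, 0 < n → q ^ n ≠ 1) {n : ℕ}
    (z : Fin n → K) (hz : ∀ i, z i ≠ 0) :
    ∃ σ : Equiv.Perm (Fin n), ∀ a b, a < b → z (σ b) ≠ q * z (σ a) := by
  let _ : PartialOrder Kˣ :=
    { le := fun a b => ∃ k : ℕ, (a : K) = q ^ k * b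
      le_refl := fun a => ⟨0, by simp⟩
      le_trans := by
        rintro a b c ⟨k, hk⟩ ⟨l, hl⟩
        exact ⟨k + l, by rw [hk, hl, pow_add, mul_assoc]⟩
      le_antisymm := by
        rintro a b ⟨k, hk⟩ ⟨l, hl⟩
        have hkl : q ^ (k + l) = 1 := mul_right_cancel₀ a.ne_zero <| by
          rw [pow_add, mul_assoc, ← hl, ← hk, one_mul]
        obtain rfl : k = 0 := by
          by_contra hk0
          exact hq (k + l) (by omega) hkl
        exact Units.ext (by simpa using hk) }
  obtain ⟨σ, hσ⟩ := exists_perm_not_lt fun i => Units.mk0 (z i) (hz i)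
  refine ⟨σ, fun a b hab h => hσ a b hab (lt_of_le_of_ne ⟨1, by simpa using h⟩ fun heq => ?_)⟩
  have hba : z (σ b) = z (σ a) := congrArg Units.val heq
  refine hq 1 one_pos (mul_right_cancel₀ (hz (σ a)) ?_)
  rw [pow_one, one_mul, ← h, hba]

/-- The product `∏_{a < b} (X_b - q X_a)`, a `q`-analogue of the Vandermonde product. In the
ordering of the variables it vanishes on one of each pair of shifted diagonals. -/
def qVandermonde {K : Type*} [CommRing K] (q : K) (n : ℕ) : MvPolynomial (Fin n) K :=
  ∏ p : Fin n × Fin n with p.1 < p.2, (X p.2 - C q * X p.1)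

theorem eval_qVandermonde {K : Type*} [CommRing K] (q : K) {n : ℕ} (z : Fin n → K) :
    eval z (qVandermonde q n) = ∏ p : Fin n × Fin n with p.1 < p.2, (z p.2 - q * z p.1) := by
  simp [qVandermonde]

theorem exists_prod_X_pow_mem_span {K : Type*} [Field K] [IsAlgClosed K] {q : K}
    (hq : ∀ n : ℕ, 0 < n → q ^ n ≠ 1) (n : ℕ) :
    ∃ e : ℕ, (∏ i, X i : MvPolynomial (Fin n) K) ^ e ∈
      Ideal.span (Set.range fun σ : Equiv.Perm (Fin n) => rename σ (qVandermonde q n)) := by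
  set J := Ideal.span (Set.range fun σ : Equiv.Perm (Fin n) => rename σ (qVandermonde q n))
  suffices (∏ i, X i : MvPolynomial (Fin n) K) ∈ J.radical from this
  rw [← vanishingIdeal_zeroLocus_eq_radical (K := K), mem_vanishingIdeal_iff]
  intro z hz
  simp only [map_prod, aeval_X]
  by_contra hne
  obtain ⟨σ, hσ⟩ := exists_perm_ne_mul hq z fun i hi =>
    hne (Finset.prod_eq_zero (Finset.mem_univ i) hi)
  have hvanish := hz (rename σ (qVandermonde q n)) (Ideal.subset_span ⟨σ, rfl⟩)
  rw [aeval_rename, aeval_eq_eval, eval_qVandermonde] at hvanish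
  obtain ⟨p, hp, hzero⟩ := Finset.prod_eq_zero_iff.1 hvanish
  exact hσ p.1 p.2 (Finset.mem_filter.1 hp).2 (sub_eq_zero.1 hzero)

theorem exists_sum_rename_mul_eq {K ι : Type*} [Field K] [CharZero K] [Fintype ι] [DecidableEq ι]
    {s v : MvPolynomial ι K} (hs : s.IsSymmetric)
    (hsv : s ∈ Ideal.span (Set.range fun σ : Equiv.Perm ι => rename σ v)) :
    ∃ c : MvPolynomial ι K, ∑ σ : Equiv.Perm ι, rename σ (c * v) = s := by
  obtain ⟨d, hd⟩ := Ideal.mem_span_range_iff_exists_fun.1 hsv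
  let N : K := Fintype.card (Equiv.Perm ι)
  refine ⟨C N⁻¹ * ∑ ω : Equiv.Perm ι, rename (ω⁻¹ : Equiv.Perm ι) (d ω), ?_⟩
  calc ∑ σ : Equiv.Perm ι,
        rename σ ((C N⁻¹ * ∑ ω : Equiv.Perm ι, rename (ω⁻¹ : Equiv.Perm ι) (d ω)) * v)
      = C N⁻¹ * ∑ ω : Equiv.Perm ι, ∑ σ : Equiv.Perm ι,
          rename (σ * ω⁻¹ : Equiv.Perm ι) (d ω) * rename σ v := by
        conv_rhs => rw [Finset.sum_comm, Finset.mul_sum]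
        refine Finset.sum_congr rfl fun σ _ => ?_
        simp only [map_mul, map_sum, rename_C, rename_rename, mul_assoc, Finset.sum_mul,
          Equiv.Perm.coe_mul]
    _ = C N⁻¹ * ∑ ω : Equiv.Perm ι, ∑ τ : Equiv.Perm ι,
          rename τ (d ω) * rename (τ * ω : Equiv.Perm ι) v := by
        congr 1
        refine Finset.sum_congr rfl fun ω _ => ?_
        exact (Fintype.sum_equiv (Equiv.mulRight ω)
          (fun τ : Equiv.Perm ι => rename τ (d ω) * rename (τ * ω : Equiv.Perm ι) v)
          (fun σ : Equiv.Perm ι => rename (σ * ω⁻¹ : Equiv.Perm ι) (d ω) * rename σ v)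
          fun τ => by simp).symm
    _ = C N⁻¹ * ∑ τ : Equiv.Perm ι, rename τ (∑ ω : Equiv.Perm ι, d ω * rename ω v) := by
        rw [Finset.sum_comm]
        simp only [map_mul, map_sum, rename_rename, Equiv.Perm.coe_mul]
    _ = C N⁻¹ * ∑ _τ : Equiv.Perm ι, s := by rw [hd]; simp only [hs _]
    _ = s := by
        rw [Finset.sum_const, Finset.card_univ, nsmul_eq_mul, ← mul_assoc, ← map_natCast C, ← C_mul,
          inv_mul_cancel₀ (Nat.cast_ne_zero.2 Fintype.card_ne_zero), C_1, one_mul]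

theorem isSymmetric_prod_X (R ι : Type*) [CommSemiring R] [Fintype ι] :
    (∏ i, X i : MvPolynomial ι R).IsSymmetric := fun σ => by
  rw [map_prod]
  simp only [rename_X]
  exact Equiv.prod_comp σ fun i => (X i : MvPolynomial ι R)

/-- The Laurent polynomial `c (∏ i, Xᵢ) ^ (-e)` is a `q`-symmetrizer if multiplying it with the
`q`-Vandermonde product and symmetrizing gives `1`. Multiplying a symmetric function with simple
poles along the shifted diagonals by the `q`-Vandermonde product clears half of its poles. -/
def IsSymmetrizer {K : Type*} [CommRing K] (q : K) {n : ℕ} (c : MvPolynomial (Fin n) K) (e : ℕ) :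
    Prop :=
  ∑ σ : Equiv.Perm (Fin n), rename σ (c * qVandermonde q n) = (∏ i, X i) ^ e

theorem exists_isSymmetrizer {K : Type*} [Field K] [IsAlgClosed K] [CharZero K] {q : K}
    (hq : ∀ n : ℕ, 0 < n → q ^ n ≠ 1) (n : ℕ) :
    ∃ (c : MvPolynomial (Fin n) K) (e : ℕ), IsSymmetrizer q c e := by
  obtain ⟨e, he⟩ := exists_prod_X_pow_mem_span hq n
  have hsymm : ((∏ i, X i : MvPolynomial (Fin n) K) ^ e).IsSymmetric := fun σ => by
    rw [map_pow, isSymmetric_prod_X K (Fin n) σ]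
  obtain ⟨c, hc⟩ := exists_sum_rename_mul_eq hsymm he
  exact ⟨c, e, hc⟩

end Symmetrization

section SmallCircles

open Metric

theorem eventually_forall_mem_closedBall {X : Type*} [PseudoMetricSpace X] {p : X} {Q : X → Prop}
    (h : ∀ᶠ z in 𝓝 p, Q z) : ∀ᶠ ε in 𝓝[>] (0 : ℝ), ∀ z ∈ closedBall p ε, Q z := by
  obtain ⟨δ, hδ, h⟩ := Metric.eventually_nhds_iff.1 h
  filter_upwards [Ioo_mem_nhdsGT hδ] with ε hε z hz
  exact h (lt_of_le_of_lt hz hε.2)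

theorem eventually_forall_mem_sphere {X : Type*} [PseudoMetricSpace X] {p : X} {Q : X → Prop}
    (h : ∀ᶠ z in 𝓝[≠] p, Q z) : ∀ᶠ ε in 𝓝[>] (0 : ℝ), ∀ z ∈ sphere p ε, Q z := by
  filter_upwards [eventually_forall_mem_closedBall (eventually_nhdsWithin_iff.1 h),
    self_mem_nhdsWithin] with ε h hε z hz
  exact h z (sphere_subset_closedBall hz) (ne_of_mem_sphere hz (ne_of_gt hε))

theorem circleIntegral_eq_of_differentiableAt_annulus {E : Type*} [NormedAddCommGroup E]
    [NormedSpace ℂ E] [CompleteSpace E] {c : ℂ} {r R : ℝ} (h0 : 0 < r) (hle : r ≤ R) {f : ℂ → E}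
    (hd : ∀ z, r ≤ dist z c → dist z c ≤ R → DifferentiableAt ℂ f z) :
    (∮ z in C(c, R), f z) = ∮ z in C(c, r), f z :=
  Complex.circleIntegral_eq_of_differentiable_on_annulus_off_countable h0 hle Set.countable_empty
    (fun z hz => (hd z (not_lt.1 hz.2) hz.1).continuousAt.continuousWithinAt)
    fun z hz => hd z (not_le.1 hz.1.2).le (mem_ball.1 hz.1.1).le

theorem circleIntegral_eq_zero_of_differentiableAt {E : Type*} [NormedAddCommGroup E]
    [NormedSpace ℂ E] [CompleteSpace E] {c : ℂ} {R : ℝ} (h0 : 0 ≤ R) {f : ℂ → E}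
    (hd : ∀ z ∈ closedBall c R, DifferentiableAt ℂ f z) : (∮ z in C(c, R), f z) = 0 :=
  Complex.circleIntegral_eq_zero_of_differentiable_on_off_countable h0 Set.countable_empty
    (fun z hz => (hd z hz).continuousAt.continuousWithinAt)
    fun z hz => hd z (ball_subset_closedBall hz.1)

/-- The integrals of `f` over all sufficiently small circles about the points of `P` add up
to `I`. For a meromorphic `f` this is `2πi` times the sum of its residues at the points of `P`. -/
def HasSmallCircleSum (P : Finset ℂ) (f : ℂ → ℂ) (I : ℂ) : Prop :=
  ∀ᶠ ε in 𝓝[>] (0 : ℝ), (∀ p ∈ P, CircleIntegrable f p ε) ∧ ∑ p ∈ P, circleIntegral f p ε = I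

variable {P : Finset ℂ} {f g : ℂ → ℂ} {I J : ℂ}

theorem HasSmallCircleSum.add (hf : HasSmallCircleSum P f I) (hg : HasSmallCircleSum P g J) :
    HasSmallCircleSum P (fun z => f z + g z) (I + J) := by
  filter_upwards [hf, hg] with ε ⟨hfi, hfI⟩ ⟨hgi, hgJ⟩
  refine ⟨fun p hp => (hfi p hp).add (hgi p hp), ?_⟩
  rw [← hfI, ← hgJ, ← Finset.sum_add_distrib]
  exact Finset.sum_congr rfl fun p hp => circleIntegral.integral_add (hfi p hp) (hgi p hp)

theorem HasSmallCircleSum.const_mul (a : ℂ) (hf : HasSmallCircleSum P f I) :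
    HasSmallCircleSum P (fun z => a * f z) (a * I) := by
  filter_upwards [hf] with ε ⟨hfi, hfI⟩
  refine ⟨fun p hp => (hfi p hp).const_smul (a := a), ?_⟩
  rw [← hfI, Finset.mul_sum]
  exact Finset.sum_congr rfl fun p _ => circleIntegral.integral_const_mul _ _ _ _

theorem HasSmallCircleSum.sum {ι : Type*} (s : Finset ι) {F : ι → ℂ → ℂ} {K : ι → ℂ}
    (h : ∀ i ∈ s, HasSmallCircleSum P (F i) (K i)) :
    HasSmallCircleSum P (fun z => ∑ i ∈ s, F i z) (∑ i ∈ s, K i) := by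
  classical
  induction s using Finset.induction_on with
  | empty =>
    exact Eventually.of_forall fun ε => ⟨fun p _ => by simp, by simp [circleIntegral]⟩
  | insert i s hi ih =>
    simp only [Finset.sum_insert hi]
    exact (h i (Finset.mem_insert_self _ _)).add
      (ih fun j hj => h j (Finset.mem_insert_of_mem hj))

theorem HasSmallCircleSum.congr (hf : HasSmallCircleSum P f I)
    (hfg : ∀ p ∈ P, f =ᶠ[𝓝[≠] p] g) : HasSmallCircleSum P g I := by
  have hsphere : ∀ᶠ ε in 𝓝[>] (0 : ℝ), ∀ p ∈ P, ∀ z ∈ sphere p ε, f z = g z :=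
    (Filter.eventually_all_finset _).2 fun p hp => eventually_forall_mem_sphere (hfg p hp)
  filter_upwards [hf, hsphere, self_mem_nhdsWithin] with ε ⟨hfi, hfI⟩ heq hε
  refine ⟨fun p hp => (circleIntegrable_congr fun z hz => ?_).1 (hfi p hp), ?_⟩
  · rw [abs_of_pos hε] at hz
    exact heq p hp z hz
  · rw [← hfI]
    exact Finset.sum_congr rfl fun p hp =>
      (circleIntegral.integral_congr (le_of_lt hε) fun z hz => heq p hp z hz).symm

theorem hasSmallCircleSum_circleIntegral_of_differentiableAt {c : ℂ} {δ : ℝ} (hc : c ∈ P)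
    (hδ : 0 < δ) (hfc : ∀ z, z ≠ c → dist z c ≤ δ → DifferentiableAt ℂ f z)
    (hfP : ∀ p ∈ P, p ≠ c → ∀ᶠ z in 𝓝 p, DifferentiableAt ℂ f z) :
    HasSmallCircleSum P f (∮ z in C(c, δ), f z) := by
  have hball : ∀ᶠ ε in 𝓝[>] (0 : ℝ), ∀ p ∈ P, p ≠ c →
      ∀ z ∈ closedBall p ε, DifferentiableAt ℂ f z :=
    (Filter.eventually_all_finset _).2 fun p hp =>
      eventually_imp_distrib_left.2 fun hpc => eventually_forall_mem_closedBall (hfP p hp hpc)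
  filter_upwards [hball, Ioo_mem_nhdsGT hδ] with ε hball hε
  constructor
  · refine fun p hp => ContinuousOn.circleIntegrable hε.1.le fun z hz => ?_
    suffices DifferentiableAt ℂ f z from this.continuousAt.continuousWithinAt
    rcases eq_or_ne p c with rfl | hpc
    · exact hfc z (ne_of_mem_sphere hz hε.1.ne') ((mem_sphere.1 hz).trans_le hε.2.le)
    · exact hball p hp hpc z (sphere_subset_closedBall hz)
  · rw [Finset.sum_eq_single_of_mem c hc fun p hp hpc =>
      circleIntegral_eq_zero_of_differentiableAt hε.1.le (hball p hp hpc)]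
    refine (circleIntegral_eq_of_differentiableAt_annulus hε.1 hε.2.le fun z hz hz' =>
      hfc z ?_ hz').symm
    exact dist_pos.1 (hε.1.trans_le hz)

theorem hasSmallCircleSum_sub_zpow {a c : ℂ} {ρ : ℝ} (ha : a ∈ P) (haρ : a ∈ ball c ρ) (n : ℤ) :
    HasSmallCircleSum P (fun z => (z - a) ^ n) (∮ z in C(c, ρ), (z - a) ^ n) := by
  have hd : ∀ z, z ≠ a → DifferentiableAt ℂ (fun z => (z - a) ^ n) z := fun z hz =>
    (differentiableAt_id.sub_const a).zpow (Or.inl (sub_ne_zero.2 hz))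
  have hsum := hasSmallCircleSum_circleIntegral_of_differentiableAt ha one_pos
    (fun z hz _ => hd z hz)
    fun p _ hpa => (eventually_ne_nhds hpa).mono hd
  suffices (∮ z in C(a, 1), (z - a) ^ n) = ∮ z in C(c, ρ), (z - a) ^ n by rwa [this] at hsum
  rcases eq_or_ne n (-1) with rfl | hn
  · simp only [zpow_neg_one]
    rw [circleIntegral.integral_sub_center_inv _ one_ne_zero,
      circleIntegral.integral_sub_inv_of_mem_ball haρ]
  · rw [circleIntegral.integral_sub_zpow_of_ne hn, circleIntegral.integral_sub_zpow_of_ne hn]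

/-- The conclusion of the residue theorem: the integral of `f` over the circle about `c` of
radius `ρ` is the sum of its integrals over small circles about the points of `P`. -/
def CircleIntegralLocalizes (P : Finset ℂ) (c : ℂ) (ρ : ℝ) (f : ℂ → ℂ) : Prop :=
  CircleIntegrable f c ρ ∧ HasSmallCircleSum P f (∮ z in C(c, ρ), f z)

variable {c : ℂ} {ρ : ℝ}

theorem CircleIntegralLocalizes.add (hf : CircleIntegralLocalizes P c ρ f)
    (hg : CircleIntegralLocalizes P c ρ g) :
    CircleIntegralLocalizes P c ρ fun z => f z + g z := by
  refine ⟨hf.1.add hg.1, ?_⟩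
  rw [circleIntegral.integral_add hf.1 hg.1]
  exact hf.2.add hg.2

theorem CircleIntegralLocalizes.const_mul (a : ℂ) (hf : CircleIntegralLocalizes P c ρ f) :
    CircleIntegralLocalizes P c ρ fun z => a * f z := by
  refine ⟨hf.1.const_smul (a := a), ?_⟩
  rw [circleIntegral.integral_const_mul]
  exact hf.2.const_mul a

theorem CircleIntegralLocalizes.congr (hf : CircleIntegralLocalizes P c ρ f)
    (hP : ∀ p ∈ P, p ∈ ball c ρ) (hρ : 0 < ρ) (hfg : ∀ z ∉ P, f z = g z) :
    CircleIntegralLocalizes P c ρ g := by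
  have hsphere : ∀ z ∈ sphere c ρ, f z = g z := fun z hz =>
    hfg z fun hzP => (mem_ball.1 (hP z hzP)).ne (mem_sphere.1 hz)
  refine ⟨(circleIntegrable_congr (by rwa [abs_of_pos hρ])).1 hf.1, ?_⟩
  rw [← circleIntegral.integral_congr hρ.le hsphere]
  refine hf.2.congr fun p _ => ?_
  filter_upwards [nhdsNE_le_cofinite p P.finite_toSet.compl_mem_cofinite] with z hz using hfg z hz

theorem circleIntegralLocalizes_sub_zpow {a : ℂ} (ha : a ∈ P) (haρ : a ∈ ball c ρ) (n : ℤ) :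
    CircleIntegralLocalizes P c ρ fun z => (z - a) ^ n := by
  refine ⟨circleIntegrable_sub_zpow_iff.2 (Or.inr (Or.inr ?_)), hasSmallCircleSum_sub_zpow ha haρ n⟩
  rw [abs_of_pos (pos_of_mem_ball haρ), mem_sphere]
  exact (mem_ball.1 haρ).ne

theorem circleIntegralLocalizes_of_differentiableAt (hρ : 0 < ρ) (hc : c ∈ P)
    (hf : ∀ z, z ≠ c → DifferentiableAt ℂ f z) : CircleIntegralLocalizes P c ρ f :=
  ⟨ContinuousOn.circleIntegrable hρ.le fun z hz =>
      (hf z (ne_of_mem_sphere hz hρ.ne')).continuousAt.continuousWithinAt,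
    hasSmallCircleSum_circleIntegral_of_differentiableAt hc hρ (fun z hz _ => hf z hz)
      fun _ _ hpc => (eventually_ne_nhds hpc).mono hf⟩

theorem differentiableAt_dslope {Φ : ℂ → ℂ} {a c : ℂ} (hac : a ≠ c)
    (hΦ : ∀ z, z ≠ c → DifferentiableAt ℂ Φ z) {z : ℂ} (hz : z ≠ c) :
    DifferentiableAt ℂ (dslope Φ a) z := by
  have hd : DifferentiableOn ℂ (dslope Φ a) {c}ᶜ :=
    (Complex.differentiableOn_dslope (isOpen_compl_singleton.mem_nhds hac)).2
      fun z hz => (hΦ z hz).differentiableWithinAt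
  exact (hd z hz).differentiableAt (isOpen_compl_singleton.mem_nhds hz)

theorem circleIntegralLocalizes_div_sub_pow {Φ : ℂ → ℂ} {a : ℂ} (hP : ∀ p ∈ P, p ∈ ball c ρ)
    (hρ : 0 < ρ) (hc : c ∈ P) (ha : a ∈ P) (hac : a ≠ c)
    (hΦ : ∀ z, z ≠ c → DifferentiableAt ℂ Φ z) (k : ℕ) :
    CircleIntegralLocalizes P c ρ fun z => Φ z / (z - a) ^ k := by
  induction k generalizing Φ with
  | zero =>
    simpa only [pow_zero, div_one] using circleIntegralLocalizes_of_differentiableAt hρ hc hΦ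
  | succ k ih =>
    have hpole := circleIntegralLocalizes_sub_zpow ha (hP a ha) (-((k : ℤ) + 1))
    have hrest := ih (Φ := dslope Φ a) fun z hz => differentiableAt_dslope hac hΦ hz
    refine ((hpole.const_mul (Φ a)).add hrest).congr hP hρ fun z hz => ?_
    have hza : z - a ≠ 0 := sub_ne_zero.2 (ne_of_mem_of_not_mem ha hz).symm
    have hslope : Φ z = Φ a + (z - a) * dslope Φ a z :=
      eq_add_of_sub_eq' (by simpa using (sub_smul_dslope Φ a z).symm)
    rw [hslope, zpow_neg, ← Nat.cast_succ, zpow_natCast, pow_succ']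
    field_simp

/-- Two distinct factors are separated by partial fractions, which reduces the statement to a single
multiple pole. -/
theorem circleIntegralLocalizes_div_multiset_prod {Φ : ℂ → ℂ} (hP : ∀ p ∈ P, p ∈ ball c ρ)
    (hρ : 0 < ρ) (hc : c ∈ P) (hΦ : ∀ z, z ≠ c → DifferentiableAt ℂ Φ z) (l : Multiset ℂ)
    (hl : ∀ a ∈ l, a ∈ P ∧ a ≠ c) :
    CircleIntegralLocalizes P c ρ fun z => Φ z / (l.map fun a => z - a).prod := by
  induction hn : Multiset.card l using Nat.strong_induction_on generalizing l with
  | _ n ih =>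
    subst hn
    rcases Multiset.empty_or_exists_mem l with rfl | ⟨a, ha⟩
    · simpa using circleIntegralLocalizes_of_differentiableAt hρ hc hΦ
    obtain ⟨t, rfl⟩ := Multiset.exists_cons_of_mem ha
    by_cases hall : ∀ b ∈ t, b = a
    · obtain ⟨k, rfl⟩ : ∃ k, t = Multiset.replicate k a := ⟨_, Multiset.eq_replicate_card.2 hall⟩
      have hpow := circleIntegralLocalizes_div_sub_pow hP hρ hc (hl a ha).1 (hl a ha).2 hΦ (k + 1)
      simpa [pow_succ'] using hpow
    · push Not at hall
      obtain ⟨b, hb, hba⟩ := hall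
      obtain ⟨t, rfl⟩ := Multiset.exists_cons_of_mem hb
      have hbt := ih _ (by simp) (b ::ₘ t) (fun d hd => hl d (Multiset.mem_cons_of_mem hd)) rfl
      have hat := ih _ (by simp) (a ::ₘ t) (fun d hd => hl d (by simp at hd ⊢; tauto)) rfl
      refine ((hbt.const_mul (b - a)⁻¹).add (hat.const_mul (-(b - a)⁻¹))).congr hP hρ
        fun z hz => ?_
      have hba' := sub_ne_zero.2 hba
      have hza := sub_ne_zero.2 (ne_of_mem_of_not_mem (hl a ha).1 hz).symm
      have hzb := sub_ne_zero.2 (ne_of_mem_of_not_mem (hl b (by simp)).1 hz).symm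
      simp only [Multiset.map_cons, Multiset.prod_cons]
      generalize (t.map fun a => z - a).prod = T
      rcases eq_or_ne T 0 with rfl | hT
      · simp
      field_simp
      ring

end SmallCircles

section TorusAverage

open MeasureTheory

theorem circleAverage_eq_circleIntegral_div {ρ : ℝ} (hρ : ρ ≠ 0) (f : ℂ → ℂ) :
    Real.circleAverage f 0 ρ = (2 * Real.pi * Complex.I)⁻¹ * ∮ z in C(0, ρ), f z / z := by
  simp only [Real.circleAverage_eq_circleIntegral hρ, sub_zero, smul_eq_mul, inv_mul_eq_div _ (f _)]

theorem integral_mul_toCircle (ρ : ℝ) (g : ℂ → ℂ) :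
    ∫ u : UnitAddCircle, g (ρ * (AddCircle.toCircle u : ℂ)) = Real.circleAverage g 0 ρ := by
  have hscale := intervalIntegral.integral_comp_mul_left (a := (0 : ℝ)) (b := 1)
    (fun θ => g (circleMap 0 ρ θ)) (c := 2 * Real.pi) (by positivity)
  rw [mul_zero, mul_one] at hscale
  rw [Real.circleAverage, ← UnitAddCircle.intervalIntegral_preimage 0, zero_add, ← hscale]
  simp only [circleMap, zero_add, AddCircle.toCircle_apply_mk, Circle.coe_exp, div_one]

theorem circleAverage_zpow {ρ : ℝ} (hρ : 0 < ρ) (m : ℤ) :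
    Real.circleAverage (fun z => z ^ m) 0 ρ = if m = 0 then 1 else 0 := by
  have hshift : ∀ z ∈ Metric.sphere (0 : ℂ) ρ, z ^ m / z = (z - 0) ^ (m - 1) := fun z hz => by
    rw [sub_zero, zpow_sub_one₀ (Metric.ne_of_mem_sphere hz hρ.ne'), div_eq_mul_inv]
  rw [circleAverage_eq_circleIntegral_div hρ.ne', circleIntegral.integral_congr hρ.le hshift]
  split_ifs with hm
  · subst hm
    simp only [zero_sub, zpow_neg_one]
    rw [circleIntegral.integral_sub_center_inv _ hρ.ne']
    exact inv_mul_cancel₀ Complex.two_pi_I_ne_zero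
  · rw [circleIntegral.integral_sub_zpow_of_ne (by omega), mul_zero]

section Fintype

variable {ι : Type*}

/-- The point with polar coordinates `r`, `u`. -/
def torusPoint (r : ι → ℝ) (u : ι → UnitAddCircle) : ι → ℂ :=
  fun i => r i * (AddCircle.toCircle (u i) : ℂ)

theorem continuous_torusPoint (r : ι → ℝ) : Continuous (torusPoint r) :=
  continuous_pi fun i => continuous_const.mul
    (continuous_subtype_val.comp (AddCircle.continuous_toCircle.comp (continuous_apply i)))

theorem norm_torusPoint {r : ι → ℝ} (hr : ∀ i, 0 < r i) (u : ι → UnitAddCircle) (i : ι) :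
    ‖torusPoint r u i‖ = r i := by
  rw [torusPoint, norm_mul, Complex.norm_real, Real.norm_of_nonneg (hr i).le, Circle.norm_coe,
    mul_one]

variable [Fintype ι] {r : ι → ℝ} {f g : (ι → ℂ) → ℂ}

/-- The average of `f` over the torus `|zᵢ| = rᵢ`. -/
def torusAvg (r : ι → ℝ) (f : (ι → ℂ) → ℂ) : ℂ :=
  ∫ u : ι → UnitAddCircle, f (torusPoint r u)

theorem torusAvg_congr (hr : ∀ i, 0 < r i) (h : ∀ z, (∀ i, ‖z i‖ = r i) → f z = g z) :
    torusAvg r f = torusAvg r g :=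
  integral_congr_ae (Eventually.of_forall fun u => h _ (norm_torusPoint hr u))

theorem integrable_comp_torusPoint (hr : ∀ i, 0 < r i)
    (hf : ContinuousOn f {z | ∀ i, ‖z i‖ = r i}) : Integrable fun u => f (torusPoint r u) := by
  have hcont : Continuous fun u => f (torusPoint r u) :=
    hf.comp_continuous (continuous_torusPoint r) (norm_torusPoint hr)
  exact hcont.integrable_of_hasCompactSupport (HasCompactSupport.of_compactSpace _)

theorem torusAvg_sum (hr : ∀ i, 0 < r i) {κ : Type*} (s : Finset κ) (F : κ → (ι → ℂ) → ℂ)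
    (hF : ∀ k ∈ s, ContinuousOn (F k) {z | ∀ i, ‖z i‖ = r i}) :
    torusAvg r (fun z => ∑ k ∈ s, F k z) = ∑ k ∈ s, torusAvg r (F k) :=
  integral_finsetSum s fun k hk => integrable_comp_torusPoint hr (hF k hk)

theorem torusAvg_const_mul (c : ℂ) (f : (ι → ℂ) → ℂ) :
    torusAvg r (fun z => c * f z) = c * torusAvg r f :=
  integral_const_mul c _

theorem torusAvg_comp_equiv {κ : Type*} [Fintype κ] (r : ι → ℝ) (f : (ι → ℂ) → ℂ) (e : κ ≃ ι) :
    torusAvg r f = torusAvg (r ∘ e) fun z => f (z ∘ e.symm) := by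
  have he := volume_measurePreserving_piCongrLeft (fun _ : ι => UnitAddCircle) e
  rw [torusAvg, ← he.integral_comp' (g := fun u => f (torusPoint r u)), torusAvg]
  congr! 3 with u
  ext i
  obtain ⟨j, rfl⟩ := e.surjective i
  simp [torusPoint, MeasurableEquiv.coe_piCongrLeft]

theorem torusAvg_of_isEmpty [IsEmpty ι] (r : ι → ℝ) (f : (ι → ℂ) → ℂ) :
    torusAvg r f = f isEmptyElim := by
  rw [torusAvg, Measure.volume_pi_eq_dirac isEmptyElim, integral_dirac]
  exact congrArg f (Subsingleton.elim _ _)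

theorem torusAvg_prod_zpow (hr : ∀ i, 0 < r i) (m : ι → ℤ) :
    torusAvg r (fun z => ∏ i, z i ^ m i) = if m = 0 then 1 else 0 := by
  have hprod := integral_fintype_prod_volume_eq_prod
    fun i (u : UnitAddCircle) => (r i * (AddCircle.toCircle u : ℂ)) ^ m i
  simp only [fun i => integral_mul_toCircle (r i) fun z => z ^ m i, circleAverage_zpow (hr _)]
    at hprod
  refine hprod.trans ?_
  split_ifs with hm
  · simp [hm]
  · obtain ⟨i, hi⟩ := Function.ne_iff.1 hm
    exact Finset.prod_eq_zero (Finset.mem_univ i) (if_neg hi)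

end Fintype

section Fin

variable {n : ℕ} {r : Fin (n + 1) → ℝ} {f : (Fin (n + 1) → ℂ) → ℂ}

theorem torusAvg_insertNth (hr : ∀ i, 0 < r i) (hf : ContinuousOn f {z | ∀ i, ‖z i‖ = r i})
    (i : Fin (n + 1)) :
    torusAvg r f = torusAvg (fun j => r (i.succAbove j)) fun w =>
      Real.circleAverage (fun t => f (i.insertNth (α := fun _ => ℂ) t w)) 0 (r i) := by
  have hmp := (volume_preserving_piFinSuccAbove (fun _ : Fin (n + 1) => UnitAddCircle) i).symm
  have hpoint : ∀ (t : UnitAddCircle) (u : Fin n → UnitAddCircle),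
      torusPoint r ((MeasurableEquiv.piFinSuccAbove (fun _ : Fin (n + 1) => UnitAddCircle) i).symm
        (t, u)) = i.insertNth (α := fun _ => ℂ) (r i * (AddCircle.toCircle t : ℂ))
          (torusPoint (fun j => r (i.succAbove j)) u) := by
    intro t u
    ext j
    induction j using Fin.succAboveCases i <;>
      simp [torusPoint, MeasurableEquiv.piFinSuccAbove_symm_apply]
  have hint := (hmp.integrable_comp_emb (MeasurableEquiv.measurableEmbedding _)).2
    (integrable_comp_torusPoint hr hf)
  rw [torusAvg, ← hmp.integral_comp' (g := fun u => f (torusPoint r u)), Measure.volume_eq_prod]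
  refine (integral_prod_symm _ hint).trans (integral_congr_ae (Eventually.of_forall fun u => ?_))
  simp only [← integral_mul_toCircle, Function.comp_apply, hpoint]

theorem torusAvg_cons (hr : ∀ i, 0 < r i) (hf : ContinuousOn f {z | ∀ i, ‖z i‖ = r i}) :
    torusAvg r f = torusAvg (fun j => r j.succ) fun w =>
      Real.circleAverage (fun t => f (Fin.cons (α := fun _ => ℂ) t w)) 0 (r 0) := by
  rw [torusAvg_insertNth hr hf 0]
  simp only [Fin.insertNth_zero', Fin.zero_succAbove]

end Fin

end TorusAverage

section SeparatelyHolomorphic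

open MeasureTheory

theorem differentiableOn_integral {X E : Type*} [TopologicalSpace X] [CompactSpace X]
    [MeasurableSpace X] [BorelSpace X] [NormedAddCommGroup E] [NormedSpace ℂ E]
    [SecondCountableTopologyEither X E] (μ : Measure X) [IsFiniteMeasure μ] {F : ℂ → X → E}
    {U : Set ℂ} (hU : IsOpen U) (hF : ContinuousOn (Function.uncurry F) (U ×ˢ Set.univ))
    (hd : ∀ x, DifferentiableOn ℂ (F · x) U) :
    DifferentiableOn ℂ (fun t => ∫ x, F t x ∂μ) U := by
  intro t₀ ht₀
  obtain ⟨R, hR, hRU⟩ := Metric.nhds_basis_closedBall.mem_iff.1 (hU.mem_nhds ht₀)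
  obtain ⟨C, hC⟩ := ((isCompact_closedBall t₀ R).prod isCompact_univ).exists_bound_of_continuousOn
    (hF.mono (Set.prod_mono_left hRU))
  have hcont : ∀ t ∈ U, Continuous (F t) := fun t ht =>
    hF.comp_continuous (f := fun x => (t, x)) (by fun_prop) fun x => ⟨ht, Set.mem_univ _⟩
  have hmeas : AEStronglyMeasurable (fun x => deriv (F · x) t₀) μ := by
    obtain ⟨s, hs⟩ : ∃ s : ℕ → ℂ, Tendsto s atTop (𝓝[≠] (0 : ℂ)) := exists_seq_tendsto _
    have hst : Tendsto (fun k => t₀ + s k) atTop (𝓝 t₀) := by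
      simpa using (tendsto_const_nhds (x := t₀)).add (hs.mono_right nhdsWithin_le_nhds)
    obtain ⟨K, hK⟩ := eventually_atTop.1 (hst.eventually (hU.mem_nhds ht₀))
    refine aestronglyMeasurable_of_tendsto_ae (u := atTop)
      (f := fun (k : ℕ) x => (s (k + K))⁻¹ • (F (t₀ + s (k + K)) x - F t₀ x))
      (fun k => (((hcont _ (hK (k + K) (Nat.le_add_left _ _))).sub (hcont _ ht₀)).const_smul
        (s (k + K))⁻¹).aestronglyMeasurable) (Eventually.of_forall fun x => ?_)
    exact (((hd x).hasDerivAt (hU.mem_nhds ht₀)).tendsto_slope_zero.comp hs).comp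
      (tendsto_add_atTop_nat K)
  have hderiv : ∀ x, ∀ t ∈ Metric.ball t₀ (R / 2), ‖deriv (F · x) t‖ ≤ C / (R / 2) := by
    intro x t ht
    have hsub : Metric.closedBall t (R / 2) ⊆ Metric.closedBall t₀ R :=
      Metric.closedBall_subset_closedBall' (by linarith [Metric.mem_ball.1 ht])
    exact Complex.norm_deriv_le_of_forall_mem_sphere_norm_le (half_pos hR)
      (((hd x).mono (hsub.trans hRU)).diffContOnCl_ball subset_rfl)
      fun z hz => hC (z, x) ⟨hsub (Metric.sphere_subset_closedBall hz), Set.mem_univ _⟩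
  have hball : Metric.ball t₀ (R / 2) ⊆ U := (Metric.ball_subset_closedBall.trans
    (Metric.closedBall_subset_closedBall (by linarith))).trans hRU
  exact (hasDerivAt_integral_of_dominated_loc_of_deriv_le (Metric.ball_mem_nhds t₀ (half_pos hR))
    ((hU.eventually_mem ht₀).mono fun t ht => (hcont t ht).aestronglyMeasurable)
    ((hcont t₀ ht₀).integrable_of_hasCompactSupport (HasCompactSupport.of_compactSpace _))
    hmeas (Eventually.of_forall hderiv) (integrable_const _) (Eventually.of_forall fun x t ht =>
      (hd x).hasDerivAt (hU.mem_nhds (hball ht)))).2.differentiableAt.differentiableWithinAt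

/-- `f` is continuous on `U` and holomorphic in each variable at the points of `U`. In contrast to
analyticity, this passes directly to integrals over parameters. -/
def HolOn {ι : Type*} [DecidableEq ι] (f : (ι → ℂ) → ℂ) (U : Set (ι → ℂ)) : Prop :=
  ContinuousOn f U ∧ ∀ z ∈ U, ∀ i, DifferentiableAt ℂ (fun t => f (Function.update z i t)) (z i)

section Basic

variable {ι : Type*} [DecidableEq ι] {f g : (ι → ℂ) → ℂ} {U W : Set (ι → ℂ)}

theorem HolOn.mono (hf : HolOn f U) (h : W ⊆ U) : HolOn f W :=
  ⟨hf.1.mono h, fun z hz => hf.2 z (h hz)⟩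

theorem HolOn.add (hf : HolOn f U) (hg : HolOn g U) : HolOn (fun z => f z + g z) U :=
  ⟨hf.1.add hg.1, fun z hz i => (hf.2 z hz i).add (hg.2 z hz i)⟩

theorem HolOn.mul (hf : HolOn f U) (hg : HolOn g U) : HolOn (fun z => f z * g z) U :=
  ⟨hf.1.mul hg.1, fun z hz i => (hf.2 z hz i).mul (hg.2 z hz i)⟩

theorem HolOn.div (hf : HolOn f U) (hg : HolOn g U) (h : ∀ z ∈ U, g z ≠ 0) :
    HolOn (fun z => f z / g z) U :=
  ⟨hf.1.div hg.1 h, fun z hz i => (hf.2 z hz i).div (hg.2 z hz i) (by simpa using h z hz)⟩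

theorem HolOn.comp_perm (hf : HolOn f U) (σ : Equiv.Perm ι) :
    HolOn (fun z => f (z ∘ σ)) {z | z ∘ σ ∈ U} := by
  refine ⟨hf.1.comp (by fun_prop) fun z hz => hz, fun z hz i => ?_⟩
  have hσ := hf.2 (z ∘ σ) hz (σ.symm i)
  simp only [Function.comp_apply, Equiv.apply_symm_apply] at hσ
  convert hσ using 3 with t
  exact Function.update_comp_equiv z σ i t

theorem HolOn.of_eqOn_nhds (h : ∀ z ∈ U, ∃ g, ∃ W ∈ 𝓝 z, HolOn g W ∧ Set.EqOn f g W) :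
    HolOn f U := by
  refine ⟨fun z hz => ?_, fun z hz i => ?_⟩ <;> obtain ⟨g, W, hW, hg, hfg⟩ := h z hz
  · exact (((hg.1 z (mem_of_mem_nhds hW)).continuousAt hW).congr
      (eventually_of_mem hW fun w hw => (hfg hw).symm)).continuousWithinAt
  · have hupdate : Tendsto (fun t => Function.update z i t) (𝓝 (z i)) (𝓝 z) := by
      simpa using (continuous_const.update i continuous_id :
        Continuous fun t => Function.update z i t).tendsto (z i)
    exact (hg.2 z (mem_of_mem_nhds hW) i).congr_of_eventuallyEq
      ((hupdate.eventually hW).mono fun t ht => hfg ht)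

theorem holOn_of_analyticOnNhd [Fintype ι] (hf : AnalyticOnNhd ℂ f U) : HolOn f U := by
  refine ⟨hf.continuousOn, fun z hz i => ?_⟩
  have hdiff : DifferentiableAt ℂ f (Function.update z i (z i)) := by
    rw [Function.update_eq_self]
    exact (hf z hz).differentiableAt
  exact hdiff.comp (z i) (hasDerivAt_update z i (z i)).differentiableAt

theorem holOn_eval [Finite ι] (p : MvPolynomial ι ℂ) (U : Set (ι → ℂ)) :
    HolOn (fun z => MvPolynomial.eval z p) U :=
  have := Fintype.ofFinite ι
  holOn_of_analyticOnNhd fun z _ =>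
    AnalyticAt.aeval_mvPolynomial (𝕜 := ℂ) (f := fun (z : ι → ℂ) i => z i)
      (fun i => (ContinuousLinearMap.proj (R := ℂ) (φ := fun _ : ι => ℂ) i).analyticAt z) p

theorem HolOn.integral {X : Type*} [TopologicalSpace X] [CompactSpace X] [MeasurableSpace X]
    [BorelSpace X] [Finite ι] (μ : Measure X) [IsFiniteMeasure μ] {F : (ι → ℂ) → X → ℂ}
    (hU : IsOpen U) (hF : ContinuousOn (Function.uncurry F) (U ×ˢ Set.univ))
    (hd : ∀ x, HolOn (F · x) U) : HolOn (fun z => ∫ x, F z x ∂μ) U := by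
  have := Fintype.ofFinite ι
  refine ⟨continuousOn_integral_of_compact_support isCompact_univ hF
    fun _ x _ hx => absurd (Set.mem_univ x) hx, fun z hz i => ?_⟩
  have hupdate : Continuous fun t => Function.update z i t :=
    continuous_const.update i continuous_id
  refine (differentiableOn_integral μ (hU.preimage hupdate) ?_ fun x t ht => ?_).differentiableAt
    ((hU.preimage hupdate).mem_nhds (by simpa using hz))
  · exact hF.comp (f := fun p : ℂ × X => (Function.update z i p.1, p.2)) (by fun_prop)
      fun p hp => ⟨hp.1, Set.mem_univ _⟩
  · simpa using ((hd x).2 _ ht i).differentiableWithinAt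

end Basic

section Fin

variable {n : ℕ} {f : (Fin (n + 1) → ℂ) → ℂ} {U : Set (Fin (n + 1) → ℂ)}

theorem HolOn.differentiableAt_insertNth (hf : HolOn f U) (i : Fin (n + 1)) {t : ℂ} {w : Fin n → ℂ}
    (h : i.insertNth (α := fun _ => ℂ) t w ∈ U) :
    DifferentiableAt ℂ (fun t => f (i.insertNth (α := fun _ => ℂ) t w)) t := by
  simpa only [Fin.insertNth_apply_same, Fin.update_insertNth] using hf.2 _ h i

theorem HolOn.differentiableAt_cons (hf : HolOn f U) {t : ℂ} {w : Fin n → ℂ}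
    (h : Fin.cons (α := fun _ => ℂ) t w ∈ U) :
    DifferentiableAt ℂ (fun t => f (Fin.cons (α := fun _ => ℂ) t w)) t := by
  simpa only [Fin.insertNth_zero'] using
    hf.differentiableAt_insertNth 0 (t := t) (w := w) (by rwa [Fin.insertNth_zero'])

theorem HolOn.comp_cons (hf : HolOn f U) (t : ℂ) :
    HolOn (fun w => f (Fin.cons (α := fun _ => ℂ) t w))
      {w | Fin.cons (α := fun _ => ℂ) t w ∈ U} := by
  refine ⟨hf.1.comp (Continuous.continuousOn (by fun_prop)) fun w hw => hw, fun w hw i => ?_⟩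
  simpa only [Fin.cons_update, Fin.cons_succ] using hf.2 _ hw i.succ

theorem HolOn.circleAverage_cons (hf : HolOn f U) {ρ : ℝ} (hρ : 0 < ρ) {W : Set (Fin n → ℂ)}
    (hW : IsOpen W) (hU : ∀ t w, ‖t‖ = ρ → w ∈ W → Fin.cons (α := fun _ => ℂ) t w ∈ U) :
    HolOn (fun w => Real.circleAverage (fun t => f (Fin.cons (α := fun _ => ℂ) t w)) 0 ρ) W := by
  simp only [← integral_mul_toCircle]
  have : Continuous fun u : UnitAddCircle => (ρ : ℂ) * (AddCircle.toCircle u : ℂ) :=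
    continuous_const.mul (continuous_subtype_val.comp AddCircle.continuous_toCircle)
  have hnorm : ∀ u : UnitAddCircle, ‖(ρ : ℂ) * (AddCircle.toCircle u : ℂ)‖ = ρ := fun u => by
    rw [norm_mul, Complex.norm_real, Real.norm_of_nonneg hρ.le, Circle.norm_coe, mul_one]
  refine HolOn.integral volume hW ?_ fun u =>
    (hf.comp_cons _).mono fun w hw => hU _ w (hnorm u) hw
  exact hf.1.comp (f := fun p : (Fin n → ℂ) × UnitAddCircle =>
    Fin.cons (α := fun _ => ℂ) ((ρ : ℂ) * (AddCircle.toCircle p.2 : ℂ)) p.1)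
    (Continuous.continuousOn (by fun_prop)) fun p hp => hU _ _ (hnorm p.2) hp.1

end Fin

end SeparatelyHolomorphic

section Deformation

theorem circleAverage_eq_of_differentiableAt_annulus {ρ₁ ρ₂ : ℝ} (h0 : 0 < ρ₁) (hle : ρ₁ ≤ ρ₂)
    {f : ℂ → ℂ} (hf : ∀ z, ρ₁ ≤ ‖z‖ → ‖z‖ ≤ ρ₂ → DifferentiableAt ℂ f z) :
    Real.circleAverage f 0 ρ₂ = Real.circleAverage f 0 ρ₁ := by
  rw [circleAverage_eq_circleIntegral_div h0.ne', circleAverage_eq_circleIntegral_div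
    (h0.trans_le hle).ne', circleIntegral_eq_of_differentiableAt_annulus h0 hle]
  intro z hz hz'
  rw [dist_zero_right] at hz hz'
  exact (hf z hz hz').div differentiableAt_id (norm_pos_iff.1 (h0.trans_le hz))

/-- The Reinhardt domain of the points of the torus whose logarithmic moduli form a point of `C`. -/
def reinhardtDomain {n : ℕ} (C : Set (Fin n → ℝ)) : Set (Fin n → ℂ) :=
  {z | z ∈ torus n ∧ (fun i => Real.log ‖z i‖) ∈ C}

theorem mem_reinhardtDomain_of_norm {n : ℕ} {C : Set (Fin n → ℝ)} {s : Fin n → ℝ} (hs : s ∈ C)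
    {z : Fin n → ℂ} (hz : ∀ i, ‖z i‖ = Real.exp (s i)) : z ∈ reinhardtDomain C := by
  refine ⟨fun i => norm_pos_iff.1 ((hz i).symm ▸ Real.exp_pos _), ?_⟩
  simpa only [hz, Real.log_exp] using hs

theorem torusAvg_exp_update_of_le {n : ℕ} {C : Set (Fin n → ℝ)} {f : (Fin n → ℂ) → ℂ}
    (hf : HolOn f (reinhardtDomain C)) (s : Fin n → ℝ) (i : Fin n) {a b : ℝ} (hab : a ≤ b)
    (hC : ∀ x ∈ Set.Icc a b, Function.update s i x ∈ C) :
    torusAvg (fun j => Real.exp (Function.update s i b j)) f =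
      torusAvg (fun j => Real.exp (Function.update s i a j)) f := by
  obtain _ | n := n
  · exact i.elim0
  have hcont : ∀ x ∈ Set.Icc a b,
      ContinuousOn f {z | ∀ j, ‖z j‖ = Real.exp (Function.update s i x j)} := fun x hx =>
    hf.1.mono fun z hz => mem_reinhardtDomain_of_norm (hC x hx) hz
  rw [torusAvg_insertNth (fun j => Real.exp_pos _) (hcont b (Set.right_mem_Icc.2 hab)) i,
    torusAvg_insertNth (fun j => Real.exp_pos _) (hcont a (Set.left_mem_Icc.2 hab)) i]
  simp only [Function.update_self, Function.update_of_ne (Fin.succAbove_ne i _)]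
  refine torusAvg_congr (fun j => Real.exp_pos _) fun w hw => ?_
  refine circleAverage_eq_of_differentiableAt_annulus (Real.exp_pos a) (Real.exp_le_exp.2 hab)
    fun t hat htb => hf.differentiableAt_insertNth i ?_
  have ht : 0 < ‖t‖ := (Real.exp_pos a).trans_le hat
  refine mem_reinhardtDomain_of_norm (hC (Real.log ‖t‖)
    ⟨(Real.le_log_iff_exp_le ht).2 hat, (Real.log_le_iff_le_exp ht).2 htb⟩) fun j => ?_
  induction j using Fin.succAboveCases i with
  | x => simp [Real.exp_log ht]
  | p j => simpa using hw j

theorem torusAvg_exp_eq_of_mem_ball {n : ℕ} {s : Fin n → ℝ} {δ : ℝ} {f : (Fin n → ℂ) → ℂ}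
    (hf : HolOn f (reinhardtDomain (Metric.ball s δ))) {s' : Fin n → ℝ}
    (hs' : s' ∈ Metric.ball s δ) :
    torusAvg (fun i => Real.exp (s' i)) f = torusAvg (fun i => Real.exp (s i)) f := by
  suffices ∀ A : Finset (Fin n), torusAvg (fun i => Real.exp (A.piecewise s' s i)) f =
      torusAvg (fun i => Real.exp (s i)) f by simpa using this Finset.univ
  intro A
  induction A using Finset.induction_on with
  | empty => simp
  | insert i A hi ih =>
    have hδ := Metric.pos_of_mem_ball hs'
    have hmem : ∀ x ∈ Set.uIcc (s i) (s' i),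
        Function.update (A.piecewise s' s) i x ∈ Metric.ball s δ := by
      intro x hx
      refine (dist_pi_lt_iff hδ).2 fun j => ?_
      have hj : dist (s' j) (s j) < δ := (dist_pi_lt_iff hδ).1 hs' j
      rcases eq_or_ne j i with rfl | hji
      · rw [Function.update_self, dist_comm]
        exact (Real.dist_left_le_of_mem_uIcc hx).trans_lt (by rwa [dist_comm])
      · rw [Function.update_of_ne hji, Finset.piecewise]
        split_ifs
        exacts [hj, by rwa [dist_self]]
    have hupdate : Function.update (A.piecewise s' s) i (s i) = A.piecewise s' s := by
      rw [Function.update_eq_self_iff, Finset.piecewise_eq_of_notMem _ _ _ hi]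
    rw [← ih, Finset.piecewise_insert]
    conv_rhs => rw [← hupdate]
    rcases le_total (s i) (s' i) with h | h
    · exact torusAvg_exp_update_of_le hf _ i h (by rwa [Set.uIcc_of_le h] at hmem)
    · exact (torusAvg_exp_update_of_le hf _ i h (by rwa [Set.uIcc_of_ge h] at hmem)).symm

theorem torusAvg_exp_eq_of_isPreconnected {n : ℕ} {C : Set (Fin n → ℝ)} (hC : IsOpen C)
    (hC' : IsPreconnected C) {f : (Fin n → ℂ) → ℂ} (hf : HolOn f (reinhardtDomain C))
    {s s' : Fin n → ℝ} (hs : s ∈ C) (hs' : s' ∈ C) :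
    torusAvg (fun i => Real.exp (s i)) f = torusAvg (fun i => Real.exp (s' i)) f := by
  have hlocal : IsLocallyConstant fun s : C => torusAvg (fun i => Real.exp (s.1 i)) f := by
    refine (IsLocallyConstant.iff_eventually_eq _).2 fun s => ?_
    obtain ⟨δ, hδ, hball⟩ := Metric.isOpen_iff.1 hC s.1 s.2
    filter_upwards [Metric.ball_mem_nhds s hδ] with s₁ hs₁
    exact torusAvg_exp_eq_of_mem_ball (hf.mono fun z hz => ⟨hz.1, hball hz.2⟩) hs₁
  have : PreconnectedSpace C := Subtype.preconnectedSpace hC'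
  exact hlocal.apply_eq_of_preconnectedSpace ⟨s, hs⟩ ⟨s', hs'⟩

end Deformation

section LinearForms

open MvPolynomial

/-- Points of the torus with `zᵢ ≠ p ^ k zⱼ` for `i ≠ j` and `|k| ≤ K`. -/
def genericSet (p : ℂ) (K n : ℕ) : Set (Fin n → ℂ) :=
  {z | z ∈ torus n ∧ ∀ i j, i ≠ j → ∀ k : ℤ, |k| ≤ K → z i ≠ p ^ k * z j}

/-- The linear forms `zᵢ - p ^ k zⱼ`, `1 ≤ k ≤ pos j - pos i`. The function `pos` records the order
of the moduli of the variables, so that the zero `zᵢ = p ^ k zⱼ` of such a form occurs when the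
moduli of `zᵢ` and `zⱼ` are far from this order. -/
def linearForms (p : ℂ) {n : ℕ} (pos : Fin n → ℕ) : Set (MvPolynomial (Fin n) ℂ) :=
  {f | ∃ i j, ∃ k : ℕ, 1 ≤ k ∧ k + pos i ≤ pos j ∧ f = X i - C (p ^ k) * X j}

/-- On the generic set, `h` is the quotient of a function which is holomorphic on the torus by a
product of linear forms. -/
def IsLinearQuotient (p : ℂ) (K : ℕ) {n : ℕ} (pos : Fin n → ℕ) (h : (Fin n → ℂ) → ℂ) : Prop :=
  ∃ H D, HolOn H (torus n) ∧ D ∈ Submonoid.closure (linearForms p pos) ∧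
    ∀ z ∈ genericSet p K n, h z = H z / eval z D

/-- The linear forms with a zero inside the contour of the first variable. -/
def innerForms (p : ℂ) {n : ℕ} (pos : Fin (n + 1) → ℕ) : Set (MvPolynomial (Fin (n + 1)) ℂ) :=
  {f | ∃ i : Fin n, ∃ k : ℕ, 1 ≤ k ∧ k + pos i.succ ≤ pos 0 ∧ f = X i.succ - C (p ^ k) * X 0}

/-- The linear forms with a zero outside the contour of the first variable. -/
def outerForms (p : ℂ) {n : ℕ} (pos : Fin (n + 1) → ℕ) : Set (MvPolynomial (Fin (n + 1)) ℂ) :=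
  {f | ∃ j : Fin n, ∃ k : ℕ, 1 ≤ k ∧ k + pos 0 ≤ pos j.succ ∧ f = X 0 - C (p ^ k) * X j.succ}

theorem exists_mul_add_mul_mem_of_mem_closure {R : Type*} [CommRing R] {s t : Set R}
    {M : Submonoid R} (h : ∀ a ∈ s, ∀ b ∈ t, ∃ u v, u * a + v * b ∈ M) {A B : R}
    (hA : A ∈ Submonoid.closure s) (hB : B ∈ Submonoid.closure t) :
    ∃ U W, U * A + W * B ∈ M := by
  induction hA using Submonoid.closure_induction with
  | mem a ha =>
    induction hB using Submonoid.closure_induction with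
    | mem b hb => exact h a ha b hb
    | one => exact ⟨0, 1, by simp [M.one_mem]⟩
    | mul x y _ _ hx hy =>
      obtain ⟨U, W, hUW⟩ := hx
      obtain ⟨U', W', hUW'⟩ := hy
      refine ⟨U * (U' * a + W' * y) + W * x * U', W * W', ?_⟩
      convert M.mul_mem hUW hUW' using 1
      ring
  | one => exact ⟨1, 0, by simp [M.one_mem]⟩
  | mul x y _ _ hx hy =>
    obtain ⟨U, W, hUW⟩ := hx
    obtain ⟨U', W', hUW'⟩ := hy
    refine ⟨U * U', W * (U' * y + W' * B) + U * x * W', ?_⟩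
    convert M.mul_mem hUW hUW' using 1
    ring

theorem map_ne_zero_of_mem_closure {R S F : Type*} [Monoid R] [MonoidWithZero S]
    [NoZeroDivisors S] [Nontrivial S] [FunLike F R S] [MonoidHomClass F R S] (f : F) {s : Set R}
    (hs : ∀ a ∈ s, f a ≠ 0) {a : R} (ha : a ∈ Submonoid.closure s) : f a ≠ 0 := by
  induction ha using Submonoid.closure_induction with
  | mem a ha => exact hs a ha
  | one => rw [map_one]; exact one_ne_zero
  | mul x y _ _ hx hy => rw [map_mul]; exact mul_ne_zero hx hy

variable {p : ℂ} {K N n : ℕ}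

theorem eval_ne_zero_of_mem_genericSet {pos : Fin n → ℕ} (hK : ∀ i, pos i ≤ K)
    {D : MvPolynomial (Fin n) ℂ} (hD : D ∈ Submonoid.closure (linearForms p pos)) {z : Fin n → ℂ}
    (hz : z ∈ genericSet p K n) : eval z D ≠ 0 := by
  refine map_ne_zero_of_mem_closure (eval z) ?_ hD
  rintro _ ⟨i, j, k, hk, hij, rfl⟩
  have hjK := hK j
  have hne := hz.2 i j (by rintro rfl; omega) k (by rw [Nat.abs_cast]; omega)
  simpa [sub_ne_zero] using hne

theorem IsLinearQuotient.continuousOn {pos : Fin n → ℕ} (hK : ∀ i, pos i ≤ K)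
    {h : (Fin n → ℂ) → ℂ} (hh : IsLinearQuotient p K pos h) :
    ContinuousOn h (genericSet p K n) := by
  obtain ⟨H, D, hH, hD, hh⟩ := hh
  exact ((hH.1.mono fun z hz => hz.1).div (holOn_eval D _).1 fun z hz =>
    eval_ne_zero_of_mem_genericSet hK hD hz).congr hh

theorem eval_cons_rename_succ {R : Type*} [CommSemiring R] (t : R) (w : Fin n → R)
    (D : MvPolynomial (Fin n) R) :
    eval (Fin.cons (α := fun _ => R) t w) (rename Fin.succ D) = eval w D := by
  rw [eval_rename]
  rfl

variable {pos : Fin (n + 1) → ℕ} {A B D : MvPolynomial (Fin (n + 1)) ℂ} {t : ℂ} {w : Fin n → ℂ}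

theorem eval_cons_ne_zero_of_mem_closure_innerForms
    (hA : A ∈ Submonoid.closure (innerForms p pos))
    (h : ∀ i, ∀ k : ℕ, 1 ≤ k → k + pos i.succ ≤ pos 0 → w i ≠ p ^ k * t) :
    eval (Fin.cons (α := fun _ => ℂ) t w) A ≠ 0 := by
  refine map_ne_zero_of_mem_closure (eval _) ?_ hA
  rintro _ ⟨i, k, hk, hik, rfl⟩
  simpa [sub_ne_zero] using h i k hk hik

theorem eval_cons_ne_zero_of_mem_closure_outerForms
    (hB : B ∈ Submonoid.closure (outerForms p pos))
    (h : ∀ j, ∀ k : ℕ, 1 ≤ k → k + pos 0 ≤ pos j.succ → t ≠ p ^ k * w j) :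
    eval (Fin.cons (α := fun _ => ℂ) t w) B ≠ 0 := by
  refine map_ne_zero_of_mem_closure (eval _) ?_ hB
  rintro _ ⟨j, k, hk, hjk, rfl⟩
  simpa [sub_ne_zero] using h j k hk hjk

theorem exists_eq_rename_succ_mul_mul (hD : D ∈ Submonoid.closure (linearForms p pos)) :
    ∃ D' ∈ Submonoid.closure (linearForms p fun i => pos i.succ),
      ∃ A ∈ Submonoid.closure (innerForms p pos), ∃ B ∈ Submonoid.closure (outerForms p pos),
        D = rename Fin.succ D' * A * B := by
  induction hD using Submonoid.closure_induction with
  | mem f hf =>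
    obtain ⟨i, j, k, hk, hij, rfl⟩ := hf
    induction i using Fin.cases with
    | zero =>
      induction j using Fin.cases with
      | zero => omega
      | succ j => exact ⟨1, one_mem _, 1, one_mem _, _,
          Submonoid.subset_closure ⟨j, k, hk, hij, rfl⟩, by simp⟩
    | succ i =>
      induction j using Fin.cases with
      | zero => exact ⟨1, one_mem _, _, Submonoid.subset_closure ⟨i, k, hk, hij, rfl⟩,
          1, one_mem _, by simp⟩
      | succ j => exact ⟨_, Submonoid.subset_closure ⟨i, j, k, hk, hij, rfl⟩, 1, one_mem _,
          1, one_mem _, by simp⟩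
  | one => exact ⟨1, one_mem _, 1, one_mem _, 1, one_mem _, by simp⟩
  | mul x y _ _ hx hy =>
    obtain ⟨D₁, hD₁, A₁, hA₁, B₁, hB₁, rfl⟩ := hx
    obtain ⟨D₂, hD₂, A₂, hA₂, B₂, hB₂, rfl⟩ := hy
    exact ⟨_, mul_mem hD₁ hD₂, _, mul_mem hA₁ hA₂, _, mul_mem hB₁ hB₂, by rw [map_mul]; ring⟩

theorem exists_rename_succ_eq_mul_add_mul (hA : A ∈ Submonoid.closure (innerForms p pos))
    (hB : B ∈ Submonoid.closure (outerForms p pos)) :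
    ∃ R ∈ Submonoid.closure (linearForms p fun i => pos i.succ), ∃ U W,
      rename Fin.succ R = U * A + W * B := by
  -- An inner and an outer form eliminate the first variable:
  -- `(zᵢ - p ^ k t) + p ^ k (t - p ^ l zⱼ) = zᵢ - p ^ (k + l) zⱼ`.
  have hforms : ∀ a ∈ innerForms p pos, ∀ b ∈ outerForms p pos, ∃ u v, u * a + v * b ∈
      (Submonoid.closure (linearForms p fun i => pos i.succ)).map
        (rename Fin.succ : MvPolynomial (Fin n) ℂ →ₐ[ℂ] MvPolynomial (Fin (n + 1)) ℂ) := by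
    rintro a ⟨i, k, hk, hik, rfl⟩ b ⟨j, l, hl, hjl, rfl⟩
    refine ⟨1, C (p ^ k), Submonoid.mem_map.2 ⟨X i - C (p ^ (k + l)) * X j,
      Submonoid.subset_closure ⟨i, j, k + l, by omega, by dsimp only; omega, rfl⟩, ?_⟩⟩
    simp only [map_sub, map_mul, rename_X, rename_C, pow_add]
    ring
  obtain ⟨U, W, hUW⟩ := exists_mul_add_mul_mem_of_mem_closure hforms hA hB
  obtain ⟨R, hR, hRUW⟩ := Submonoid.mem_map.1 hUW
  exact ⟨R, hR, U, W, hRUW⟩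

theorem exists_eval_cons_eq_mul_multiset_prod (hp : p ≠ 0) (hN : pos 0 ≤ N)
    (hA : A ∈ Submonoid.closure (innerForms p pos)) (w : Fin n → ℂ) :
    ∃ (c : ℂ) (l : Multiset ℂ), c ≠ 0 ∧ (∀ a ∈ l, a ∈ insidePoints p⁻¹ N w) ∧
      ∀ t, eval (Fin.cons (α := fun _ => ℂ) t w) A = c * (l.map fun a => t - a).prod := by
  induction hA using Submonoid.closure_induction with
  | mem f hf =>
    obtain ⟨i, k, hk, hik, rfl⟩ := hf
    refine ⟨-p ^ k, {p⁻¹ ^ k * w i}, neg_ne_zero.2 (pow_ne_zero _ hp), fun a ha => ?_, fun t => ?_⟩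
    · rw [Multiset.mem_singleton.1 ha]
      refine Finset.mem_image.2 ⟨(⟨k - 1, by omega⟩, i), Finset.mem_univ _, ?_⟩
      simp only [Nat.sub_add_cancel hk]
    · have hpk := pow_ne_zero k hp
      simp only [eval_sub, eval_mul, eval_X, eval_C, Fin.cons_succ, Fin.cons_zero,
        Multiset.map_singleton, Multiset.prod_singleton, inv_pow]
      field_simp
      ring
  | one => exact ⟨1, 0, one_ne_zero, by simp, by simp⟩
  | mul x y _ _ hx hy =>
    obtain ⟨c, l, hc, hl, h⟩ := hx
    obtain ⟨c', l', hc', hl', h'⟩ := hy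
    refine ⟨c * c', l + l', mul_ne_zero hc hc', fun a ha => ?_, fun t => ?_⟩
    · exact (Multiset.mem_add.1 ha).elim (hl a) (hl' a)
    · rw [map_mul, h, h', Multiset.map_add, Multiset.prod_add]
      ring

theorem IsLinearQuotient.exists_partialFractions (hK : ∀ i, pos i ≤ K)
    {h : (Fin (n + 1) → ℂ) → ℂ} (hh : IsLinearQuotient p K pos h) :
    ∃ Φ Ψ B A E, HolOn Φ (torus (n + 1)) ∧ HolOn Ψ (torus (n + 1)) ∧
      B ∈ Submonoid.closure (outerForms p pos) ∧ A ∈ Submonoid.closure (innerForms p pos) ∧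
      E ∈ Submonoid.closure (linearForms p fun i => pos i.succ) ∧
      ∀ t, ∀ w ∈ genericSet p K n, ∀ z ∈ genericSet p K (n + 1),
        z = Fin.cons (α := fun _ => ℂ) t w →
          h z = (eval w E)⁻¹ * (Φ z / eval z B + Ψ z / eval z A) := by
  obtain ⟨H, D, hH, hD, hh⟩ := hh
  obtain ⟨D', hD', A, hA, B, hB, rfl⟩ := exists_eq_rename_succ_mul_mul hD
  obtain ⟨R, hR, U, W, hUW⟩ := exists_rename_succ_eq_mul_add_mul hA hB
  refine ⟨fun z => H z * eval z U, fun z => H z * eval z W, B, A, D' * R,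
    hH.mul (holOn_eval U _), hH.mul (holOn_eval W _), hB, hA, mul_mem hD' hR, ?_⟩
  rintro t w hw _ hz rfl
  have hD0 := eval_ne_zero_of_mem_genericSet hK hD hz
  have hR0 := eval_ne_zero_of_mem_genericSet (fun i => hK i.succ) hR hw
  have hbezout := congrArg (eval (Fin.cons (α := fun _ => ℂ) t w)) hUW
  rw [hh _ hz]
  simp only [map_mul, map_add, eval_cons_rename_succ] at hD0 hbezout ⊢
  obtain ⟨hD'A0, hB0⟩ := mul_ne_zero_iff.1 hD0
  obtain ⟨hD'0, hA0⟩ := mul_ne_zero_iff.1 hD'A0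
  field_simp
  rw [hbezout]
  ring

end LinearForms

section ContourStep

open MvPolynomial

section CircleAverage

theorem circleIntegral_div_eq {ρ : ℝ} (hρ : ρ ≠ 0) (f : ℂ → ℂ) :
    (∮ z in C(0, ρ), f z / z) = 2 * Real.pi * Complex.I * Real.circleAverage f 0 ρ := by
  rw [circleAverage_eq_circleIntegral_div hρ, mul_inv_cancel_left₀ Complex.two_pi_I_ne_zero]

/-- The average of `f` over the circles about `0` of sufficiently small radius. -/
def smallCircleAverage (f : ℂ → ℂ) : ℂ :=
  limUnder (𝓝[>] (0 : ℝ)) fun ρ => Real.circleAverage f 0 ρ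

/-- The average of `f` over the circles about `0` of sufficiently large radius. -/
def largeCircleAverage (f : ℂ → ℂ) : ℂ :=
  limUnder atTop fun ρ => Real.circleAverage f 0 ρ

variable {f : ℂ → ℂ} {ρ : ℝ}

theorem smallCircleAverage_eq (hρ : 0 < ρ) (hf : ∀ z, z ≠ 0 → ‖z‖ ≤ ρ → DifferentiableAt ℂ f z) :
    smallCircleAverage f = Real.circleAverage f 0 ρ := by
  refine Tendsto.limUnder_eq (tendsto_const_nhds.congr' ?_)
  filter_upwards [Ioo_mem_nhdsGT hρ] with ε hε
  exact circleAverage_eq_of_differentiableAt_annulus hε.1 hε.2.le fun z hz hz' =>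
    hf z (norm_pos_iff.1 (hε.1.trans_le hz)) hz'

theorem largeCircleAverage_eq (hρ : 0 < ρ) (hf : ∀ z, ρ ≤ ‖z‖ → DifferentiableAt ℂ f z) :
    largeCircleAverage f = Real.circleAverage f 0 ρ := by
  refine Tendsto.limUnder_eq (tendsto_const_nhds.congr' ?_)
  filter_upwards [eventually_ge_atTop ρ] with R hR
  exact (circleAverage_eq_of_differentiableAt_annulus hρ hR fun z hz _ => hf z hz).symm

end CircleAverage

section Moduli

variable {p : ℂ} {K : ℕ} {M : ℝ}

theorem exists_norm_zpow_lt (p : ℂ) (K : ℕ) : ∃ M : ℝ, ∀ k : ℤ, |k| ≤ K → ‖p‖ ^ k < M := by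
  obtain ⟨M, hM⟩ := ((Set.finite_Icc (-(K : ℤ)) K).image fun k : ℤ => ‖p‖ ^ k).bddAbove
  exact ⟨M + 1, fun k hk =>
    (hM (Set.mem_image_of_mem _ (abs_le.1 hk))).trans_lt (lt_add_one M)⟩

theorem ne_zpow_mul_of_mul_norm_lt (hM : ∀ k : ℤ, |k| ≤ K → ‖p‖ ^ k < M) {k : ℤ} (hk : |k| ≤ K)
    {a b : ℂ} (ha : a ≠ 0) (hab : M * ‖a‖ < ‖b‖) : b ≠ p ^ k * a := by
  rintro rfl
  rw [norm_mul, norm_zpow] at hab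
  exact hab.not_gt (mul_lt_mul_of_pos_right (hM k hk) (norm_pos_iff.2 ha))

theorem ne_zpow_mul_of_mul_norm_lt' (hp : p ≠ 0) (hM : ∀ k : ℤ, |k| ≤ K → ‖p‖ ^ k < M) {k : ℤ}
    (hk : |k| ≤ K) {a b : ℂ} (ha : a ≠ 0) (hab : M * ‖a‖ < ‖b‖) : a ≠ p ^ k * b := fun h =>
  ne_zpow_mul_of_mul_norm_lt hM ((abs_neg k).trans_le hk) ha hab
    (by rw [h, zpow_neg, inv_mul_cancel_left₀ (zpow_ne_zero _ hp)])

theorem mem_genericSet_of_norm (hp : p ≠ 0) (hM : ∀ k : ℤ, |k| ≤ K → ‖p‖ ^ k < M) {n : ℕ}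
    {pos : Fin n → ℕ} (hpos : Function.Injective pos) {r : Fin n → ℝ} (hr : ∀ i, 0 < r i)
    (hadj : ∀ i j, pos i < pos j → M * r i < r j) {z : Fin n → ℂ} (hz : ∀ i, ‖z i‖ = r i) :
    z ∈ genericSet p K n := by
  have hz0 : ∀ i, z i ≠ 0 := fun i => norm_pos_iff.1 ((hr i).trans_eq (hz i).symm)
  refine ⟨hz0, fun i j hij k hk => ?_⟩
  simp only [← hz] at hadj
  rcases lt_or_gt_of_ne (hpos.ne hij) with hlt | hlt
  · exact ne_zpow_mul_of_mul_norm_lt' hp hM hk (hz0 i) (hadj i j hlt)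
  · exact ne_zpow_mul_of_mul_norm_lt hM hk (hz0 j) (hadj j i hlt)

theorem exists_pos_forall_mul_lt_norm {n : ℕ} (M : ℝ) {w : Fin n → ℂ} (hw : w ∈ torus n) :
    ∃ δ : ℝ, 0 < δ ∧ ∀ j, M * δ < ‖w j‖ := by
  have htendsto : Tendsto (fun δ => M * δ) (𝓝[>] 0) (𝓝 (M * 0)) :=
    (tendsto_const_nhds.mul tendsto_id).mono_left nhdsWithin_le_nhds
  have hsmall : ∀ᶠ δ in 𝓝[>] (0 : ℝ), ∀ j, M * δ < ‖w j‖ := eventually_all.2 fun j =>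
    htendsto.eventually_lt_const (by simpa using hw j)
  exact (eventually_mem_nhdsWithin.and hsmall).exists

theorem exists_pos_forall_mul_norm_lt {n : ℕ} (M : ℝ) (w : Fin n → ℂ) :
    ∃ ρ : ℝ, 0 < ρ ∧ ∀ j, M * ‖w j‖ < ρ :=
  ((eventually_gt_atTop 0).and (eventually_all.2 fun _ => eventually_gt_atTop _)).exists

theorem cons_mem_torus {n : ℕ} {t : ℂ} {w : Fin n → ℂ} (ht : t ≠ 0) (hw : w ∈ torus n) :
    Fin.cons (α := fun _ => ℂ) t w ∈ torus (n + 1) :=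
  Fin.cases ht hw

theorem eventually_cons_mem_genericSet (hp : p ≠ 0) {n : ℕ} {w : Fin n → ℂ}
    (hw : w ∈ genericSet p K n) (a : ℂ) :
    ∀ᶠ t in 𝓝[≠] a, Fin.cons (α := fun _ => ℂ) t w ∈ genericSet p K (n + 1) := by
  have hne : ∀ c, ∀ᶠ t in 𝓝[≠] a, t ≠ c := fun c =>
    nhdsNE_le_cofinite a (Set.finite_singleton c).compl_mem_cofinite
  have hpoles : ∀ᶠ t in 𝓝[≠] a, ∀ j, ∀ k ∈ Finset.Icc (-(K : ℤ)) K, t ≠ p ^ k * w j :=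
    eventually_all.2 fun j => (Filter.eventually_all_finset _).2 fun k _ => hne _
  filter_upwards [hne 0, hpoles] with t ht0 ht
  refine ⟨cons_mem_torus ht0 hw.1, fun i j hij k hk => ?_⟩
  have hk' := abs_le.1 hk
  cases i using Fin.cases <;> cases j using Fin.cases
  · exact absurd rfl hij
  case zero.succ j => exact ht j k (Finset.mem_Icc.2 hk')
  case succ.zero i =>
    intro h
    rw [Fin.cons_succ, Fin.cons_zero] at h
    refine ht i (-k) (Finset.mem_Icc.2 ⟨by omega, by omega⟩) ?_
    rw [h, zpow_neg, inv_mul_cancel_left₀ (zpow_ne_zero _ hp)]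
  case succ.succ i j => exact hw.2 i j (fun h => hij (h ▸ rfl)) k hk

end Moduli

variable {p : ℂ} {K N n : ℕ} {M : ℝ} {pos : Fin (n + 1) → ℕ} {A B : MvPolynomial (Fin (n + 1)) ℂ}
  {w : Fin n → ℂ} {Φ : (Fin (n + 1) → ℂ) → ℂ}

/-- The part of the torus where the polynomial `A` does not vanish. -/
def nonvanishing {n : ℕ} (A : MvPolynomial (Fin n) ℂ) : Set (Fin n → ℂ) :=
  {z | z ∈ torus n ∧ eval z A ≠ 0}

theorem HolOn.div_eval {n : ℕ} {Φ : (Fin n → ℂ) → ℂ} (hΦ : HolOn Φ (torus n))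
    (A : MvPolynomial (Fin n) ℂ) : HolOn (fun z => Φ z / eval z A) (nonvanishing A) :=
  (hΦ.mono fun _ hz => hz.1).div (holOn_eval A _) fun _ hz => hz.2

theorem cons_mem_nonvanishing_of_norm_le (hp : p ≠ 0) (hM : ∀ k : ℤ, |k| ≤ K → ‖p‖ ^ k < M)
    (hK : ∀ i, pos i ≤ K) (hB : B ∈ Submonoid.closure (outerForms p pos)) (hw : w ∈ torus n)
    {δ : ℝ} (hδ : ∀ j : Fin n, pos 0 < pos j.succ → M * δ < ‖w j‖) {t : ℂ} (ht : t ≠ 0)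
    (htδ : ‖t‖ ≤ δ) : Fin.cons (α := fun _ => ℂ) t w ∈ nonvanishing B := by
  have hM0 : 0 ≤ M := zero_le_one.trans (by simpa using (hM 0 (by simp)).le)
  refine ⟨cons_mem_torus ht hw, eval_cons_ne_zero_of_mem_closure_outerForms hB
    fun j k hk hjk => ?_⟩
  have hjK := hK j.succ
  exact_mod_cast ne_zpow_mul_of_mul_norm_lt' (k := k) hp hM (by rw [Nat.abs_cast]; omega) ht
    ((mul_le_mul_of_nonneg_left htδ hM0).trans_lt (hδ j (by omega)))

theorem cons_mem_nonvanishing_of_le_norm (hp : p ≠ 0) (hM : ∀ k : ℤ, |k| ≤ K → ‖p‖ ^ k < M)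
    (hK : ∀ i, pos i ≤ K) (hA : A ∈ Submonoid.closure (innerForms p pos)) (hw : w ∈ torus n)
    {ρ : ℝ} (hρ0 : 0 < ρ) (hρ : ∀ i : Fin n, pos i.succ < pos 0 → M * ‖w i‖ < ρ) {t : ℂ}
    (htρ : ρ ≤ ‖t‖) : Fin.cons (α := fun _ => ℂ) t w ∈ nonvanishing A := by
  refine ⟨cons_mem_torus (norm_pos_iff.1 (hρ0.trans_le htρ)) hw,
    eval_cons_ne_zero_of_mem_closure_innerForms hA fun i k hk hik => ?_⟩
  have h0K := hK 0
  exact_mod_cast ne_zpow_mul_of_mul_norm_lt' (k := k) hp hM (by rw [Nat.abs_cast]; omega) (hw i)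
    ((hρ i (by omega)).trans_le htρ)

section Holomorphy

variable {f : (Fin (n + 1) → ℂ) → ℂ}

theorem HolOn.smallCircleAverage_cons (hp : p ≠ 0)
    (hB : B ∈ Submonoid.closure (outerForms p pos)) (hf : HolOn f (nonvanishing B)) :
    HolOn (fun w => smallCircleAverage fun t => f (Fin.cons (α := fun _ => ℂ) t w)) (torus n) := by
  obtain ⟨K, hK⟩ := (Set.finite_range pos).bddAbove
  rw [mem_upperBounds, Set.forall_mem_range] at hK
  obtain ⟨M, hM⟩ := exists_norm_zpow_lt p K
  refine HolOn.of_eqOn_nhds fun w₀ hw₀ => ?_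
  obtain ⟨δ, hδ0, hδ⟩ := exists_pos_forall_mul_lt_norm M hw₀
  let W : Set (Fin n → ℂ) := {w | ∀ j, w j ≠ 0 ∧ M * δ < ‖w j‖}
  have hW : IsOpen W := by
    simp only [W, Set.ofPred_forall]
    exact isOpen_iInter_of_finite fun j => (isOpen_ne.preimage (continuous_apply j)).inter
      (isOpen_lt continuous_const (continuous_apply j).norm)
  have hmem : ∀ w ∈ W, ∀ t : ℂ, t ≠ 0 → ‖t‖ ≤ δ →
      Fin.cons (α := fun _ => ℂ) t w ∈ nonvanishing B := fun w hw _ =>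
    cons_mem_nonvanishing_of_norm_le hp hM hK hB (fun j => (hw j).1) fun j _ => (hw j).2
  refine ⟨_, W, hW.mem_nhds fun j => ⟨hw₀ j, hδ j⟩, hf.circleAverage_cons hδ0 hW fun t w ht hw =>
    hmem w hw t (norm_pos_iff.1 (ht ▸ hδ0)) ht.le, fun w hw => ?_⟩
  exact smallCircleAverage_eq hδ0 fun t ht htδ => hf.differentiableAt_cons (hmem w hw t ht htδ)

theorem HolOn.largeCircleAverage_cons (hp : p ≠ 0)
    (hA : A ∈ Submonoid.closure (innerForms p pos)) (hf : HolOn f (nonvanishing A)) :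
    HolOn (fun w => largeCircleAverage fun t => f (Fin.cons (α := fun _ => ℂ) t w)) (torus n) := by
  obtain ⟨K, hK⟩ := (Set.finite_range pos).bddAbove
  rw [mem_upperBounds, Set.forall_mem_range] at hK
  obtain ⟨M, hM⟩ := exists_norm_zpow_lt p K
  refine HolOn.of_eqOn_nhds fun w₀ hw₀ => ?_
  obtain ⟨ρ, hρ0, hρ⟩ := exists_pos_forall_mul_norm_lt M w₀
  let W : Set (Fin n → ℂ) := {w | ∀ j, w j ≠ 0 ∧ M * ‖w j‖ < ρ}
  have hW : IsOpen W := by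
    simp only [W, Set.ofPred_forall]
    exact isOpen_iInter_of_finite fun j => (isOpen_ne.preimage (continuous_apply j)).inter
      (isOpen_lt (continuous_const.mul (continuous_apply j).norm) continuous_const)
  have hmem : ∀ w ∈ W, ∀ t : ℂ, ρ ≤ ‖t‖ →
      Fin.cons (α := fun _ => ℂ) t w ∈ nonvanishing A := fun w hw _ =>
    cons_mem_nonvanishing_of_le_norm hp hM hK hA (fun j => (hw j).1) hρ0 fun j _ => (hw j).2
  refine ⟨_, W, hW.mem_nhds fun j => ⟨hw₀ j, hρ j⟩, hf.circleAverage_cons hρ0 hW fun t w ht hw =>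
    hmem w hw t ht.ge, fun w hw => ?_⟩
  exact largeCircleAverage_eq hρ0 fun t htρ => hf.differentiableAt_cons (hmem w hw t htρ)

end Holomorphy

section SmallCircles

theorem zero_notMem_insidePoints (hp : p ≠ 0) (hw : w ∈ torus n) :
    (0 : ℂ) ∉ insidePoints p⁻¹ N w := by
  intro h
  obtain ⟨⟨k, i⟩, -, h⟩ := Finset.mem_image.1 h
  exact mul_ne_zero (pow_ne_zero _ (inv_ne_zero hp)) (hw i) h

theorem eval_cons_ne_zero_of_mem_insidePoints (hp : p ≠ 0) (hroot : ∀ k : ℕ, 0 < k → p ^ k ≠ 1)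
    (hN : ∀ i, pos i ≤ N) (hK : 2 * N ≤ K) (hB : B ∈ Submonoid.closure (outerForms p pos))
    (hw : w ∈ genericSet p K n) {a : ℂ} (ha : a ∈ insidePoints p⁻¹ N w) :
    eval (Fin.cons (α := fun _ => ℂ) a w) B ≠ 0 := by
  obtain ⟨⟨k, i⟩, -, rfl⟩ := Finset.mem_image.1 ha
  refine eval_cons_ne_zero_of_mem_closure_outerForms hB fun j l hl hjl h => ?_
  have hkN := k.2
  have hjN := hN j.succ
  have hij : w i = p ^ ((k : ℕ) + 1 + l) * w j := by
    rw [inv_pow, inv_mul_eq_iff_eq_mul₀ (pow_ne_zero _ hp)] at h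
    rw [h, pow_add p (k + 1) l, mul_assoc]
  by_cases heq : i = j
  · subst heq
    exact hroot _ (by omega) (mul_right_cancel₀ (hw.1 i) (hij.symm.trans (one_mul _).symm))
  · exact hw.2 i j heq ((k : ℕ) + 1 + l : ℕ) (by rw [Nat.abs_cast]; omega)
      (by rw [zpow_natCast]; exact hij)

theorem norm_lt_of_mem_insidePoints (hM : ∀ k : ℤ, |k| ≤ K → ‖p‖ ^ k < M) (hNK : N ≤ K)
    (hw : w ∈ torus n) {ρ : ℝ} (hρ : ∀ i, M * ‖w i‖ < ρ) {a : ℂ}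
    (ha : a ∈ insidePoints p⁻¹ N w) : ‖a‖ < ρ := by
  obtain ⟨⟨k, i⟩, -, rfl⟩ := Finset.mem_image.1 ha
  have hkN := k.2
  have hpow := hM (-((k : ℕ) + 1 : ℕ)) (by rw [abs_neg, Nat.abs_cast]; omega)
  rw [zpow_neg, zpow_natCast] at hpow
  rw [norm_mul, norm_pow, norm_inv, inv_pow]
  exact (mul_lt_mul_of_pos_right hpow (norm_pos_iff.2 (hw i))).trans (hρ i)

theorem hasSmallCircleSum_div_outerForms (hp : p ≠ 0) (hroot : ∀ k : ℕ, 0 < k → p ^ k ≠ 1)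
    (hN : ∀ i, pos i ≤ N) (hK : 2 * N ≤ K) (hB : B ∈ Submonoid.closure (outerForms p pos))
    (hΦ : HolOn Φ (torus (n + 1))) (hw : w ∈ genericSet p K n) {f : ℂ → ℂ}
    (hf : f = fun t => Φ (Fin.cons (α := fun _ => ℂ) t w) /
      eval (Fin.cons (α := fun _ => ℂ) t w) B) :
    HasSmallCircleSum (insert 0 (insidePoints p⁻¹ N w)) (fun t => f t / t)
      (2 * Real.pi * Complex.I * smallCircleAverage f) := by
  obtain ⟨M, hM⟩ := exists_norm_zpow_lt p N
  obtain ⟨δ, hδ0, hδ⟩ := exists_pos_forall_mul_lt_norm M hw.1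
  have hd : ∀ t, Fin.cons (α := fun _ => ℂ) t w ∈ nonvanishing B → DifferentiableAt ℂ f t :=
    fun t ht => hf ▸ (hΦ.div_eval B).differentiableAt_cons ht
  have hdδ : ∀ t, t ≠ 0 → ‖t‖ ≤ δ → DifferentiableAt ℂ f t := fun t ht htδ =>
    hd t (cons_mem_nonvanishing_of_norm_le hp hM hN hB hw.1 (fun j _ => hδ j) ht htδ)
  rw [smallCircleAverage_eq hδ0 hdδ, ← circleIntegral_div_eq hδ0.ne']
  refine hasSmallCircleSum_circleIntegral_of_differentiableAt (Finset.mem_insert_self _ _) hδ0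
    (fun t ht htδ => (hdδ t ht (by rwa [dist_zero_right] at htδ)).div differentiableAt_id ht)
    fun a ha ha0 => ?_
  have hne := eval_cons_ne_zero_of_mem_insidePoints hp hroot hN hK hB hw
    (Finset.mem_of_mem_insert_of_ne ha ha0)
  have hcont : Continuous fun t : ℂ => eval (Fin.cons (α := fun _ => ℂ) t w) B :=
    B.continuous_eval.comp (by fun_prop)
  filter_upwards [hcont.continuousAt.eventually_ne hne, eventually_ne_nhds ha0] with t ht ht0
  exact (hd t ⟨cons_mem_torus ht0 hw.1, ht⟩).div differentiableAt_id ht0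

theorem hasSmallCircleSum_div_innerForms (hp : p ≠ 0) (hN : ∀ i, pos i ≤ N)
    (hA : A ∈ Submonoid.closure (innerForms p pos))
    (hΦ : HolOn Φ (torus (n + 1))) (hw : w ∈ torus n) {f : ℂ → ℂ}
    (hf : f = fun t => Φ (Fin.cons (α := fun _ => ℂ) t w) /
      eval (Fin.cons (α := fun _ => ℂ) t w) A) :
    HasSmallCircleSum (insert 0 (insidePoints p⁻¹ N w)) (fun t => f t / t)
      (2 * Real.pi * Complex.I * largeCircleAverage f) := by
  obtain ⟨M, hM⟩ := exists_norm_zpow_lt p N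
  obtain ⟨ρ, hρ0, hρ⟩ := exists_pos_forall_mul_norm_lt M w
  have hd : ∀ t, ρ ≤ ‖t‖ → DifferentiableAt ℂ f t := fun t ht =>
    hf ▸ (hΦ.div_eval A).differentiableAt_cons
      (cons_mem_nonvanishing_of_le_norm hp hM hN hA hw hρ0 (fun i _ => hρ i) ht)
  obtain ⟨c, l, hc, hl, heval⟩ := exists_eval_cons_eq_mul_multiset_prod hp (hN 0) hA w
  have hfactor : (fun t => f t / t) = fun t =>
      (Φ (Fin.cons (α := fun _ => ℂ) t w) / (c * t)) / (l.map fun a => t - a).prod := by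
    ext t
    simp only [hf, heval]
    ring
  rw [largeCircleAverage_eq hρ0 hd, ← circleIntegral_div_eq hρ0.ne', hfactor]
  refine (circleIntegralLocalizes_div_multiset_prod (fun a ha => ?_) hρ0
    (Finset.mem_insert_self _ _) (fun t ht => ?_) l fun a ha => ?_).2
  · rw [mem_ball_zero_iff]
    rcases Finset.mem_insert.1 ha with rfl | ha
    · rwa [norm_zero]
    · exact norm_lt_of_mem_insidePoints hM le_rfl hw hρ ha
  · exact (hΦ.differentiableAt_cons (cons_mem_torus ht hw)).div
      (differentiableAt_id.const_mul c) (mul_ne_zero hc ht)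
  · exact ⟨Finset.mem_insert_of_mem (hl a ha),
      ne_of_mem_of_not_mem (hl a ha) (zero_notMem_insidePoints hp hw)⟩

end SmallCircles

theorem circleAverage_add_cons (hp : p ≠ 0) (hM : ∀ k : ℤ, |k| ≤ K → ‖p‖ ^ k < M)
    (hK : ∀ i, pos i ≤ K) (hB : B ∈ Submonoid.closure (outerForms p pos))
    (hA : A ∈ Submonoid.closure (innerForms p pos)) {f g : (Fin (n + 1) → ℂ) → ℂ}
    (hf : HolOn f (nonvanishing B)) (hg : HolOn g (nonvanishing A)) (hw : w ∈ torus n) {ρ : ℝ}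
    (hρ0 : 0 < ρ) (houter : ∀ j : Fin n, pos 0 < pos j.succ → M * ρ < ‖w j‖)
    (hinner : ∀ i : Fin n, pos i.succ < pos 0 → M * ‖w i‖ < ρ) :
    Real.circleAverage (fun t => f (Fin.cons (α := fun _ => ℂ) t w) +
        g (Fin.cons (α := fun _ => ℂ) t w)) 0 ρ =
      smallCircleAverage (fun t => f (Fin.cons (α := fun _ => ℂ) t w)) +
        largeCircleAverage fun t => g (Fin.cons (α := fun _ => ℂ) t w) := by
  have hdf : ∀ t, t ≠ 0 → ‖t‖ ≤ ρ →
      DifferentiableAt ℂ (fun t => f (Fin.cons (α := fun _ => ℂ) t w)) t := fun t ht htρ =>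
    hf.differentiableAt_cons (cons_mem_nonvanishing_of_norm_le hp hM hK hB hw houter ht htρ)
  have hdg : ∀ t, ρ ≤ ‖t‖ →
      DifferentiableAt ℂ (fun t => g (Fin.cons (α := fun _ => ℂ) t w)) t := fun t ht =>
    hg.differentiableAt_cons (cons_mem_nonvanishing_of_le_norm hp hM hK hA hw hρ0 hinner ht)
  rw [smallCircleAverage_eq hρ0 hdf, largeCircleAverage_eq hρ0 hdg,
    ← Real.circleAverage_fun_add]
  · refine ContinuousOn.circleIntegrable hρ0.le fun t ht => ?_
    have htρ := mem_sphere_zero_iff_norm.1 ht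
    exact (hdf t (norm_pos_iff.1 (htρ ▸ hρ0)) htρ.le).continuousAt.continuousWithinAt
  · exact ContinuousOn.circleIntegrable hρ0.le fun t ht =>
      (hdg t (mem_sphere_zero_iff_norm.1 ht).ge).continuousAt.continuousWithinAt

/-- The contour integral and the average over a circle agree, because both are computed from the
partial fraction decomposition: the summand without inner poles contributes its average over a small
circle and the summand without outer poles its average over a large circle. -/
theorem IsLinearQuotient.exists_integral_first (hp : p ≠ 0) (hroot : ∀ k : ℕ, 0 < k → p ^ k ≠ 1)
    (hpos : Function.Injective pos) (hN : ∀ i, pos i ≤ N) (hK : 2 * N ≤ K)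
    (hM : ∀ k : ℤ, |k| ≤ K → ‖p‖ ^ k < M) {h : (Fin (n + 1) → ℂ) → ℂ}
    (hh : IsLinearQuotient p K pos h) :
    ∃ g, IsLinearQuotient p K (fun i => pos i.succ) g ∧
      (∀ w ∈ genericSet p K n, HasSmallCircleSum (insert 0 (insidePoints p⁻¹ N w))
        (fun t => h (Fin.cons (α := fun _ => ℂ) t w) / t) (2 * Real.pi * Complex.I * g w)) ∧
      ∀ r : Fin (n + 1) → ℝ, (∀ i, 0 < r i) → (∀ i j, pos i < pos j → M * r i < r j) →
        torusAvg r h = torusAvg (fun i => r i.succ) g := by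
  have hNK : ∀ i, pos i ≤ K := fun i => (hN i).trans (by omega)
  obtain ⟨Φ, Ψ, B, A, E, hΦ, hΨ, hB, hA, hE, hsplit⟩ := hh.exists_partialFractions hNK
  refine ⟨fun w => (smallCircleAverage (fun t => Φ (Fin.cons (α := fun _ => ℂ) t w) / eval _ B) +
      largeCircleAverage fun t => Ψ (Fin.cons (α := fun _ => ℂ) t w) / eval _ A) / eval w E,
    ⟨_, E, ((hΦ.div_eval B).smallCircleAverage_cons hp hB).add
      ((hΨ.div_eval A).largeCircleAverage_cons hp hA), hE, fun _ _ => rfl⟩,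
    fun w hw => ?_, fun r hr hadj => ?_⟩
  · have hsum := ((hasSmallCircleSum_div_outerForms hp hroot hN hK hB hΦ hw rfl).add
      (hasSmallCircleSum_div_innerForms hp hN hA hΨ hw.1 rfl)).const_mul (eval w E)⁻¹
    rw [← mul_add, mul_left_comm, ← div_eq_inv_mul] at hsum
    refine hsum.congr fun a _ => ?_
    filter_upwards [eventually_cons_mem_genericSet hp hw a] with t ht
    rw [hsplit t w hw _ ht rfl]
    ring
  · have hgen : ∀ z : Fin (n + 1) → ℂ, (∀ i, ‖z i‖ = r i) → z ∈ genericSet p K (n + 1) :=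
      fun z hz => mem_genericSet_of_norm hp hM hpos hr hadj hz
    rw [torusAvg_cons hr ((hh.continuousOn hNK).mono hgen)]
    refine torusAvg_congr (fun i => hr _) fun w hw => ?_
    have hwgen : w ∈ genericSet p K n := mem_genericSet_of_norm hp hM
      (hpos.comp (Fin.succ_injective n)) (fun i => hr i.succ) (fun i j hij => hadj _ _ hij) hw
    have hcircle : Set.EqOn (fun t => h (Fin.cons (α := fun _ => ℂ) t w)) _
        (Metric.sphere 0 |r 0|) := fun t ht => hsplit t w hwgen _ (hgen _ fun i => ?_) rfl
    · simp only [← smul_eq_mul] at hcircle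
      rw [Real.circleAverage_congr_sphere hcircle, Real.circleAverage_fun_smul,
        circleAverage_add_cons hp hM hNK hB hA (hΦ.div_eval B) (hΨ.div_eval A) hwgen.1 (hr 0)
          (fun j hj => (hw j).symm ▸ hadj _ _ hj) (fun i hi => (hw i).symm ▸ hadj _ _ hi),
        smul_eq_mul, div_eq_inv_mul]
    · rw [mem_sphere_zero_iff_norm, abs_of_pos (hr 0)] at ht
      cases i using Fin.cases with
      | zero => exact ht
      | succ i => exact hw i

end ContourStep

section IteratedIntegral

variable {p q : ℂ} {N K : ℕ} {M : ℝ}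

theorem contourIntegral_eq {S : Finset ℂ} {g : ℂ → ℂ} {c : ℂ}
    (h : HasSmallCircleSum (insert 0 S) (fun z => g z / z) (2 * Real.pi * Complex.I * c)) :
    contourIntegral S g = c := by
  refine Tendsto.limUnder_eq (tendsto_const_nhds.congr' ?_)
  filter_upwards [h] with ε hε
  rw [hε.2, inv_mul_cancel_left₀ Complex.two_pi_I_ne_zero]

theorem iteratedIntegral_eq_sum_torusAvg (hp : p ≠ 0) (hroot : ∀ k : ℕ, 0 < k → p ^ k ≠ 1)
    (hK : 2 * N ≤ K) (hM : ∀ k : ℤ, |k| ≤ K → ‖p‖ ^ k < M) {ι : Type*} (s : Finset ι)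
    (cs : List Contour) (hcs : ∀ c ∈ cs, c.insideRatio q = p⁻¹)
    (pos : ι → Fin cs.length → ℕ) (r : ι → Fin cs.length → ℝ) (h : ι → (Fin cs.length → ℂ) → ℂ)
    (G : (Fin cs.length → ℂ) → ℂ) (hinj : ∀ a ∈ s, Function.Injective (pos a))
    (hN : ∀ a ∈ s, ∀ i, pos a i ≤ N) (hr : ∀ a ∈ s, ∀ i, 0 < r a i)
    (hadj : ∀ a ∈ s, ∀ i j, pos a i < pos a j → M * r a i < r a j)
    (hh : ∀ a ∈ s, IsLinearQuotient p K (pos a) (h a))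
    (hG : ∀ z ∈ genericSet p K cs.length, G z = ∑ a ∈ s, h a z) :
    iteratedIntegral q N cs G = ∑ a ∈ s, torusAvg (r a) (h a) := by
  induction cs with
  | nil =>
    rw [iteratedIntegral, hG _ ⟨fun i => i.elim0, fun i => i.elim0⟩]
    exact Finset.sum_congr rfl fun a _ => ((torusAvg_of_isEmpty _ _).trans
      (congrArg _ (Subsingleton.elim _ _))).symm
  | cons c cs ih =>
    choose! g hg hgsum hgavg using fun a (ha : a ∈ s) =>
      (hh a ha).exists_integral_first hp hroot (hinj a ha) (hN a ha) hK hM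
    rw [iteratedIntegral, ih (fun c hc => hcs c (List.mem_cons_of_mem _ hc))
      (fun a i => pos a i.succ) (fun a i => r a i.succ) g _
      (fun a ha => (hinj a ha).comp (Fin.succ_injective _)) (fun a ha i => hN a ha _)
      (fun a ha i => hr a ha _) (fun a ha i j hij => hadj a ha _ _ hij) hg fun w hw => ?_]
    · exact Finset.sum_congr rfl fun a ha => (hgavg a ha (r a) (hr a ha) (hadj a ha)).symm
    · rw [hcs c List.mem_cons_self]
      refine contourIntegral_eq ?_
      rw [Finset.mul_sum]
      refine (HasSmallCircleSum.sum s fun a ha => hgsum a ha w hw).congr fun b _ => ?_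
      filter_upwards [eventually_cons_mem_genericSet hp hw b] with t ht
      rw [hG _ ht, Finset.sum_div]

end IteratedIntegral

section ShiftedDiagonals

open MvPolynomial

variable {q : ℂ} {n : ℕ}

theorem prod_ne_zero_of_mem_torus {z : Fin n → ℂ} (hz : z ∈ torus n) : ∏ i, z i ≠ 0 :=
  Finset.prod_ne_zero_iff.2 fun i _ => hz i

theorem comp_mem_torus {m : ℕ} {z : Fin n → ℂ} (hz : z ∈ torus n) (f : Fin m → Fin n) :
    z ∘ f ∈ torus m := fun i => hz (f i)

theorem holOn_eval_comp_div_prod_pow {m : ℕ} (f : Fin m → Fin n) (p : MvPolynomial (Fin m) ℂ)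
    (e : ℕ) : HolOn (fun z => eval (z ∘ f) p / (∏ i, z (f i)) ^ e) (torus n) := by
  have hp := holOn_eval (rename f p) (torus n)
  have hX := holOn_eval ((∏ i, X (f i) : MvPolynomial (Fin n) ℂ) ^ e) (torus n)
  simp only [eval_rename, map_pow, eval_prod, eval_X] at hp hX
  exact hp.div hX fun z hz => pow_ne_zero _ (prod_ne_zero_of_mem_torus (comp_mem_torus hz f))

/-- The product of `z_u - q z_v` over the pairs `(u, v)` in `E`, which vanishes along the shifted
diagonals given by `E`. -/
def pairProd (q : ℂ) {n : ℕ} (E : Finset (Fin n × Fin n)) (z : Fin n → ℂ) : ℂ :=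
  ∏ p ∈ E, (z p.1 - q * z p.2)

theorem holOn_pairProd (q : ℂ) (E : Finset (Fin n × Fin n)) (U : Set (Fin n → ℂ)) :
    HolOn (pairProd q E) U := by
  have h := holOn_eval (∏ p ∈ E, (X p.1 - C q * X p.2)) U
  simp only [eval_prod, eval_sub, eval_mul, eval_X, eval_C] at h
  exact h

theorem pairProd_ne_zero {E : Finset (Fin n × Fin n)} {z : Fin n → ℂ}
    (h : ∀ p ∈ E, z p.1 ≠ q * z p.2) : pairProd q E z ≠ 0 :=
  Finset.prod_ne_zero_iff.2 fun p hp => sub_ne_zero.2 (h p hp)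

theorem pairProd_ne_zero_of_mem_regularSet {E : Finset (Fin n × Fin n)}
    (hE : E ⊆ Finset.univ.offDiag) {z : Fin n → ℂ} (hz : z ∈ regularSet q n) :
    pairProd q E z ≠ 0 :=
  pairProd_ne_zero fun _ hp => hz.2 _ _ (Finset.mem_offDiag.1 (hE hp)).2.2

theorem prod_prod_eq_pairProd_offDiag (z : Fin n → ℂ) :
    (∏ i, ∏ j, if i ≠ j then z i - q * z j else 1) = pairProd q Finset.univ.offDiag z := by
  rw [← Finset.prod_product', Finset.prod_ite, Finset.prod_const_one, mul_one, pairProd]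
  refine Finset.prod_congr ?_ fun _ _ => rfl
  ext
  simp

theorem pairProd_mul_pairProd_sdiff {E E' : Finset (Fin n × Fin n)} (z : Fin n → ℂ) :
    pairProd q E z * pairProd q (E' \ E) z = pairProd q E' z * pairProd q (E \ E') z := by
  have hE : pairProd q E z = pairProd q (E ∩ E') z * pairProd q (E \ E') z :=
    (Finset.prod_inter_mul_prod_sdiff E E' _).symm
  have hE' : pairProd q E' z = pairProd q (E' ∩ E) z * pairProd q (E' \ E) z :=
    (Finset.prod_inter_mul_prod_sdiff E' E _).symm
  rw [hE, hE', Finset.inter_comm]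
  ring

/-- `G` has at most simple poles along the shifted diagonals `zᵢ = q zⱼ`, `i ≠ j`, of `(ℂ*)ⁿ`, and
no other singularities. -/
def HasSimpleShiftedPoles (q : ℂ) {n : ℕ} (G : (Fin n → ℂ) → ℂ) : Prop :=
  ∃ F, HolOn F (torus n) ∧ ∀ z ∈ regularSet q n, F z = pairProd q Finset.univ.offDiag z * G z

theorem HasSimpleShiftedPoles.continuousOn {G : (Fin n → ℂ) → ℂ} (hG : HasSimpleShiftedPoles q G) :
    ContinuousOn G (regularSet q n) := by
  obtain ⟨F, hF, hFG⟩ := hG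
  have hne : ∀ z ∈ regularSet q n, pairProd q Finset.univ.offDiag z ≠ 0 :=
    fun z => pairProd_ne_zero_of_mem_regularSet subset_rfl
  refine ((hF.1.mono fun z hz => hz.1).div (holOn_pairProd q _ _).1 hne).congr fun z hz => ?_
  rw [Pi.div_apply, hFG z hz, mul_div_cancel_left₀ _ (hne z hz)]

/-- The function `c (∏ i, zᵢ) ^ (-e)` times the `q`-Vandermonde product; its symmetrization is `1`
if `IsSymmetrizer q c e`. -/
def symWeight (q : ℂ) {n : ℕ} (c : MvPolynomial (Fin n) ℂ) (e : ℕ) (z : Fin n → ℂ) : ℂ :=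
  eval z (c * qVandermonde q n) / (∏ i, z i) ^ e

theorem holOn_symWeight (q : ℂ) (c : MvPolynomial (Fin n) ℂ) (e : ℕ) :
    HolOn (symWeight q c e) (torus n) :=
  holOn_eval_comp_div_prod_pow id (c * qVandermonde q n) e

theorem IsSymmetrizer.sum_symWeight_comp {c : MvPolynomial (Fin n) ℂ} {e : ℕ}
    (hc : IsSymmetrizer q c e) {z : Fin n → ℂ} (hz : z ∈ torus n) :
    ∑ σ : Equiv.Perm (Fin n), symWeight q c e (z ∘ σ) = 1 := by
  have heval := congrArg (eval z) hc
  simp only [map_sum, eval_rename, map_pow, eval_prod, eval_X] at heval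
  simp only [symWeight, Function.comp_apply, fun σ : Equiv.Perm (Fin n) => Equiv.prod_comp σ z]
  rw [← Finset.sum_div, heval, div_self (pow_ne_zero _ (prod_ne_zero_of_mem_torus hz))]

/-- The pairs `(u, v)` in which `v` comes before `u` in the order `ω 0, ω 1, …`. -/
def inversePairs (ω : Equiv.Perm (Fin n)) : Finset (Fin n × Fin n) :=
  {p | ω.symm p.2 < ω.symm p.1}

theorem inversePairs_subset_offDiag (ω : Equiv.Perm (Fin n)) :
    inversePairs ω ⊆ Finset.univ.offDiag := fun p hp => by
  rw [inversePairs, Finset.mem_filter_univ] at hp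
  simp only [Finset.mem_offDiag, Finset.mem_univ, true_and]
  exact fun h => hp.ne (by rw [h])

theorem eval_comp_qVandermonde (z : Fin n → ℂ) (ω : Equiv.Perm (Fin n)) :
    eval (z ∘ ω) (qVandermonde q n) = pairProd q (inversePairs ω) z := by
  rw [eval_qVandermonde]
  refine Finset.prod_bij' (fun p _ => (ω p.2, ω p.1)) (fun p _ => (ω.symm p.2, ω.symm p.1))
    ?_ ?_ ?_ ?_ ?_ <;> simp [inversePairs]

theorem symWeight_comp (z : Fin n → ℂ) (c : MvPolynomial (Fin n) ℂ) (e : ℕ)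
    (ω : Equiv.Perm (Fin n)) :
    symWeight q c e (z ∘ ω) =
      eval (z ∘ ω) c / (∏ i, z (ω i)) ^ e * pairProd q (inversePairs ω) z := by
  rw [symWeight, map_mul, eval_comp_qVandermonde, mul_div_right_comm]
  rfl

theorem mem_regularSet_of_norm (hq : q ≠ 0) {s : Fin n → ℝ}
    (hs : ∀ u v, u ≠ v → s u - s v ≠ Real.log ‖q‖) {z : Fin n → ℂ}
    (hz : ∀ i, ‖z i‖ = Real.exp (s i)) : z ∈ regularSet q n := by
  refine ⟨fun i => norm_pos_iff.1 ((hz i).symm ▸ Real.exp_pos _), fun i j hij h => hs i j hij ?_⟩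
  have hlog := congrArg (fun t => Real.log ‖t‖) h
  simp only [norm_mul, hz] at hlog
  rw [Real.log_mul (norm_ne_zero_iff.2 hq) (Real.exp_pos _).ne', Real.log_exp, Real.log_exp] at hlog
  linarith

/-- The cone of logarithmic radii which keep the torus, for each `(u, v)` in `E`, on a fixed side of
`z_u = q z_v`: inside if `v` belongs to `T`, and outside otherwise. Here `b = log |q|`. -/
def sideCone (b : ℝ) {n : ℕ} (E : Finset (Fin n × Fin n)) (T : Finset (Fin n)) :
    Set (Fin n → ℝ) :=
  {s | ∀ p ∈ E, if p.2 ∈ T then s p.1 - s p.2 < b else b < s p.1 - s p.2}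

theorem sideCone_eq_iInter (b : ℝ) (E : Finset (Fin n × Fin n)) (T : Finset (Fin n)) :
    sideCone b E T =
      ⋂ p ∈ E, {s | if p.2 ∈ T then s p.1 - s p.2 < b else b < s p.1 - s p.2} := by
  ext s
  simp [sideCone]

theorem isOpen_sideCone (b : ℝ) (E : Finset (Fin n × Fin n)) (T : Finset (Fin n)) :
    IsOpen (sideCone b E T) := by
  rw [sideCone_eq_iInter]
  refine isOpen_biInter_finset fun p _ => ?_
  have hcont : Continuous fun s : Fin n → ℝ => s p.1 - s p.2 := by fun_prop
  split_ifs
  · exact isOpen_lt hcont continuous_const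
  · exact isOpen_lt continuous_const hcont

theorem convex_sideCone (b : ℝ) (E : Finset (Fin n × Fin n)) (T : Finset (Fin n)) :
    Convex ℝ (sideCone b E T) := by
  rw [sideCone_eq_iInter]
  refine convex_iInter₂ fun p _ => ?_
  have hlin : IsLinearMap ℝ fun s : Fin n → ℝ => s p.1 - s p.2 :=
    ⟨fun x y => add_sub_add_comm _ _ _ _, fun c x => (mul_sub _ _ _).symm⟩
  split_ifs
  · exact convex_halfSpace_lt hlin _
  · exact convex_halfSpace_gt hlin _

theorem pairProd_ne_zero_of_mem_sideCone (hq : q ≠ 0) {E : Finset (Fin n × Fin n)}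
    {T : Finset (Fin n)} {z : Fin n → ℂ}
    (hz : z ∈ reinhardtDomain (sideCone (Real.log ‖q‖) E T)) : pairProd q E z ≠ 0 :=
  pairProd_ne_zero fun p hp h => by
    have hside := hz.2 p hp
    have hlog := congrArg (fun t => Real.log ‖t‖) h
    simp only [norm_mul] at hlog
    rw [Real.log_mul (norm_ne_zero_iff.2 hq) (norm_ne_zero_iff.2 (hz.1 _))] at hlog
    split_ifs at hside <;> simp only at hside <;> linarith

/-- The zeros of the weight `a * pairProd q Y * pairProd q E` cancel the poles of `G` except those
along `offDiag \ E \ Y`; these are the only ones the torus must not cross. -/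
theorem torusAvg_exp_eq_of_mem_sideCone (hq : q ≠ 0) {a G : (Fin n → ℂ) → ℂ}
    (ha : HolOn a (torus n)) (hG : HasSimpleShiftedPoles q G) {E : Finset (Fin n × Fin n)}
    (hE : E ⊆ Finset.univ.offDiag) (Y : Finset (Fin n × Fin n)) (T : Finset (Fin n))
    {s s' : Fin n → ℝ} (hs : ∀ u v, u ≠ v → s u - s v ≠ Real.log ‖q‖)
    (hs' : ∀ u v, u ≠ v → s' u - s' v ≠ Real.log ‖q‖)
    (hsT : s ∈ sideCone (Real.log ‖q‖) ((Finset.univ.offDiag \ E) \ Y) T)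
    (hsT' : s' ∈ sideCone (Real.log ‖q‖) ((Finset.univ.offDiag \ E) \ Y) T) :
    torusAvg (fun i => Real.exp (s i)) (fun z => a z * pairProd q Y z * pairProd q E z * G z) =
      torusAvg (fun i => Real.exp (s' i))
        (fun z => a z * pairProd q Y z * pairProd q E z * G z) := by
  obtain ⟨F, hF, hFG⟩ := hG
  set L := Finset.univ.offDiag \ E
  have hcancel : ∀ z ∈ regularSet q n, a z * pairProd q Y z * pairProd q E z * G z =
      a z * F z * pairProd q (Y \ L) z / pairProd q (L \ Y) z := fun z hz => by
    have hne : pairProd q (L \ Y) z ≠ 0 :=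
      pairProd_ne_zero_of_mem_regularSet (Finset.sdiff_subset.trans Finset.sdiff_subset) hz
    have hoffDiag : pairProd q L z * pairProd q E z = pairProd q Finset.univ.offDiag z :=
      Finset.prod_sdiff hE
    rw [eq_div_iff hne, hFG z hz, ← hoffDiag]
    linear_combination
      (a z * pairProd q E z * G z) * pairProd_mul_pairProd_sdiff (q := q) (E := Y) (E' := L) z
  have hsub : reinhardtDomain (sideCone (Real.log ‖q‖) (L \ Y) T) ⊆ torus n := fun z hz => hz.1
  have hol : HolOn (fun z => a z * F z * pairProd q (Y \ L) z / pairProd q (L \ Y) z)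
      (reinhardtDomain (sideCone (Real.log ‖q‖) (L \ Y) T)) :=
    (((ha.mul hF).mono hsub).mul (holOn_pairProd q _ _)).div (holOn_pairProd q _ _)
      fun z => pairProd_ne_zero_of_mem_sideCone hq
  rw [torusAvg_congr (fun i => Real.exp_pos _) fun z hz =>
      hcancel z (mem_regularSet_of_norm hq hs hz),
    torusAvg_congr (fun i => Real.exp_pos _) fun z hz =>
      hcancel z (mem_regularSet_of_norm hq hs' hz)]
  exact torusAvg_exp_eq_of_isPreconnected (isOpen_sideCone _ _ _)
    (convex_sideCone _ _ _).isPreconnected hol hsT hsT'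

end ShiftedDiagonals

section Blocks

open MvPolynomial

variable {q : ℂ} {k l : ℕ}

/-- The product of two weights as in `symWeight`, the first of them in the reversed first `k`
variables and the second one in the last `l` variables. -/
def blockWeight (q : ℂ) {k l : ℕ} (c : MvPolynomial (Fin k) ℂ) (e : ℕ)
    (c' : MvPolynomial (Fin l) ℂ) (e' : ℕ) (z : Fin (k + l) → ℂ) : ℂ :=
  symWeight q c e (fun i => z (Fin.castAdd l i.rev)) *
    symWeight q c' e' (fun j => z (Fin.natAdd k j))

/-- The pairs of variables for which `blockWeight` has a factor `z_u - q z_v`. -/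
def blockPairs (k l : ℕ) : Finset (Fin (k + l) × Fin (k + l)) :=
  {p | (p.1 < p.2 ∧ (p.2 : ℕ) < k) ∨ (k ≤ (p.2 : ℕ) ∧ p.2 < p.1)}

theorem pairProd_blockPairs (z : Fin (k + l) → ℂ) :
    pairProd q (blockPairs k l) z =
      pairProd q (inversePairs Fin.revPerm) (z ∘ Fin.castAdd l) *
        pairProd q (inversePairs 1) (z ∘ Fin.natAdd k) := by
  simp only [pairProd, blockPairs, inversePairs, Finset.prod_filter, Fintype.prod_prod_type,
    Fin.prod_univ_add]
  have hlt (i : Fin k) (j : Fin l) : ¬Fin.natAdd k j < Fin.castAdd l i := by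
    simp [Fin.lt_def]; omega
  have hcast (i i' : Fin k) : Fin.castAdd l i < Fin.castAdd l i' ↔ i < i' := Iff.rfl
  have hge (i : Fin k) : ¬k ≤ (i : ℕ) := i.2.not_ge
  have hone (j : Fin l) : (1 : Equiv.Perm (Fin l)).symm j = j := rfl
  simp [hlt, hge, hone, hcast]

theorem exists_blockWeight_eq_mul_pairProd (c : MvPolynomial (Fin k) ℂ) (e : ℕ)
    (c' : MvPolynomial (Fin l) ℂ) (e' : ℕ) :
    ∃ a, HolOn a (torus (k + l)) ∧
      ∀ z, blockWeight q c e c' e' z = a z * pairProd q (blockPairs k l) z := by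
  refine ⟨_, (holOn_eval_comp_div_prod_pow (fun i : Fin k => Fin.castAdd l i.rev) c e).mul
    (holOn_eval_comp_div_prod_pow (Fin.natAdd k) c' e'), fun z => ?_⟩
  have hfront := symWeight_comp (q := q) (z ∘ Fin.castAdd l) c e Fin.revPerm
  have hback := symWeight_comp (q := q) (z ∘ Fin.natAdd k) c' e' 1
  rw [pairProd_blockPairs, mul_mul_mul_comm]
  exact congrArg₂ (· * ·) hfront hback

theorem holOn_blockWeight (q : ℂ) (c : MvPolynomial (Fin k) ℂ) (e : ℕ)
    (c' : MvPolynomial (Fin l) ℂ) (e' : ℕ) : HolOn (blockWeight q c e c' e') (torus (k + l)) := by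
  obtain ⟨a, ha, h⟩ := exists_blockWeight_eq_mul_pairProd (q := q) c e c' e'
  rw [funext h]
  exact ha.mul (holOn_pairProd q _ _)

/-- The set of the elements that `ω` moves to the first `k` places. -/
def frontSet {n : ℕ} (k : ℕ) (ω : Equiv.Perm (Fin n)) : Finset (Fin n) := {a | (ω a : ℕ) < k}

theorem mem_frontSet {n : ℕ} {k : ℕ} {ω : Equiv.Perm (Fin n)} {a : Fin n} :
    a ∈ frontSet k ω ↔ (ω a : ℕ) < k := by simp [frontSet]

theorem card_frontSet (ω : Equiv.Perm (Fin (k + l))) : (frontSet k ω).card = k := by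
  have himage : (frontSet k ω).card =
      (Finset.univ.filter fun i : Fin (k + l) => (i : ℕ) < k).card :=
    Finset.card_bijective ω ω.bijective (by simp [mem_frontSet])
  rw [himage, Fin.card_filter_val_lt, min_eq_right (k.le_add_right l)]

theorem exists_frontSet_eq {S : Finset (Fin (k + l))} (hS : S.card = k) :
    ∃ ω : Equiv.Perm (Fin (k + l)), frontSet k ω = S := by
  have hcard : Fintype.card {a // a ∈ S} = Fintype.card {i : Fin (k + l) // (i : ℕ) < k} := by
    rw [Fintype.card_coe, hS, Fintype.card_subtype, Fin.card_filter_val_lt]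
    simp
  let e := Fintype.equivOfCardEq hcard
  refine ⟨e.extendSubtype, Finset.ext fun a => mem_frontSet.trans ⟨fun h => ?_, fun ha => ?_⟩⟩
  · by_contra ha
    exact e.extendSubtype_not_mem a ha h
  · exact e.extendSubtype_mem a ha

/-- The permutation of `Fin (k + l)` that acts on the two blocks separately. -/
def blockPerm (τ : Equiv.Perm (Fin k)) (τ' : Equiv.Perm (Fin l)) : Equiv.Perm (Fin (k + l)) :=
  finSumFinEquiv.permCongr (Equiv.sumCongr τ τ')

theorem blockPerm_castAdd (τ : Equiv.Perm (Fin k)) (τ' : Equiv.Perm (Fin l)) (i : Fin k) :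
    blockPerm τ τ' (Fin.castAdd l i) = Fin.castAdd l (τ i) := by
  simp [blockPerm, Equiv.permCongr_apply]

theorem blockPerm_natAdd (τ : Equiv.Perm (Fin k)) (τ' : Equiv.Perm (Fin l)) (j : Fin l) :
    blockPerm τ τ' (Fin.natAdd k j) = Fin.natAdd k (τ' j) := by
  simp [blockPerm, Equiv.permCongr_apply]

theorem blockPerm_injective :
    Function.Injective fun p : Equiv.Perm (Fin k) × Equiv.Perm (Fin l) => blockPerm p.1 p.2 := by
  rintro ⟨τ, τ'⟩ ⟨ρ, ρ'⟩ h
  refine Prod.ext (Equiv.ext fun i => ?_) (Equiv.ext fun j => ?_)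
  · simpa [blockPerm_castAdd] using Equiv.congr_fun h (Fin.castAdd l i)
  · simpa [blockPerm_natAdd] using Equiv.congr_fun h (Fin.natAdd k j)

theorem exists_blockPerm_eq {π : Equiv.Perm (Fin (k + l))}
    (h : ∀ i : Fin (k + l), (i : ℕ) < k → (π i : ℕ) < k) : ∃ τ τ', blockPerm τ τ' = π := by
  have hrange : (finSumFinEquiv.symm.permCongr π : Equiv.Perm (Fin k ⊕ Fin l)) ∈
      (Equiv.Perm.sumCongrHom (Fin k) (Fin l)).range := by
    refine Equiv.Perm.mem_sumCongrHom_range_of_perm_mapsTo_inl ?_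
    rintro _ ⟨i, rfl⟩
    refine ⟨⟨_, h (Fin.castAdd l i) i.2⟩, ?_⟩
    rw [Equiv.permCongr_apply, Equiv.eq_symm_apply]
    ext
    simp
  obtain ⟨⟨τ, τ'⟩, hττ'⟩ := hrange
  refine ⟨τ, τ', ?_⟩
  rw [blockPerm, show Equiv.sumCongr τ τ' = finSumFinEquiv.symm.permCongr π from hττ']
  ext i
  simp [Equiv.permCongr_apply]

theorem frontSet_blockPerm_mul (τ : Equiv.Perm (Fin k)) (τ' : Equiv.Perm (Fin l))
    (ω : Equiv.Perm (Fin (k + l))) : frontSet k (blockPerm τ τ' * ω) = frontSet k ω := by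
  ext a
  rw [mem_frontSet, mem_frontSet, Equiv.Perm.mul_apply]
  generalize ω a = b
  induction b using Fin.addCases with
  | left i => simp [blockPerm_castAdd]
  | right j => simp [blockPerm_natAdd]

theorem sum_filter_frontSet_eq {M : Type*} [AddCommMonoid M] (f : Equiv.Perm (Fin (k + l)) → M)
    (ω₀ : Equiv.Perm (Fin (k + l))) :
    ∑ ω : Equiv.Perm (Fin (k + l)) with frontSet k ω = frontSet k ω₀, f ω =
      ∑ p : Equiv.Perm (Fin k) × Equiv.Perm (Fin l), f (blockPerm p.1 p.2 * ω₀) := by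
  refine (Finset.sum_nbij (fun p => blockPerm p.1 p.2 * ω₀) (fun p _ => ?_) ?_ ?_ ?_).symm
  · simpa using frontSet_blockPerm_mul p.1 p.2 ω₀
  · exact fun p _ p' _ h => blockPerm_injective (mul_right_cancel h)
  · intro ω hω
    have hfront : frontSet k ω = frontSet k ω₀ := by simpa using hω
    obtain ⟨τ, τ', hττ'⟩ := exists_blockPerm_eq (π := ω * ω₀⁻¹) fun i hi => by
      have hmem : ω₀.symm i ∈ frontSet k ω := by simpa [hfront, mem_frontSet] using hi
      simpa [mem_frontSet] using hmem
    exact ⟨(τ, τ'), by simp, by simp [hττ']⟩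
  · exact fun _ _ => rfl

theorem blockWeight_comp_blockPerm_symm (c : MvPolynomial (Fin k) ℂ) (e : ℕ)
    (c' : MvPolynomial (Fin l) ℂ) (e' : ℕ) (z : Fin (k + l) → ℂ) (τ : Equiv.Perm (Fin k))
    (τ' : Equiv.Perm (Fin l)) :
    blockWeight q c e c' e' (z ∘ (blockPerm τ τ').symm) =
      symWeight q c e ((z ∘ Fin.castAdd l) ∘ (τ⁻¹ * Fin.revPerm : Equiv.Perm (Fin k))) *
        symWeight q c' e' ((z ∘ Fin.natAdd k) ∘ (τ'⁻¹ : Equiv.Perm (Fin l))) := by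
  have hfront (i : Fin k) : (blockPerm τ τ').symm (Fin.castAdd l i) = Fin.castAdd l (τ⁻¹ i) := by
    rw [Equiv.symm_apply_eq, blockPerm_castAdd, Equiv.Perm.inv_def, Equiv.apply_symm_apply]
  have hback (j : Fin l) : (blockPerm τ τ').symm (Fin.natAdd k j) = Fin.natAdd k (τ'⁻¹ j) := by
    rw [Equiv.symm_apply_eq, blockPerm_natAdd, Equiv.Perm.inv_def, Equiv.apply_symm_apply]
  simp only [blockWeight, Function.comp_apply, hfront, hback]
  rfl

theorem sum_blockWeight_comp_symm {c : MvPolynomial (Fin k) ℂ} {e : ℕ}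
    {c' : MvPolynomial (Fin l) ℂ} {e' : ℕ} (hc : IsSymmetrizer q c e)
    (hc' : IsSymmetrizer q c' e') {S : Finset (Fin (k + l))} (hS : S.card = k)
    {z : Fin (k + l) → ℂ} (hz : z ∈ torus (k + l)) :
    ∑ ω : Equiv.Perm (Fin (k + l)) with frontSet k ω = S,
      blockWeight q c e c' e' (z ∘ ω.symm) = 1 := by
  obtain ⟨ω₀, rfl⟩ := exists_frontSet_eq hS
  set y := z ∘ ω₀.symm
  have hy : y ∈ torus (k + l) := comp_mem_torus hz _
  have hfront : ∑ τ : Equiv.Perm (Fin k),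
      symWeight q c e ((y ∘ Fin.castAdd l) ∘ (τ⁻¹ * Fin.revPerm : Equiv.Perm (Fin k))) = 1 := by
    rw [← hc.sum_symWeight_comp (comp_mem_torus hy (Fin.castAdd l))]
    exact Fintype.sum_equiv ((Equiv.inv _).trans (Equiv.mulRight Fin.revPerm)) _ _ fun τ => rfl
  have hback : ∑ τ' : Equiv.Perm (Fin l),
      symWeight q c' e' ((y ∘ Fin.natAdd k) ∘ (τ'⁻¹ : Equiv.Perm (Fin l))) = 1 := by
    rw [← hc'.sum_symWeight_comp (comp_mem_torus hy (Fin.natAdd k))]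
    exact Fintype.sum_equiv (Equiv.inv _) _ _ fun τ => rfl
  calc ∑ ω : Equiv.Perm (Fin (k + l)) with frontSet k ω = frontSet k ω₀,
        blockWeight q c e c' e' (z ∘ ω.symm)
      = ∑ p : Equiv.Perm (Fin k) × Equiv.Perm (Fin l),
          blockWeight q c e c' e' (y ∘ (blockPerm p.1 p.2).symm) := sum_filter_frontSet_eq _ _
    _ = 1 := by
        simp only [blockWeight_comp_blockPerm_symm, Fintype.sum_prod_type, ← Finset.mul_sum, hback,
          mul_one, hfront]

end Blocks

section Cancellation

open MvPolynomial

section Radii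

variable {q : ℂ} {b lam : ℝ} {n : ℕ} {t : Fin n → ℤ}

/-- The radii `exp (lam * tᵢ)`. -/
def expRadii (lam : ℝ) {n : ℕ} (t : Fin n → ℤ) (i : Fin n) : ℝ :=
  Real.exp (lam * t i)

theorem expRadii_pos (i : Fin n) : 0 < expRadii lam t i := Real.exp_pos _

theorem mul_sub_mul_lt_of_lt (hlam : |b| < lam) {m k : ℤ} (h : m < k) : lam * m - lam * k < b := by
  have hgap : (m : ℝ) + 1 ≤ k := by exact_mod_cast h
  have hpos : 0 < lam := (abs_nonneg _).trans_lt hlam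
  nlinarith [neg_abs_le b]

theorem lt_mul_sub_mul_of_lt (hlam : |b| < lam) {m k : ℤ} (h : k < m) : b < lam * m - lam * k := by
  have hneg := mul_sub_mul_lt_of_lt (b := -b) (abs_neg b ▸ hlam) h
  linarith

theorem mul_sub_mul_ne (hlam : |b| < lam) (ht : Function.Injective t) (u v : Fin n) (h : u ≠ v) :
    lam * t u - lam * t v ≠ b := by
  rcases lt_or_gt_of_ne (ht.ne h) with h | h
  · exact (mul_sub_mul_lt_of_lt hlam h).ne
  · exact (lt_mul_sub_mul_of_lt hlam h).ne'

theorem mul_mem_sideCone (hlam : |b| < lam) {E : Finset (Fin n × Fin n)} {T : Finset (Fin n)}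
    (h : ∀ p ∈ E, if p.2 ∈ T then t p.1 < t p.2 else t p.2 < t p.1) :
    (fun i => lam * t i) ∈ sideCone b E T := fun p hp => by
  have hside := h p hp
  split_ifs at hside ⊢
  · exact mul_sub_mul_lt_of_lt hlam hside
  · exact lt_mul_sub_mul_of_lt hlam hside

theorem mem_regularSet_of_expRadii (hq : q ≠ 0) (hlam : |Real.log ‖q‖| < lam)
    (ht : Function.Injective t) {z : Fin n → ℂ} (hz : ∀ i, ‖z i‖ = expRadii lam t i) :
    z ∈ regularSet q n :=
  mem_regularSet_of_norm hq (mul_sub_mul_ne hlam ht) hz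

theorem HasSimpleShiftedPoles.continuousOn_mul_expRadii (hq : q ≠ 0) (hlam : |Real.log ‖q‖| < lam)
    (ht : Function.Injective t) {a G : (Fin n → ℂ) → ℂ} (ha : HolOn a (torus n))
    (hG : HasSimpleShiftedPoles q G) :
    ContinuousOn (fun z => a z * G z) {z | ∀ i, ‖z i‖ = expRadii lam t i} :=
  ((ha.1.mono fun _ hz => hz.1).mul hG.continuousOn).mono fun _ hz =>
    mem_regularSet_of_expRadii hq hlam ht hz

theorem torusAvg_mul_eq_sum_symWeight_comp (hq : q ≠ 0) (hlam : |Real.log ‖q‖| < lam)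
    (ht : Function.Injective t) {d : MvPolynomial (Fin n) ℂ} {f : ℕ} (hd : IsSymmetrizer q d f)
    {a G : (Fin n → ℂ) → ℂ} (ha : HolOn a (torus n)) (hG : HasSimpleShiftedPoles q G) :
    torusAvg (expRadii lam t) (fun z => a z * G z) =
      ∑ ω : Equiv.Perm (Fin n),
        torusAvg (expRadii lam t) fun z => a z * symWeight q d f (z ∘ ω) * G z := by
  rw [← torusAvg_sum expRadii_pos]
  · refine torusAvg_congr expRadii_pos fun z hz => ?_
    rw [← Finset.sum_mul, ← Finset.mul_sum,
      hd.sum_symWeight_comp (mem_regularSet_of_expRadii hq hlam ht hz).1, mul_one]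
  · exact fun ω _ => hG.continuousOn_mul_expRadii hq hlam ht
      (ha.mul (((holOn_symWeight q d f).comp_perm ω).mono fun z hz => comp_mem_torus hz ω))

end Radii

section SignedIndex

variable {n : ℕ}

/-- The exponents `a` for `a ∈ S` and `-a` for `a ∉ S`: in the radii `expRadii lam (signedIndex S)`,
the variables in `S` come before the others, in descending order, and the others are in ascending
order. Since `0` has the exponent `0` in either case, adding it to `S` or removing it from `S`
does not change the radii. -/
def signedIndex (S : Finset (Fin n)) (a : Fin n) : ℤ := if a ∈ S then (a : ℕ) else -(a : ℕ)

theorem signedIndex_injective (S : Finset (Fin n)) : Function.Injective (signedIndex S) := by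
  intro a b h
  unfold signedIndex at h
  ext
  split_ifs at h <;> omega

theorem signedIndex_symmDiff_zero (S : Finset (Fin (n + 1))) :
    signedIndex (symmDiff S {0}) = signedIndex S := by
  ext a
  by_cases ha : a = 0
  · simp [ha, signedIndex]
  · simp [signedIndex, Finset.mem_symmDiff, ha]

end SignedIndex

section Deformation

variable {q : ℂ} {lam : ℝ} {k l : ℕ} {G : (Fin (k + l) → ℂ) → ℂ}

theorem lt_of_mem_offDiag_sdiff_blockPairs {ω : Equiv.Perm (Fin (k + l))}
    {p : Fin (k + l) × Fin (k + l)}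
    (hp : p ∈ (Finset.univ.offDiag \ inversePairs ω) \ blockPairs k l) :
    ω.symm p.1 < ω.symm p.2 ∧ if (p.2 : ℕ) < k then p.2 < p.1 else p.1 < p.2 := by
  simp only [Finset.mem_sdiff, Finset.mem_offDiag, Finset.mem_univ, true_and, inversePairs,
    blockPairs, Finset.mem_filter_univ, not_lt, not_or, not_and] at hp
  obtain ⟨⟨hne, hle⟩, hfront, hback⟩ := hp
  refine ⟨hle.lt_of_ne (ω.symm.injective.ne hne), ?_⟩
  split_ifs with hk
  · exact (not_lt.1 fun h => (hfront h).not_gt hk).lt_of_ne' hne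
  · exact (hback (not_lt.1 hk)).lt_of_ne hne

/-- The torus may be moved because its radii before and after are on the same side of all the poles
which the zeros of the two weights leave over. -/
theorem torusAvg_blockWeight_mul_symWeight_comp (hq : q ≠ 0) (hlam : |Real.log ‖q‖| < lam)
    (hG : HasSimpleShiftedPoles q G) (c : MvPolynomial (Fin k) ℂ) (e : ℕ)
    (c' : MvPolynomial (Fin l) ℂ) (e' : ℕ) (d : MvPolynomial (Fin (k + l)) ℂ) (f : ℕ)
    (ω : Equiv.Perm (Fin (k + l))) :
    torusAvg (expRadii lam fun i => -((i : ℕ) : ℤ))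
        (fun z => blockWeight q c e c' e' z * symWeight q d f (z ∘ ω) * G z) =
      torusAvg (expRadii lam (signedIndex (frontSet k ω) ∘ ω.symm))
        fun z => blockWeight q c e c' e' z * symWeight q d f (z ∘ ω) * G z := by
  obtain ⟨a, ha, hab⟩ := exists_blockWeight_eq_mul_pairProd (q := q) c e c' e'
  have hintegrand : ∀ z, blockWeight q c e c' e' z * symWeight q d f (z ∘ ω) * G z =
      (a z * (eval (z ∘ ω) d / (∏ i, z (ω i)) ^ f)) * pairProd q (blockPairs k l) z *
        pairProd q (inversePairs ω) z * G z := fun z => by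
    rw [hab, symWeight_comp]; ring
  have hneg : Function.Injective fun i : Fin (k + l) => -((i : ℕ) : ℤ) := fun i j hij => by
    ext; simpa using hij
  simp only [hintegrand]
  refine torusAvg_exp_eq_of_mem_sideCone hq (ha.mul (holOn_eval_comp_div_prod_pow ω d f)) hG
    (inversePairs_subset_offDiag ω) (blockPairs k l)
    (Finset.univ.filter fun v : Fin (k + l) => (v : ℕ) < k) (mul_sub_mul_ne hlam hneg)
    (mul_sub_mul_ne hlam ((signedIndex_injective (frontSet k ω)).comp ω.symm.injective))
    (mul_mem_sideCone hlam fun p hp => ?_) (mul_mem_sideCone hlam fun p hp => ?_)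
  all_goals
    obtain ⟨hω, hp⟩ := lt_of_mem_offDiag_sdiff_blockPairs hp
    simp only [Finset.mem_filter_univ, Function.comp_apply, signedIndex, mem_frontSet,
      Equiv.apply_symm_apply]
    split_ifs at hp ⊢ <;> omega

theorem torusAvg_blockWeight_mul_symWeight_reindex (hq : q ≠ 0) (hlam : |Real.log ‖q‖| < lam)
    (hsymm : ∀ σ : Equiv.Perm (Fin (k + l)), ∀ z ∈ regularSet q (k + l), G (z ∘ σ) = G z)
    (c : MvPolynomial (Fin k) ℂ) (e : ℕ) (c' : MvPolynomial (Fin l) ℂ) (e' : ℕ)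
    (d : MvPolynomial (Fin (k + l)) ℂ) (f : ℕ) (ω : Equiv.Perm (Fin (k + l))) :
    torusAvg (expRadii lam (signedIndex (frontSet k ω) ∘ ω.symm))
        (fun z => blockWeight q c e c' e' z * symWeight q d f (z ∘ ω) * G z) =
      torusAvg (expRadii lam (signedIndex (frontSet k ω))) fun z =>
        blockWeight q c e c' e' (z ∘ ω.symm) * symWeight q d f z * G z := by
  have hradii : expRadii lam (signedIndex (frontSet k ω) ∘ ω.symm) ∘ ω =
      expRadii lam (signedIndex (frontSet k ω)) := by
    ext i
    simp [expRadii]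
  rw [torusAvg_comp_equiv _ _ ω, hradii]
  refine torusAvg_congr expRadii_pos fun z hz => ?_
  have hcomp : (z ∘ ω.symm) ∘ ω = z := by ext; simp
  rw [hcomp, hsymm _ z (mem_regularSet_of_expRadii hq hlam (signedIndex_injective _) hz)]

theorem torusAvg_blockWeight_mul (hq : q ≠ 0) (hlam : |Real.log ‖q‖| < lam)
    {c : MvPolynomial (Fin k) ℂ} {e : ℕ} (hc : IsSymmetrizer q c e)
    {c' : MvPolynomial (Fin l) ℂ} {e' : ℕ} (hc' : IsSymmetrizer q c' e')
    {d : MvPolynomial (Fin (k + l)) ℂ} {f : ℕ} (hd : IsSymmetrizer q d f)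
    (hG : HasSimpleShiftedPoles q G)
    (hsymm : ∀ σ : Equiv.Perm (Fin (k + l)), ∀ z ∈ regularSet q (k + l), G (z ∘ σ) = G z) :
    torusAvg (expRadii lam fun i => -((i : ℕ) : ℤ)) (fun z => blockWeight q c e c' e' z * G z) =
      ∑ S ∈ Finset.powersetCard k Finset.univ,
        torusAvg (expRadii lam (signedIndex S)) fun z => symWeight q d f z * G z := by
  have hneg : Function.Injective fun i : Fin (k + l) => -((i : ℕ) : ℤ) := fun i j hij => by
    ext; simpa using hij
  have hmaps (ω : Equiv.Perm (Fin (k + l))) (_ : ω ∈ Finset.univ) :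
      frontSet k ω ∈ Finset.powersetCard k Finset.univ :=
    Finset.mem_powersetCard.2 ⟨Finset.subset_univ _, card_frontSet ω⟩
  rw [torusAvg_mul_eq_sum_symWeight_comp hq hlam hneg hd (holOn_blockWeight q c e c' e') hG,
    ← Finset.sum_fiberwise_of_maps_to hmaps]
  refine Finset.sum_congr rfl fun S hS => ?_
  trans ∑ ω : Equiv.Perm (Fin (k + l)) with frontSet k ω = S,
    torusAvg (expRadii lam (signedIndex S)) fun z =>
      blockWeight q c e c' e' (z ∘ ω.symm) * symWeight q d f z * G z
  · refine Finset.sum_congr rfl fun ω hω => ?_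
    rw [torusAvg_blockWeight_mul_symWeight_comp hq hlam hG,
      torusAvg_blockWeight_mul_symWeight_reindex hq hlam hsymm, (Finset.mem_filter.1 hω).2]
  rw [← torusAvg_sum expRadii_pos]
  · refine torusAvg_congr expRadii_pos fun z hz => ?_
    have hz' := mem_regularSet_of_expRadii hq hlam (signedIndex_injective S) hz
    rw [← Finset.sum_mul, ← Finset.sum_mul,
      sum_blockWeight_comp_symm hc hc' (Finset.mem_powersetCard.1 hS).2 hz'.1, one_mul]
  · exact fun ω _ => hG.continuousOn_mul_expRadii hq hlam (signedIndex_injective S)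
      ((((holOn_blockWeight q c e c' e').comp_perm ω.symm).mono
        fun z hz => comp_mem_torus hz ω.symm).mul (holOn_symWeight q d f))

end Deformation

theorem neg_one_pow_card_symmDiff_singleton {α : Type*} [DecidableEq α] (S : Finset α) (a : α) :
    (-1 : ℂ) ^ (symmDiff S {a}).card = -(-1) ^ S.card := by
  by_cases ha : a ∈ S
  · have herase : symmDiff S {a} = S.erase a := by
      ext b; by_cases hb : b = a <;> simp [Finset.mem_symmDiff, hb, ha]
    rw [herase, ← Finset.card_erase_add_one ha, pow_succ]
    ring
  · have hinsert : symmDiff S {a} = insert a S := by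
      ext b; by_cases hb : b = a <;> simp [Finset.mem_symmDiff, hb, ha]
    rw [hinsert, Finset.card_insert_of_notMem ha, pow_succ]
    ring

theorem sum_neg_one_pow_card_mul_eq_zero {α : Type*} [Fintype α] [DecidableEq α] (a : α)
    {J : Finset α → ℂ} (hJ : ∀ S, J (symmDiff S {a}) = J S) :
    ∑ S, (-1) ^ S.card * J S = 0 := by
  refine Finset.sum_involution (fun S _ => symmDiff S {a}) (fun S _ => ?_) (fun S _ _ h => ?_)
    (fun S _ => Finset.mem_univ _) (fun S _ => symmDiff_symmDiff_cancel_right _ _)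
  · rw [neg_one_pow_card_symmDiff_singleton, hJ]; ring
  · exact Finset.singleton_ne_empty a (symmDiff_eq_left.1 h)

theorem sum_antidiagonal_powersetCard_eq_zero {n : ℕ} {J : Finset (Fin (n + 1)) → ℂ}
    (hJ : ∀ S, J (symmDiff S {0}) = J S) :
    ∑ p ∈ Finset.HasAntidiagonal.antidiagonal (n + 1), (-1 : ℂ) ^ p.2 *
      ∑ S ∈ Finset.powersetCard p.1 Finset.univ, J S = 0 := by
  have hsign (p : ℕ × ℕ) (hp : p ∈ Finset.HasAntidiagonal.antidiagonal (n + 1)) :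
      (-1 : ℂ) ^ p.2 * ∑ S ∈ Finset.powersetCard p.1 Finset.univ, J S =
        (-1) ^ (n + 1) * ∑ S ∈ Finset.powersetCard p.1 Finset.univ, (-1) ^ S.card * J S := by
    have hpow : (-1 : ℂ) ^ (n + 1) * (-1) ^ p.1 = (-1) ^ p.2 := by
      rw [← Finset.HasAntidiagonal.mem_antidiagonal.1 hp, pow_add, mul_right_comm, ← mul_pow]
      simp
    rw [Finset.mul_sum, Finset.mul_sum]
    refine Finset.sum_congr rfl fun S hS => ?_
    rw [(Finset.mem_powersetCard.1 hS).2, ← mul_assoc, hpow]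
  rw [Finset.sum_congr rfl hsign, ← Finset.mul_sum]
  refine mul_eq_zero_of_right _ ?_
  rw [← sum_neg_one_pow_card_mul_eq_zero 0 hJ, ← Finset.powerset_univ, Finset.sum_powerset,
    Finset.card_fin, Finset.Nat.sum_antidiagonal_eq_sum_range_succ_mk]

end Cancellation

section OrderedRegion

variable {q : ℂ} {n : ℕ}

theorem mul_expRadii_lt {lam R : ℝ} (hR : R < Real.exp lam) (hlam : 0 ≤ lam) {t : Fin n → ℤ}
    {i j : Fin n} (h : t j < t i) : R * expRadii lam t j < expRadii lam t i := by
  have hgap : (t j : ℝ) + 1 ≤ t i := by exact_mod_cast h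
  calc R * expRadii lam t j < Real.exp lam * expRadii lam t j :=
        mul_lt_mul_of_pos_right hR (expRadii_pos j)
    _ = Real.exp (lam * (t j + 1)) := by rw [expRadii, ← Real.exp_add]; ring_nf
    _ ≤ expRadii lam t i := Real.exp_le_exp.2 (mul_le_mul_of_nonneg_left hgap hlam)

theorem orderedRegion_anti {R R' : ℝ} (h : R ≤ R') : orderedRegion R' n ⊆ orderedRegion R n :=
  fun _ hz => ⟨hz.1, fun i j hij =>
    (mul_le_mul_of_nonneg_right h (norm_nonneg _)).trans_lt (hz.2 i j hij)⟩

theorem eventually_orderedRegion_subset_regularSet (hq : q ≠ 0) :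
    ∀ᶠ R in atTop, orderedRegion R n ⊆ regularSet q n := by
  filter_upwards [eventually_ge_atTop ‖q‖, eventually_ge_atTop ‖q‖⁻¹] with R hR hR' z hz
  refine ⟨hz.1, fun i j hij heq => ?_⟩
  have hnorm : ‖z i‖ = ‖q‖ * ‖z j‖ := by rw [heq, norm_mul]
  rcases lt_or_gt_of_ne hij with hij | hij
  · have hle := mul_le_mul_of_nonneg_right hR (norm_nonneg (z j))
    exact ((hnorm.trans_le hle).trans_lt (hz.2 i j hij)).false
  · have hle := mul_le_mul_of_nonneg_right hR' (norm_nonneg (z i))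
    rw [hnorm, inv_mul_cancel_left₀ (norm_ne_zero_iff.2 hq), ← hnorm] at hle
    exact (hle.trans_lt (hz.2 j i hij)).false

theorem isOpen_torus : IsOpen (torus n) := by
  simp only [torus, Set.ofPred_forall]
  exact isOpen_iInter_of_finite fun i => isOpen_ne_fun (continuous_apply i) continuous_const

theorem isOpen_orderedRegion (R : ℝ) : IsOpen (orderedRegion R n) := by
  have hinter : orderedRegion R n = torus n ∩ ⋂ i, ⋂ j, {z | i < j → R * ‖z j‖ < ‖z i‖} := by
    ext
    simp [orderedRegion]
  rw [hinter]
  refine isOpen_torus.inter (isOpen_iInter_of_finite fun i => isOpen_iInter_of_finite fun j => ?_)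
  by_cases hij : i < j
  · simpa [hij] using isOpen_lt (by fun_prop : Continuous fun z : Fin n → ℂ => R * ‖z j‖)
      (by fun_prop)
  · simp [hij]

theorem isPreconnected_torus : IsPreconnected (torus n) := by
  have hpi : torus n = Set.univ.pi fun _ => ({0}ᶜ : Set ℂ) := by ext; simp [torus]
  rw [hpi]
  refine isPreconnected_univ_pi fun _ => (isConnected_compl_singleton_of_one_lt_rank ?_ 0).2
  rw [Complex.rank_real_complex]
  norm_num

theorem mem_torus_of_norm {r : Fin n → ℝ} (hr : ∀ i, 0 < r i) {z : Fin n → ℂ}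
    (hz : ∀ i, ‖z i‖ = r i) : z ∈ torus n :=
  fun i => norm_pos_iff.1 ((hz i).symm ▸ hr i)

theorem mem_orderedRegion_of_expRadii {lam R : ℝ} (hR : R < Real.exp lam) (hlam : 0 ≤ lam)
    {t : Fin n → ℤ} (ht : StrictAnti t) {z : Fin n → ℂ} (hz : ∀ i, ‖z i‖ = expRadii lam t i) :
    z ∈ orderedRegion R n :=
  ⟨mem_torus_of_norm expRadii_pos hz, fun i j hij => by
    rw [hz, hz]
    exact mul_expRadii_lt hR hlam (ht hij)⟩

theorem strictAnti_neg_val : StrictAnti fun i : Fin n => -((i : ℕ) : ℤ) :=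
  fun i j (hij : (i : ℕ) < j) => by simp only; omega

theorem orderedRegion_nonempty (R : ℝ) : (orderedRegion R n).Nonempty := by
  obtain ⟨lam, hlam, hR⟩ := ((eventually_ge_atTop (0 : ℝ)).and
    (Real.tendsto_exp_atTop.eventually_gt_atTop R)).exists
  exact ⟨_, mem_orderedRegion_of_expRadii hR hlam strictAnti_neg_val
    (norm_torusPoint expRadii_pos 0)⟩

end OrderedRegion

section LaurentCoefficients

open MeasureTheory

variable {n : ℕ} {r : Fin n → ℝ}

theorem continuousOn_prod_zpow (hr : ∀ i, 0 < r i) (m : Fin n → ℤ) :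
    ContinuousOn (fun z : Fin n → ℂ => ∏ i, z i ^ m i) {z | ∀ i, ‖z i‖ = r i} :=
  continuousOn_finsetProd _ fun i _ => (continuous_apply i).continuousOn.zpow₀ _ fun _ hz =>
    Or.inl (mem_torus_of_norm hr hz i)

theorem hasSum_torusAvg (hr : ∀ i, 0 < r i) {κ : Type*} [Countable κ]
    {F : κ → (Fin n → ℂ) → ℂ} {f : (Fin n → ℂ) → ℂ} {bound : κ → ℝ}
    (hF : ∀ k, ContinuousOn (F k) {z | ∀ i, ‖z i‖ = r i})
    (hbound : ∀ k z, (∀ i, ‖z i‖ = r i) → ‖F k z‖ ≤ bound k) (hsummable : Summable bound)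
    (hsum : ∀ z, (∀ i, ‖z i‖ = r i) → HasSum (fun k => F k z) (f z)) :
    HasSum (fun k => torusAvg r (F k)) (torusAvg r f) :=
  hasSum_integral_of_dominated_convergence (fun k _ => bound k)
    (fun k => (integrable_comp_torusPoint hr (hF k)).aestronglyMeasurable)
    (fun k => Eventually.of_forall fun u => hbound k _ (norm_torusPoint hr u))
    (Eventually.of_forall fun _ => hsummable) (integrable_const _)
    (Eventually.of_forall fun u => hsum _ (norm_torusPoint hr u))

theorem torusAvg_prod_zpow_mul_of_hasSum (hr : ∀ i, 0 < r i) {a : (Fin n → ℤ) → ℂ}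
    {G : (Fin n → ℂ) → ℂ}
    (h : ∀ z, (∀ i, ‖z i‖ = r i) → HasSum (fun m => a m * ∏ i, z i ^ (-m i)) (G z))
    (m : Fin n → ℤ) : torusAvg r (fun z => (∏ i, z i ^ m i) * G z) = a m := by
  have hnorm (k : Fin n → ℤ) {z : Fin n → ℂ} (hz : ∀ i, ‖z i‖ = r i) :
      ‖a k * ∏ i, z i ^ (m - k) i‖ = ‖a k‖ * ∏ i, r i ^ (m - k) i := by
    simp only [norm_mul, norm_prod, norm_zpow, hz]
  have hsum {z : Fin n → ℂ} (hz : ∀ i, ‖z i‖ = r i) :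
      HasSum (fun k => a k * ∏ i, z i ^ (m - k) i) ((∏ i, z i ^ m i) * G z) := by
    have hterm (k : Fin n → ℤ) :
        a k * ∏ i, z i ^ (m - k) i = (∏ i, z i ^ m i) * (a k * ∏ i, z i ^ (-k i)) := by
      simp only [mul_left_comm, ← Finset.prod_mul_distrib,
        ← zpow_add₀ (mem_torus_of_norm hr hz _), Pi.sub_apply, sub_eq_add_neg]
    simp only [hterm]
    exact (h z hz).mul_left _
  have hsummable : Summable fun k => ‖a k‖ * ∏ i, r i ^ (m - k) i := by
    simpa only [hnorm _ (norm_torusPoint hr 0)] using (hsum (norm_torusPoint hr 0)).summable.norm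
  have havg (k : Fin n → ℤ) : torusAvg r (fun z => a k * ∏ i, z i ^ (m - k) i) =
      if k = m then a m else 0 := by
    rw [torusAvg_const_mul, torusAvg_prod_zpow hr]
    by_cases hk : k = m
    · subst hk
      simp
    · rw [if_neg hk, if_neg (by rw [sub_eq_zero]; exact Ne.symm hk), mul_zero]
  have htotal := hasSum_torusAvg hr (F := fun k z => a k * ∏ i, z i ^ (m - k) i)
    (fun k => continuousOn_const.mul (continuousOn_prod_zpow hr (m - k)))
    (fun k z hz => (hnorm k hz).le) hsummable fun z hz => hsum hz
  simp only [havg] at htotal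
  exact htotal.unique (hasSum_ite_eq m _)

end LaurentCoefficients

section Continuation

variable {V : Type*} [AddCommGroup V] [Module ℂ V] {q : ℂ} {x : ℤ → Module.End ℂ V}
  {φ : Module.Dual ℂ V} {v : V} {n : ℕ} {G G' : (Fin n → ℂ) → ℂ}

theorem IsContinuation.hasSimpleShiftedPoles (h : IsContinuation q x φ v n G) :
    HasSimpleShiftedPoles q G := by
  obtain ⟨F, hF, h⟩ := h.simple_poles
  exact ⟨F, holOn_of_analyticOnNhd hF,
    fun z hz => by rw [h z hz, prod_prod_eq_pairProd_offDiag]⟩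

theorem IsContinuation.eqOn (hq : q ≠ 0) (h : IsContinuation q x φ v n G)
    (h' : IsContinuation q x φ v n G') : Set.EqOn G G' (regularSet q n) := by
  obtain ⟨F, hF, hFG⟩ := h.simple_poles
  obtain ⟨F', hF', hFG'⟩ := h'.simple_poles
  obtain ⟨R, -, hR⟩ := h.expansion
  obtain ⟨R', -, hR'⟩ := h'.expansion
  obtain ⟨S, hRS, hRS', hS⟩ := ((eventually_ge_atTop R).and ((eventually_ge_atTop R').and
    (eventually_orderedRegion_subset_regularSet (n := n) hq))).exists
  obtain ⟨z₀, hz₀⟩ := orderedRegion_nonempty (n := n) S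
  have heq : F =ᶠ[𝓝 z₀] F' := by
    filter_upwards [(isOpen_orderedRegion S).mem_nhds hz₀] with z hz
    rw [hFG z (hS hz), hFG' z (hS hz), (hR z (orderedRegion_anti hRS hz)).unique
      (hR' z (orderedRegion_anti hRS' hz))]
  intro z hz
  have hFF' := hF.eqOn_of_preconnected_of_eventuallyEq hF' isPreconnected_torus hz₀.1 heq hz.1
  rw [hFG z hz, hFG' z hz, prod_prod_eq_pairProd_offDiag] at hFF'
  exact mul_left_cancel₀ (pairProd_ne_zero_of_mem_regularSet subset_rfl hz) hFF'

theorem comp_perm_mem_regularSet {z : Fin n → ℂ} (hz : z ∈ regularSet q n)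
    (σ : Equiv.Perm (Fin n)) : z ∘ σ ∈ regularSet q n :=
  ⟨comp_mem_torus hz.1 σ, fun _ _ hij => hz.2 _ _ (σ.injective.ne hij)⟩

theorem IsContinuation.comp_perm_eq {D : Submodule ℂ (Module.Dual ℂ V)} (hq : q ≠ 0)
    (hcomm : IsAlmostCommutative D q x) (hφ : φ ∈ D) (h : IsContinuation q x φ v n G)
    (σ : Equiv.Perm (Fin n)) (z : Fin n → ℂ) (hz : z ∈ regularSet q n) : G (z ∘ σ) = G z := by
  obtain ⟨G', h', hsymm⟩ := hcomm n φ hφ v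
  rw [h.eqOn hq h' hz, h.eqOn hq h' (comp_perm_mem_regularSet hz σ), hsymm σ z hz]

end Continuation

section ModePolynomials

open MvPolynomial

variable {V : Type*} [AddCommGroup V] [Module ℂ V] {q : ℂ} {x : ℤ → Module.End ℂ V}
  {φ : Module.Dual ℂ V} {v : V} {n : ℕ} {r : Fin n → ℝ} {G : (Fin n → ℂ) → ℂ}

/-- On the torus `|zᵢ| = rᵢ` the Laurent series of the matrix coefficient `⟨φ, x(z₁) ⋯ x(zₙ) v⟩`
converges to `G`, and `G` is continuous. -/
structure ExpandsOnTorus (x : ℤ → Module.End ℂ V) (φ : Module.Dual ℂ V) (v : V) {n : ℕ}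
    (r : Fin n → ℝ) (G : (Fin n → ℂ) → ℂ) : Prop where
  hasSum : ∀ z, (∀ i, ‖z i‖ = r i) →
    HasSum (fun m : Fin n → ℤ => φ (modeProduct x m v) * ∏ i, z i ^ (-m i)) (G z)
  continuousOn : ContinuousOn G {z | ∀ i, ‖z i‖ = r i}

theorem IsContinuation.eventually_expandsOnTorus (hq : q ≠ 0) (h : IsContinuation q x φ v n G)
    {t : Fin n → ℤ} (ht : StrictAnti t) :
    ∀ᶠ lam in atTop, ExpandsOnTorus x φ v (expRadii lam t) G := by
  obtain ⟨R, -, hR⟩ := h.expansion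
  filter_upwards [eventually_ge_atTop (0 : ℝ), Real.tendsto_exp_atTop.eventually_gt_atTop R,
    eventually_gt_atTop |Real.log ‖q‖|] with lam hlam hRlam hqlam
  exact ⟨fun z hz => hR z (mem_orderedRegion_of_expRadii hRlam hlam ht hz),
    h.analytic.continuousOn.mono fun z hz => mem_regularSet_of_expRadii hq hqlam ht.injective hz⟩

theorem torusAvg_sum_prod_zpow_mul (hr : ∀ i, 0 < r i) (hG : ExpandsOnTorus x φ v r G)
    {ι : Type*} (s : Finset ι) (a : ι → ℂ) (m : ι → Fin n → ℤ) :
    torusAvg r (fun z => (∑ i ∈ s, a i * ∏ j, z j ^ m i j) * G z) =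
      φ ((∑ i ∈ s, a i • modeProduct x (m i)) v) := by
  simp only [Finset.sum_mul, mul_assoc]
  rw [torusAvg_sum hr]
  · simp only [torusAvg_const_mul, torusAvg_prod_zpow_mul_of_hasSum hr hG.hasSum,
      LinearMap.sum_apply, map_sum, LinearMap.smul_apply, map_smul, smul_eq_mul]
  · exact fun i _ =>
      continuousOn_const.mul ((continuousOn_prod_zpow hr (m i)).mul hG.continuousOn)

/-- The operator obtained from `f / (∏ i, zᵢ) ^ e` by replacing each monomial by the product of the
modes with the same exponents. -/
def modePolynomial (x : ℤ → Module.End ℂ V) {n : ℕ} (f : MvPolynomial (Fin n) ℂ) (e : ℕ) :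
    Module.End ℂ V :=
  ∑ β ∈ f.support, coeff β f • modeProduct x fun i => (β i : ℤ) - e

theorem eval_div_prod_pow_eq_sum {z : Fin n → ℂ} (hz : z ∈ torus n) (f : MvPolynomial (Fin n) ℂ)
    (e : ℕ) :
    eval z f / (∏ i, z i) ^ e = ∑ β ∈ f.support, coeff β f * ∏ i, z i ^ ((β i : ℤ) - e) := by
  simp only [eval_eq', Finset.sum_div, mul_div_assoc, ← Finset.prod_pow, ← Finset.prod_div_distrib,
    zpow_sub₀ (hz _), zpow_natCast]

theorem apply_modePolynomial (hr : ∀ i, 0 < r i) (hG : ExpandsOnTorus x φ v r G)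
    (f : MvPolynomial (Fin n) ℂ) (e : ℕ) :
    φ (modePolynomial x f e v) = torusAvg r (fun z => eval z f / (∏ i, z i) ^ e * G z) := by
  rw [modePolynomial, ← torusAvg_sum_prod_zpow_mul hr hG]
  refine torusAvg_congr hr fun z hz => ?_
  rw [eval_div_prod_pow_eq_sum (mem_torus_of_norm hr hz)]

theorem modeProduct_append {k l : ℕ} (m : Fin k → ℤ) (m' : Fin l → ℤ) :
    modeProduct x (Fin.append m m') = modeProduct x m * modeProduct x m' := by
  have happend : (fun i => x (Fin.append m m' i)) =
      Fin.append (fun i => x (m i)) fun i => x (m' i) := by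
    funext i
    induction i using Fin.addCases <;> simp
  rw [modeProduct, happend, List.ofFn_fin_append, List.prod_append]
  rfl

theorem apply_modePolynomial_mul {k l : ℕ} {G : (Fin (k + l) → ℂ) → ℂ} {r : Fin (k + l) → ℝ}
    (hr : ∀ i, 0 < r i) (hG : ExpandsOnTorus x φ v r G) (f : MvPolynomial (Fin k) ℂ) (e : ℕ)
    (f' : MvPolynomial (Fin l) ℂ) (e' : ℕ) :
    φ ((modePolynomial x f e * modePolynomial x f' e') v) = torusAvg r (fun z =>
      eval (z ∘ Fin.castAdd l) f / (∏ i, z (Fin.castAdd l i)) ^ e *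
        (eval (z ∘ Fin.natAdd k) f' / (∏ j, z (Fin.natAdd k j)) ^ e') * G z) := by
  have hmul : modePolynomial x f e * modePolynomial x f' e' =
      ∑ p ∈ f.support ×ˢ f'.support, (coeff p.1 f * coeff p.2 f') •
        modeProduct x (Fin.append (fun i => (p.1 i : ℤ) - e) fun j => (p.2 j : ℤ) - e') := by
    simp only [modePolynomial, Finset.sum_mul_sum, Finset.sum_product, modeProduct_append,
      smul_mul_smul_comm]
  rw [hmul, ← torusAvg_sum_prod_zpow_mul hr hG]
  refine torusAvg_congr hr fun z hz => ?_
  have hz' := mem_torus_of_norm hr hz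
  rw [show (∏ i, z (Fin.castAdd l i)) = ∏ i, (z ∘ Fin.castAdd l) i from rfl,
    show (∏ j, z (Fin.natAdd k j)) = ∏ j, (z ∘ Fin.natAdd k) j from rfl,
    eval_div_prod_pow_eq_sum (comp_mem_torus hz' _),
    eval_div_prod_pow_eq_sum (comp_mem_torus hz' _), Finset.sum_mul_sum, Finset.sum_product]
  simp only [Fin.prod_univ_add, Fin.append_left, Fin.append_right, Function.comp_apply,
    mul_mul_mul_comm]

end ModePolynomials

section SymmetrizedIntegrals

open MvPolynomial

variable {q p : ℂ} {K n : ℕ}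

theorem genericSet_subset_regularSet {k : ℤ} (hk : p ^ k = q) (hK : |k| ≤ K) :
    genericSet p K n ⊆ regularSet q n :=
  fun _ hz => ⟨hz.1, fun i j hij => by rw [← hk]; exact hz.2 i j hij k hK⟩

theorem exists_pairProd_eq_mul_eval {pos : Fin n → ℕ} {E : Finset (Fin n × Fin n)}
    (hE : ∀ a ∈ E, ∃ κ, ∃ f ∈ linearForms p pos, ∀ z : Fin n → ℂ,
      z a.1 - q * z a.2 = κ * eval z f) :
    ∃ κ, ∃ D ∈ Submonoid.closure (linearForms p pos), ∀ z, pairProd q E z = κ * eval z D := by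
  choose! κ f hf hκ using hE
  refine ⟨∏ a ∈ E, κ a, ∏ a ∈ E, f a,
    Submonoid.prod_mem _ fun a ha => Submonoid.subset_closure (hf a ha), fun z => ?_⟩
  rw [pairProd, eval_prod, ← Finset.prod_mul_distrib]
  exact Finset.prod_congr rfl fun a ha => hκ a ha z

/-- The zeros of the weight cancel the poles of `G` along `inversePairs ω`. -/
theorem HasSimpleShiftedPoles.isLinearQuotient_symWeight_comp_mul {G : (Fin n → ℂ) → ℂ}
    (hG : HasSimpleShiftedPoles q G) (hgen : genericSet p K n ⊆ regularSet q n)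
    (c : MvPolynomial (Fin n) ℂ) (e : ℕ) (ω : Equiv.Perm (Fin n)) {pos : Fin n → ℕ}
    (hforms : ∀ i j, ω.symm i < ω.symm j → ∃ κ, ∃ f ∈ linearForms p pos, ∀ z : Fin n → ℂ,
      z i - q * z j = κ * eval z f) :
    IsLinearQuotient p K pos fun z => symWeight q c e (z ∘ ω) * G z := by
  obtain ⟨F, hF, hFG⟩ := hG
  set E := Finset.univ.offDiag \ inversePairs ω
  obtain ⟨κ, D, hD, hκ⟩ := exists_pairProd_eq_mul_eval (E := E) fun a ha => by
    obtain ⟨hoff, hinv⟩ := Finset.mem_sdiff.1 ha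
    rw [inversePairs, Finset.mem_filter_univ, not_lt] at hinv
    exact hforms _ _ (hinv.lt_of_ne (ω.symm.injective.ne (Finset.mem_offDiag.1 hoff).2.2))
  refine ⟨fun z => κ⁻¹ * (eval (z ∘ ω) c / (∏ i, z (ω i)) ^ e * F z), D, ?_, hD, fun z hz => ?_⟩
  · have hconst : HolOn (fun _ => κ⁻¹) (torus n) := by
      simpa using holOn_eval (C κ⁻¹) (torus n)
    exact hconst.mul ((holOn_eval_comp_div_prod_pow ω c e).mul hF)
  have hne : pairProd q E z ≠ 0 :=
    pairProd_ne_zero_of_mem_regularSet Finset.sdiff_subset (hgen hz)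
  have hoffDiag : pairProd q E z * pairProd q (inversePairs ω) z =
      pairProd q Finset.univ.offDiag z := Finset.prod_sdiff (inversePairs_subset_offDiag ω)
  rw [hκ] at hne hoffDiag
  have hκ0 : κ ≠ 0 := left_ne_zero_of_mul hne
  simp only
  rw [eq_div_iff (right_ne_zero_of_mul hne), hFG z (hgen hz), ← hoffDiag, symWeight_comp]
  field_simp

theorem torusAvg_symWeight_comp_mul {G : (Fin n → ℂ) → ℂ} {r : Fin n → ℝ} (hr : ∀ i, 0 < r i)
    (hsymm : ∀ (σ : Equiv.Perm (Fin n)) z, (∀ i, ‖z i‖ = r i) → G (z ∘ σ) = G z)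
    (c : MvPolynomial (Fin n) ℂ) (e : ℕ) (ω : Equiv.Perm (Fin n)) :
    torusAvg (r ∘ ω.symm) (fun z => symWeight q c e (z ∘ ω) * G z) =
      torusAvg r fun z => symWeight q c e z * G z := by
  rw [torusAvg_comp_equiv _ _ ω, Function.comp_assoc, Equiv.symm_comp_self, Function.comp_id]
  refine torusAvg_congr hr fun z hz => ?_
  rw [Function.comp_assoc, Equiv.symm_comp_self, Function.comp_id, hsymm _ z hz]

/-- Each summand of the symmetrization is a linear quotient, whose iterated integral is the average
over a torus with the order of radii given by `ω`; by symmetry these averages are all equal. -/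
theorem iteratedIntegral_eq_factorial_mul_torusAvg (hq : q ≠ 0) (hp : p ≠ 0)
    (hroot : ∀ k : ℕ, 0 < k → p ^ k ≠ 1) {cs : List Contour}
    (hcs : ∀ a ∈ cs, a.insideRatio q = p⁻¹) {g : Fin cs.length → ℕ} (hg : Function.Injective g)
    (hgle : ∀ i, g i ≤ cs.length)
    (hgen : genericSet p (2 * cs.length + 1) cs.length ⊆ regularSet q cs.length)
    (hforms : ∀ (ω : Equiv.Perm (Fin cs.length)) i j, ω.symm i < ω.symm j →
      ∃ κ, ∃ f ∈ linearForms p (g ∘ ω.symm), ∀ z : Fin cs.length → ℂ,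
        z i - q * z j = κ * eval z f)
    {c : MvPolynomial (Fin cs.length) ℂ} {e : ℕ} (hc : IsSymmetrizer q c e)
    {G : (Fin cs.length → ℂ) → ℂ} (hG : HasSimpleShiftedPoles q G)
    (hsymm : ∀ σ : Equiv.Perm (Fin cs.length), ∀ z ∈ regularSet q cs.length, G (z ∘ σ) = G z)
    (σ : Equiv.Perm (Fin cs.length)) :
    ∀ᶠ lam in atTop, iteratedIntegral q cs.length cs (fun z => G (z ∘ σ)) =
      (cs.length.factorial : ℂ) *
        torusAvg (expRadii lam fun i => (g i : ℤ)) fun z => symWeight q c e z * G z := by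
  obtain ⟨M, hM⟩ := exists_norm_zpow_lt p (2 * cs.length + 1)
  filter_upwards [eventually_ge_atTop (0 : ℝ), Real.tendsto_exp_atTop.eventually_gt_atTop M,
    eventually_gt_atTop |Real.log ‖q‖|] with lam hlam hMlam hqlam
  have hinj : Function.Injective fun i => (g i : ℤ) := Nat.cast_injective.comp hg
  have hsymm' (σ : Equiv.Perm (Fin cs.length)) (z : Fin cs.length → ℂ)
      (hz : ∀ i, ‖z i‖ = expRadii lam (fun i => (g i : ℤ)) i) : G (z ∘ σ) = G z :=
    hsymm σ z (mem_regularSet_of_expRadii hq hqlam hinj hz)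
  rw [iteratedIntegral_eq_sum_torusAvg hp hroot (by omega : 2 * cs.length ≤ 2 * cs.length + 1) hM
    (Finset.univ : Finset (Equiv.Perm (Fin cs.length))) cs hcs (fun ω => g ∘ ω.symm)
    (fun ω => expRadii lam (fun i => (g i : ℤ)) ∘ ω.symm)
    (fun ω z => symWeight q c e (z ∘ ω) * G z) _ (fun ω _ => hg.comp ω.symm.injective)
    (fun ω _ i => hgle _) (fun ω _ i => expRadii_pos _)
    (fun ω _ i j hij => mul_expRadii_lt hMlam hlam (Nat.cast_lt.2 hij))
    (fun ω _ => hG.isLinearQuotient_symWeight_comp_mul hgen c e ω (hforms ω)) fun z hz => ?_]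
  · simp only [torusAvg_symWeight_comp_mul expRadii_pos hsymm', Finset.sum_const, Finset.card_univ,
      Fintype.card_perm, Fintype.card_fin, nsmul_eq_mul]
  · rw [← Finset.sum_mul, hc.sum_symWeight_comp (hgen hz).1, one_mul, hsymm σ z (hgen hz)]

end SymmetrizedIntegrals

section Operators

open MvPolynomial

variable {V : Type*} [AddCommGroup V] [Module ℂ V] {q : ℂ} {x : ℤ → Module.End ℂ V}
  {D : Submodule ℂ (Module.Dual ℂ V)}

theorem strictAnti_rev_val (n : ℕ) : StrictAnti fun i : Fin n => ((i.rev : ℕ) : ℤ) :=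
  fun _ _ hij => Nat.cast_lt.2 (Fin.rev_lt_rev.2 hij)

theorem iteratedIntegral_C_eq (hq0 : q ≠ 0) (hq : ∀ n : ℕ, 0 < n → q ^ n ≠ 1)
    {cs : List Contour} (hcs : ∀ a ∈ cs, a = Contour.C) {c : MvPolynomial (Fin cs.length) ℂ}
    {e : ℕ} (hc : IsSymmetrizer q c e) {G : (Fin cs.length → ℂ) → ℂ}
    (hG : HasSimpleShiftedPoles q G)
    (hsymm : ∀ σ : Equiv.Perm (Fin cs.length), ∀ z ∈ regularSet q cs.length, G (z ∘ σ) = G z)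
    (σ : Equiv.Perm (Fin cs.length)) :
    ∀ᶠ lam in atTop, iteratedIntegral q cs.length cs (fun z => G (z ∘ σ)) =
      (cs.length.factorial : ℂ) * torusAvg (expRadii lam fun i => ((i.rev : ℕ) : ℤ))
        fun z => symWeight q c e (z ∘ Fin.revPerm) * G z := by
  have hforms (ω : Equiv.Perm (Fin cs.length)) (i j : Fin cs.length) (hij : ω.symm i < ω.symm j) :
      ∃ κ, ∃ f ∈ linearForms q (Fin.val ∘ ω.symm), ∀ z : Fin cs.length → ℂ,
        z i - q * z j = κ * eval z f :=
    ⟨1, X i - C (q ^ 1) * X j, ⟨i, j, 1, le_rfl, by simp only [Function.comp_apply]; omega, rfl⟩,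
      fun z => by simp⟩
  filter_upwards [iteratedIntegral_eq_factorial_mul_torusAvg hq0 hq0 hq (fun a ha => hcs a ha ▸ rfl)
    Fin.val_injective (fun i => i.2.le)
    (genericSet_subset_regularSet (zpow_one q) (by push_cast; rw [abs_one]; omega)) hforms hc hG
    hsymm σ, eventually_gt_atTop |Real.log ‖q‖|] with lam hintegral hlam
  have hinj : Function.Injective fun i : Fin cs.length => ((i : ℕ) : ℤ) :=
    Nat.cast_injective.comp Fin.val_injective
  rw [hintegral, ← torusAvg_symWeight_comp_mul expRadii_pos
    (fun σ z hz => hsymm σ z (mem_regularSet_of_expRadii hq0 hlam hinj hz)) c e Fin.revPerm]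
  rfl

theorem iteratedIntegral_C'_eq (hq0 : q ≠ 0) (hq : ∀ n : ℕ, 0 < n → q ^ n ≠ 1)
    {cs : List Contour} (hcs : ∀ a ∈ cs, a = Contour.C') {c : MvPolynomial (Fin cs.length) ℂ}
    {e : ℕ} (hc : IsSymmetrizer q c e) {G : (Fin cs.length → ℂ) → ℂ}
    (hG : HasSimpleShiftedPoles q G)
    (hsymm : ∀ σ : Equiv.Perm (Fin cs.length), ∀ z ∈ regularSet q cs.length, G (z ∘ σ) = G z)
    (σ : Equiv.Perm (Fin cs.length)) :
    ∀ᶠ lam in atTop, iteratedIntegral q cs.length cs (fun z => G (z ∘ σ)) =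
      (cs.length.factorial : ℂ) * torusAvg (expRadii lam fun i => ((i.rev : ℕ) : ℤ))
        fun z => symWeight q c e z * G z := by
  have hforms (ω : Equiv.Perm (Fin cs.length)) (i j : Fin cs.length) (hij : ω.symm i < ω.symm j) :
      ∃ κ, ∃ f ∈ linearForms q⁻¹ ((Fin.val ∘ Fin.rev) ∘ ω.symm), ∀ z : Fin cs.length → ℂ,
        z i - q * z j = κ * eval z f := by
    have hrev : (ω.symm j).rev < (ω.symm i).rev := Fin.rev_lt_rev.2 hij
    refine ⟨-q, X j - C (q⁻¹ ^ 1) * X i,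
      ⟨j, i, 1, le_rfl, by simp only [Function.comp_apply]; omega, rfl⟩, fun z => ?_⟩
    simp only [eval_sub, eval_mul, eval_X, eval_C, pow_one]
    field_simp
    ring
  exact iteratedIntegral_eq_factorial_mul_torusAvg hq0 (inv_ne_zero hq0)
    (fun k hk => by rw [inv_pow, ne_eq, inv_eq_one]; exact hq k hk)
    (fun a ha => by rw [hcs a ha, inv_inv]; rfl) (Fin.val_injective.comp Fin.rev_injective)
    (fun i => i.rev.2.le) (genericSet_subset_regularSet (k := -1) (by rw [zpow_neg_one, inv_inv])
      (by push_cast; rw [abs_neg, abs_one]; omega)) hforms hc hG hsymm σ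

theorem isIntegralOperator_C (hq0 : q ≠ 0) (hq : ∀ n : ℕ, 0 < n → q ^ n ≠ 1)
    (hcomm : IsAlmostCommutative D q x) {cs : List Contour} (hcs : ∀ a ∈ cs, a = Contour.C)
    {c : MvPolynomial (Fin cs.length) ℂ} {e : ℕ} (hc : IsSymmetrizer q c e)
    (σ : Equiv.Perm (Fin cs.length)) :
    IsIntegralOperator D q x cs σ ((cs.length.factorial : ℂ) •
      modePolynomial x (rename Fin.revPerm (c * qVandermonde q cs.length)) e) := by
  intro φ hφ v G hG
  obtain ⟨lam, hintegral, hexpands⟩ := ((iteratedIntegral_C_eq hq0 hq hcs hc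
    hG.hasSimpleShiftedPoles (hG.comp_perm_eq hq0 hcomm hφ) σ).and
    (hG.eventually_expandsOnTorus hq0 (strictAnti_rev_val _))).exists
  rw [hintegral, LinearMap.smul_apply, map_smul, smul_eq_mul,
    apply_modePolynomial expRadii_pos hexpands]
  simp only [symWeight, eval_rename, Function.comp_apply, Equiv.prod_comp]

theorem isIntegralOperator_C' (hq0 : q ≠ 0) (hq : ∀ n : ℕ, 0 < n → q ^ n ≠ 1)
    (hcomm : IsAlmostCommutative D q x) {cs : List Contour} (hcs : ∀ a ∈ cs, a = Contour.C')
    {c : MvPolynomial (Fin cs.length) ℂ} {e : ℕ} (hc : IsSymmetrizer q c e)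
    (σ : Equiv.Perm (Fin cs.length)) :
    IsIntegralOperator D q x cs σ ((cs.length.factorial : ℂ) •
      modePolynomial x (c * qVandermonde q cs.length) e) := by
  intro φ hφ v G hG
  obtain ⟨lam, hintegral, hexpands⟩ := ((iteratedIntegral_C'_eq hq0 hq hcs hc
    hG.hasSimpleShiftedPoles (hG.comp_perm_eq hq0 hcomm hφ) σ).and
    (hG.eventually_expandsOnTorus hq0 (strictAnti_rev_val _))).exists
  rw [hintegral, LinearMap.smul_apply, map_smul, smul_eq_mul,
    apply_modePolynomial expRadii_pos hexpands]
  rfl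

theorem apply_modePolynomial_mul_eq_torusAvg_blockWeight {k l : ℕ} {φ : Module.Dual ℂ V} {v : V}
    {r : Fin (k + l) → ℝ} (hr : ∀ i, 0 < r i) {G : (Fin (k + l) → ℂ) → ℂ}
    (hG : ExpandsOnTorus x φ v r G) (c : MvPolynomial (Fin k) ℂ) (e : ℕ)
    (c' : MvPolynomial (Fin l) ℂ) (e' : ℕ) :
    φ ((modePolynomial x (rename Fin.revPerm (c * qVandermonde q k)) e *
      modePolynomial x (c' * qVandermonde q l) e') v) =
        torusAvg r fun z => blockWeight q c e c' e' z * G z := by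
  rw [apply_modePolynomial_mul hr hG]
  refine torusAvg_congr hr fun z _ => ?_
  rw [← Equiv.prod_comp Fin.revPerm fun i => z (Fin.castAdd l i), eval_rename]
  rfl

theorem sum_antidiagonal_modePolynomial_mul_eq_zero (hD : ∀ v : V, (∀ φ ∈ D, φ v = 0) → v = 0)
    (hq0 : q ≠ 0) (hcomm : IsAlmostCommutative D q x) {c : ∀ n, MvPolynomial (Fin n) ℂ}
    {e : ℕ → ℕ} (hc : ∀ n, IsSymmetrizer q (c n) (e n)) (n : ℕ) :
    ∑ p ∈ Finset.HasAntidiagonal.antidiagonal (n + 1), (-1 : ℂ) ^ p.2 •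
      (modePolynomial x (rename Fin.revPerm (c p.1 * qVandermonde q p.1)) (e p.1) *
        modePolynomial x (c p.2 * qVandermonde q p.2) (e p.2)) = 0 := by
  refine LinearMap.ext fun v => hD _ fun φ hφ => ?_
  obtain ⟨G, hG, hsymm⟩ := hcomm (n + 1) φ hφ v
  obtain ⟨lam, hexpands, hlam⟩ := ((hG.eventually_expandsOnTorus hq0 strictAnti_neg_val).and
    (eventually_gt_atTop |Real.log ‖q‖|)).exists
  have hpoles := hG.hasSimpleShiftedPoles
  rw [LinearMap.sum_apply, map_sum, ← sum_antidiagonal_powersetCard_eq_zero (n := n) (J := fun S =>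
    torusAvg (expRadii lam (signedIndex S)) fun z => symWeight q (c (n + 1)) (e (n + 1)) z * G z)
    fun S => by simp only [signedIndex_symmDiff_zero]]
  refine Finset.sum_congr rfl fun ⟨k, l⟩ hp => ?_
  have hkl : k + l = n + 1 := Finset.HasAntidiagonal.mem_antidiagonal.1 hp
  rw [LinearMap.smul_apply, map_smul, smul_eq_mul]
  congr 1
  clear hp hG
  generalize n + 1 = m at *
  subst hkl
  rw [apply_modePolynomial_mul_eq_torusAvg_blockWeight expRadii_pos hexpands,
    torusAvg_blockWeight_mul hq0 hlam (hc k) (hc l) (hc (k + l)) hpoles hsymm]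

end Operators

section OrderedExponential

open MvPolynomial (rename)

variable {V : Type*} [AddCommGroup V] [Module ℂ V] {q : ℂ} {x : ℤ → Module.End ℂ V}
  {D : Submodule ℂ (Module.Dual ℂ V)}

theorem IsIntegralOperator.unique (hD : ∀ v : V, (∀ φ ∈ D, φ v = 0) → v = 0)
    (hcomm : IsAlmostCommutative D q x) {cs : List Contour} {σ : Equiv.Perm (Fin cs.length)}
    {T T' : Module.End ℂ V} (h : IsIntegralOperator D q x cs σ T)
    (h' : IsIntegralOperator D q x cs σ T') : T = T' := by
  refine LinearMap.ext fun v => sub_eq_zero.1 (hD _ fun φ hφ => ?_)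
  obtain ⟨G, hG, -⟩ := hcomm cs.length φ hφ v
  rw [map_sub, h φ hφ v G hG, h' φ hφ v G hG, sub_self]

theorem isIntegralOperator_integralOperator {cs : List Contour} {σ : Equiv.Perm (Fin cs.length)}
    {T : Module.End ℂ V} (h : IsIntegralOperator D q x cs σ T) :
    IsIntegralOperator D q x cs σ (integralOperator D q x cs σ) :=
  Classical.epsilon_spec (p := IsIntegralOperator D q x cs σ) ⟨T, h⟩

theorem IsIntegralOperator.integralOperator_eq (hD : ∀ v : V, (∀ φ ∈ D, φ v = 0) → v = 0)
    (hcomm : IsAlmostCommutative D q x) {cs : List Contour} {σ : Equiv.Perm (Fin cs.length)}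
    {T : Module.End ℂ V} (h : IsIntegralOperator D q x cs σ T) : integralOperator D q x cs σ = T :=
  (isIntegralOperator_integralOperator h).unique hD hcomm h

theorem isIntegralOperator_nil (σ : Equiv.Perm (Fin ([] : List Contour).length)) :
    IsIntegralOperator D q x [] σ 1 := by
  intro φ _ v G hG
  obtain ⟨R, -, hR⟩ := hG.expansion
  have hsum := hR Fin.elim0 ⟨fun i => i.elim0, fun i => i.elim0⟩
  have : Unique (Fin ([] : List Contour).length → ℤ) := inferInstanceAs (Unique (Fin 0 → ℤ))
  have hvalue := hsum.unique (hasSum_unique _)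
  simp only [List.length_nil, Finset.univ_eq_empty, Finset.prod_empty, mul_one] at hvalue
  rw [iteratedIntegral, show Fin.elim0 ∘ σ = Fin.elim0 from funext fun i => i.elim0, hvalue]
  rfl

theorem adq_single (k l : ℕ) :
    adq (Finsupp.single ⟨List.replicate k .C, List.replicate l .C'⟩ 1) =
      Finsupp.single ⟨List.replicate (k + 1) .C, List.replicate l .C'⟩ 1 -
        Finsupp.single ⟨List.replicate k .C, List.replicate (l + 1) .C'⟩ 1 := by
  simp [adq, List.replicate_succ]

theorem adq_pow_single (n : ℕ) :
    (adq ^ n) (Finsupp.single ⟨[], []⟩ 1) =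
      ∑ p ∈ Finset.HasAntidiagonal.antidiagonal n, n.choose p.1 • ((-1 : ℂ) ^ p.2 •
        Finsupp.single (⟨List.replicate p.1 .C, List.replicate p.2 .C'⟩ : IntegralTerm)
          (1 : ℂ)) := by
  induction n with
  | zero =>
    rw [Finset.Nat.antidiagonal_zero, Finset.sum_singleton, Nat.choose_self, one_smul, pow_zero,
      pow_zero, one_smul]
    rfl
  | succ n ih =>
    rw [Finset.sum_antidiagonal_choose_succ_nsmul
      (fun k l => (-1 : ℂ) ^ l • Finsupp.single
        (⟨List.replicate k .C, List.replicate l .C'⟩ : IntegralTerm) (1 : ℂ)) n,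
      pow_succ', Module.End.mul_apply, ih, map_sum, ← Finset.sum_add_distrib]
    refine Finset.sum_congr rfl fun p hp => ?_
    have hn := Finset.HasAntidiagonal.mem_antidiagonal.1 hp
    rw [Nat.choose_symm_of_eq_add hn.symm, map_nsmul, map_smul, adq_single, smul_sub, smul_sub,
      pow_succ, mul_neg_one, neg_smul, smul_neg]
    abel

theorem adqPow_eq_sum (D : Submodule ℂ (Module.Dual ℂ V)) (q : ℂ) (x : ℤ → Module.End ℂ V)
    (n : ℕ) (A : Module.End ℂ V) :
    adqPow D q x n A = ∑ p ∈ Finset.HasAntidiagonal.antidiagonal n, n.choose p.1 •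
      ((-1 : ℂ) ^ p.2 • (integralOperator D q x (List.replicate p.1 .C) 1 * A *
        integralOperator D q x (List.replicate p.2 .C') Fin.revPerm)) := by
  change Finsupp.linearCombination ℂ (fun t => IntegralTerm.value D q x A t)
    ((adq ^ n) (Finsupp.single ⟨[], []⟩ 1)) = _
  rw [adq_pow_single, map_sum]
  refine Finset.sum_congr rfl fun p _ => ?_
  rw [map_nsmul, map_smul, Finsupp.linearCombination_single, one_smul]
  rfl

theorem exists_isIntegralOperator_replicate (hD : ∀ v : V, (∀ φ ∈ D, φ v = 0) → v = 0)
    (hq0 : q ≠ 0) (hq : ∀ n : ℕ, 0 < n → q ^ n ≠ 1) (hcomm : IsAlmostCommutative D q x) :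
    ∃ L R : ℕ → Module.End ℂ V,
      (∀ n, IsIntegralOperator D q x (List.replicate n .C) 1 ((n.factorial : ℂ) • L n)) ∧
      (∀ n, IsIntegralOperator D q x (List.replicate n .C') Fin.revPerm
        ((n.factorial : ℂ) • R n)) ∧
      ∀ n, ∑ p ∈ Finset.HasAntidiagonal.antidiagonal (n + 1),
        (-1 : ℂ) ^ p.2 • (L p.1 * R p.2) = 0 := by
  choose c e hc using exists_isSymmetrizer hq
  let L n := modePolynomial x (rename Fin.revPerm (c n * qVandermonde q n)) (e n)
  let R n := modePolynomial x (c n * qVandermonde q n) (e n)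
  refine ⟨L, R, fun n => ?_, fun n => ?_,
    sum_antidiagonal_modePolynomial_mul_eq_zero hD hq0 hcomm hc⟩
  · exact congrArg (fun m => (m.factorial : ℂ) • L m) List.length_replicate ▸
      isIntegralOperator_C hq0 hq hcomm (fun _ => List.eq_of_mem_replicate) (hc _) 1
  · exact congrArg (fun m => (m.factorial : ℂ) • R m) List.length_replicate ▸
      isIntegralOperator_C' hq0 hq hcomm (fun _ => List.eq_of_mem_replicate) (hc _) Fin.revPerm

theorem mk_mul_mk_neg_one_pow_smul (𝕜 : Type*) {R : Type*} [CommRing 𝕜] [Ring R] [Algebra 𝕜 R]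
    {a b : ℕ → R} (ha : a 0 = 1) (hb : b 0 = 1)
    (h : ∀ n, ∑ p ∈ Finset.HasAntidiagonal.antidiagonal (n + 1),
      (-1 : 𝕜) ^ p.2 • (a p.1 * b p.2) = 0) :
    PowerSeries.mk a * PowerSeries.mk (fun n => (-1 : 𝕜) ^ n • b n) = 1 := by
  ext n
  simp only [PowerSeries.coeff_mul, PowerSeries.coeff_mk, mul_smul_comm]
  cases n with
  | zero => simp [ha, hb]
  | succ n => rw [h, PowerSeries.coeff_one, if_neg n.succ_ne_zero]

theorem inv_factorial_smul_sum_choose_smul {𝕜 R : Type*} [Field 𝕜] [CharZero 𝕜] [Ring R]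
    [Algebra 𝕜 R] (a b : ℕ → R) (A : R) (n : ℕ) :
    ((n.factorial : 𝕜)⁻¹) • ∑ p ∈ Finset.HasAntidiagonal.antidiagonal n, n.choose p.1 •
        ((-1 : 𝕜) ^ p.2 • ((p.1.factorial : 𝕜) • a p.1 * A * (p.2.factorial : 𝕜) • b p.2)) =
      PowerSeries.coeff n (PowerSeries.mk a * PowerSeries.C A *
        PowerSeries.mk fun n => (-1 : 𝕜) ^ n • b n) := by
  rw [PowerSeries.coeff_mul, Finset.smul_sum]
  refine Finset.sum_congr rfl fun p hp => ?_
  have hchoose : (n.choose p.1 : 𝕜) * p.1.factorial * p.2.factorial = n.factorial := by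
    rw [← Finset.HasAntidiagonal.mem_antidiagonal.1 hp, Nat.choose_symm_add]
    exact_mod_cast Nat.add_choose_mul_factorial_mul_factorial p.1 p.2
  rw [PowerSeries.coeff_mul_C, PowerSeries.coeff_mk, PowerSeries.coeff_mk,
    ← Nat.cast_smul_eq_nsmul 𝕜]
  simp only [smul_mul_assoc, mul_smul_comm, smul_smul]
  congr 1
  have hfactorial : (n.factorial : 𝕜) ≠ 0 := Nat.cast_ne_zero.2 n.factorial_ne_zero
  field_simp
  rw [← hchoose]
  ring

end OrderedExponential

end QExp

end

open QExp in
theorem mainTheorem6_general {V : Type*} [AddCommGroup V] [Module ℂ V]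
    {D : Submodule ℂ (Module.Dual ℂ V)} {q : ℂ} {x : ℤ → Module.End ℂ V}
    (hD : ∀ v : V, (∀ φ ∈ D, φ v = 0) → v = 0) (hq0 : q ≠ 0)
    (hq : ∀ n : ℕ, 0 < n → q ^ n ≠ 1) (hcomm : IsAlmostCommutative D q x)
    (A : Module.End ℂ V) :
    (∀ n : ℕ, IsIntegralOperator D q x (List.replicate n Contour.C) 1
      (integralOperator D q x (List.replicate n Contour.C) 1)) ∧
    (∀ n : ℕ, IsIntegralOperator D q x (List.replicate n Contour.C') Fin.revPerm
      (integralOperator D q x (List.replicate n Contour.C') Fin.revPerm)) ∧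
    IsUnit (orderedExp D q x) ∧
    orderedExp D q x * PowerSeries.C A * Ring.inverse (orderedExp D q x) =
      PowerSeries.mk fun n => ((n.factorial : ℂ)⁻¹) • adqPow D q x n A := by
  obtain ⟨L, R, hL, hR, hLR⟩ := exists_isIntegralOperator_replicate hD hq0 hq hcomm
  have hL0 : L 0 = 1 := by simpa using (hL 0).unique hD hcomm (isIntegralOperator_nil 1)
  have hR0 : R 0 = 1 := by simpa using (hR 0).unique hD hcomm (isIntegralOperator_nil _)
  have hE : orderedExp D q x = PowerSeries.mk L := by
    ext n : 1
    rw [orderedExp, PowerSeries.coeff_mk, PowerSeries.coeff_mk,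
      (hL n).integralOperator_eq hD hcomm,
      inv_smul_smul₀ (Nat.cast_ne_zero.2 n.factorial_ne_zero)]
  have hunit : IsUnit (orderedExp D q x) := by
    rw [hE, PowerSeries.isUnit_iff_constantCoeff, PowerSeries.constantCoeff_mk, hL0]
    exact isUnit_one
  refine ⟨fun n => isIntegralOperator_integralOperator (hL n),
    fun n => isIntegralOperator_integralOperator (hR n), hunit, ?_⟩
  have hinv : 1 = orderedExp D q x * PowerSeries.mk fun n => (-1 : ℂ) ^ n • R n := by
    rw [hE, mk_mul_mk_neg_one_pow_smul ℂ hL0 hR0 hLR]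
  rw [← mul_one (Ring.inverse _), (Ring.inverse_mul_eq_iff_eq_mul _ _ _ hunit).2 hinv, hE]
  ext n : 1
  simp only [PowerSeries.coeff_mk, adqPow_eq_sum, (hL _).integralOperator_eq hD hcomm,
    (hR _).integralOperator_eq hD hcomm, inv_factorial_smul_sum_choose_smul]

theorem mainTheorem6 {V : Type*} [AddCommGroup V] [Module ℂ V]
    (D : Submodule ℂ (Module.Dual ℂ V))
    (hD : ∀ v : V, (∀ φ ∈ D, φ v = 0) → v = 0)
    (q : ℂ) (hq0 : q ≠ 0) (hq : ∀ n : ℕ, 0 < n → q ^ n ≠ 1)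
    (x : ℤ → Module.End ℂ V)
    (hx : ∀ v : V, ∃ N : ℤ, ∀ m : ℤ, N ≤ m → x m v = 0)
    (hcomm : QExp.IsAlmostCommutative D q x)
    (A : Module.End ℂ V) :
    (∀ n : ℕ, QExp.IsIntegralOperator D q x (List.replicate n QExp.Contour.C) 1
      (QExp.integralOperator D q x (List.replicate n QExp.Contour.C) 1)) ∧
    (∀ n : ℕ, QExp.IsIntegralOperator D q x (List.replicate n QExp.Contour.C') Fin.revPerm
      (QExp.integralOperator D q x (List.replicate n QExp.Contour.C') Fin.revPerm)) ∧
    IsUnit (QExp.orderedExp D q x) ∧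
    QExp.orderedExp D q x * PowerSeries.C A * Ring.inverse (QExp.orderedExp D q x) =
      PowerSeries.mk fun n => ((n.factorial : ℂ)⁻¹) • QExp.adqPow D q x n A :=
  mainTheorem6_general hD hq0 hq hcomm A
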